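/- A rateless code is a pair of deterministic maps: an encoder that sends each word $m\in\{0,1\}^k$ ($k\in\mathbb N$) to an infinite bit sequence $\mathrm{enc}(m,1),\mathrm{enc}(m,2),\dots$, and a decoder that sends each $y\in\{0,1\}^n$ and each $k$ to a word $\mathrm{dec}(y,k)\in\{0,1\}^k$. Write $\mathrm{enc}(m,[1:n])$ for the first $n$ bits of the encoding, and $$\mathrm{err}(p,k,n)=\max_{m\in\{0,1\}^k}\Pr_{e}\bigl[\mathrm{dec}(\mathrm{enc}(m,[1:n])+e,\,k)\neq m\bigr],$$ where $e\in\{0,1\}^n$ has independent coordinates, each equal to $1$ with probability $p$. Let $H(p)=-p\log_2p-(1-p)\log_2(1-p)$. **Greedy matrix.** For each $k$, define rows $R_1,R_2,\dots\in\mathrm{GF}(2)^k$ as follows. $R_1,\dots,R_k$ are the rows of the identity matrix, and $M=\emptyset$ at the start. For $n=k,k+1,\dots$: let $W_{i,n}$ be the set of $x\in\mathrm{GF}(2)^k$ for which exactly $i$ of $R_1\cdot x,\dots,R_n\cdot x$ equal $1$; for every $1\le i\le n$ with $|W_{i,n}\setminus M|<2n^2$ add all of $W_{i,n}$ to $M$;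 then let $\widehat W_{i,n}=W_{i,n}\setminus M$, let $d$ be the least positive integer with $W_{d,n}\ne\emptyset$, and let $R_{n+1}$ be the lexicographically first $R\in\mathrm{GF}(2)^k$ such that, for all $1\le i\le n$, $$\Bigl(\tfrac12-\tfrac1{2\sqrt n}\Bigr)|\widehat W_{i,n}|\le|\{s\in\widehat W_{i,n}: s\cdot R=1\}|\le\Bigl(\tfrac12+\tfrac1{2\sqrt n}\Bigr)|\widehat W_{i,n}|,$$ and such that $|\{s\in W_{d,n}:s\cdot R=1\}|\ge\tfrac18|W_{d,n}|$ (the last condition is void for $k=0$). **Theorem.** For every $k$ and $n\ge k$ a suitable vector $R_{n+1}$ exists, so the greedy matrix is well defined. There is a rateless code $(\mathrm{enc},\mathrm{dec})$ such that: 1. it is linear, with generator matrix the greedy matrix, that is, $\mathrm{enc}(m,i)=R_i\cdot m$; it is systematic, that is, $\mathrm{enc}(m,[1:k])=m$ for $m\in\{0,1\}^k$; and $\mathrm{dec}$ is maximum-likelihood decoding, that is, $\mathrm{dec}(y,k)$ is always a word whose $n$-bit codeword is closest to $y$ in Hamming distance; 2. for every $p\in(0,\tfrac12)$ and $\delta\in(0,1-H(p))$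 there is a constant $c>0$, depending only on $p$ and $\delta$, such that $\mathrm{err}(p,k,n)\le e^{-c\,n/\log n}$ for all $k$ and all $n\ge2$ with $n\ge k/(1-H(p)-\delta)$; 3. on a random access machine with unit-cost operations ($+$, truncated $-$, $\times$, integer division, comparison, indirect addressing) on words of $O(k+\log n)$ bits, one program computes $\mathrm{enc}(m,[1:n])$ from $k$, $n$, $m\in\{0,1\}^k$, and another computes $\mathrm{dec}(y,k)$ from $k$, $n$, $y\in\{0,1\}^n$, both in time $O(nk\cdot2^{2k})$ for all $k,n\ge1$, with absolute constants. -/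

import Mathlib

open scoped BigOperators

noncomputable section

namespace Rateless

/-- Binary words of length `l`, as vectors over the field with two elements. -/
abbrev Word (l : ℕ) : Type := Fin l → ZMod 2

/-- A (deterministic) rateless code. `enc k m i` is the bit in position `i` of the infinite encoding
of the `k`-bit information word `m`, where positions are counted from `0`. `dec n k y` is the
`k`-bit information word to which the noisy codeword `y` of length `n` is decoded. -/
structure RatelessCode where
  enc : (k : ℕ) → Word k → ℕ → ZMod 2
  dec : (n k : ℕ) → Word n → Word k

namespace RatelessCode

/-- The `n`-bit prefix of the encoding of `m`. -/
def encPrefix (C : RatelessCode) {k : ℕ} (n : ℕ) (m : Word k) : Word n :=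
  fun i => C.enc k m i

/-- `G k` is a generator matrix, with rows `G k 0, G k 1, …`, of the code for `k`-bit words. In
particular the code is linear. -/
def IsGeneratedBy (C : RatelessCode) (G : (k : ℕ) → ℕ → Word k) : Prop :=
  ∀ (k : ℕ) (m : Word k) (i : ℕ), C.enc k m i = G k i ⬝ᵥ m

/-- The first `k` bits of the encoding of a `k`-bit word are the word itself. -/
def IsSystematic (C : RatelessCode) : Prop :=
  ∀ (k : ℕ) (m : Word k), C.encPrefix k m = m

/-- Maximum-likelihood decoding: a received word `y` of length `n` is decoded to an information
word whose `n`-bit codeword is closest to `y` in Hamming distance. -/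
def IsMaximumLikelihood (C : RatelessCode) : Prop :=
  ∀ (n k : ℕ) (y : Word n) (m : Word k),
    hammingDist y (C.encPrefix n (C.dec n k y)) ≤ hammingDist y (C.encPrefix n m)

end RatelessCode

/-! ### The binary symmetric channel and the error function -/

/-- The probability of the noise vector `e` over the binary symmetric channel: the coordinates are
independent, and each of them is `1` with probability `p`. -/
def bscProb (p : ℝ) {n : ℕ} (e : Word n) : ℝ :=
  ∏ i, if e i = 1 then p else 1 - p

/-- The error function: the maximum over the `k`-bit words `m` of the probability that `m` is
decoded incorrectly from its noisy `n`-bit codeword. -/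
def RatelessCode.errorProb (C : RatelessCode) (p : ℝ) (k n : ℕ) : ℝ :=
  ⨆ m : Word k, ∑ e : Word n with C.dec n k (C.encPrefix n m + e) ≠ m, bscProb p e

/-- The binary entropy function, in bits. -/
def entropy (p : ℝ) : ℝ :=
  -p * Real.logb 2 p - (1 - p) * Real.logb 2 (1 - p)

/-! ### The greedy construction of the generator matrix -/

section Greedy

variable {k : ℕ}

/-- `W_{i,n}`: the information words whose codeword, under the first `n` rows, has weight `i`. -/
def weightClass (R : ℕ → Word k) (n i : ℕ) : Finset (Word k) :=
  {x | hammingNorm (fun j : Fin n => R j ⬝ᵥ x) = i}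

/-- The words of `S` that are not orthogonal to `r`. -/
def elevated (r : Word k) (S : Finset (Word k)) : Finset (Word k) :=
  {s ∈ S | s ⬝ᵥ r = 1}

/-- `r` `ε`-splits `S`. -/
def Splits (ε : ℝ) (r : Word k) (S : Finset (Word k)) : Prop :=
  (1 / 2 - ε) * (S.card : ℝ) ≤ ((elevated r S).card : ℝ) ∧
    ((elevated r S).card : ℝ) ≤ (1 / 2 + ε) * (S.card : ℝ)

/-- `r` `ε`-elevates `S`. -/
def Elevates (ε : ℝ) (r : Word k) (S : Finset (Word k)) : Prop :=
  ε * (S.card : ℝ) ≤ ((elevated r S).card : ℝ)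

/-- The set of marked words after `t` iterations; iteration `t` (counted from `0`) has `n = k + t`
rows at its disposal and marks every weight class that has less than `2 n ^ 2` unmarked words. -/
def marked (R : ℕ → Word k) : ℕ → Finset (Word k)
  | 0 => ∅
  | t + 1 => marked R t ∪ (Finset.Icc 1 (k + t)).biUnion fun i =>
      if (weightClass R (k + t) i \ marked R t).card < 2 * (k + t) ^ 2
      then weightClass R (k + t) i else ∅

/-- `r` is a suitable next row in iteration `t`, where `n = k + t` rows are present: it
`1 / (2 √n)`-splits the unmarked part of every weight class and `1 / 8`-elevates the class of the
minimum positive weight. -/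
def Suitable (R : ℕ → Word k) (t : ℕ) (r : Word k) : Prop :=
  (∀ i ∈ Finset.Icc 1 (k + t),
    Splits (1 / (2 * √((k + t : ℕ) : ℝ))) r (weightClass R (k + t) i \ marked R (t + 1))) ∧
  ∀ d, IsLeast {d : ℕ | 0 < d ∧ (weightClass R (k + t) d).Nonempty} d →
    Elevates (1 / 8) r (weightClass R (k + t) d)

/-- Strict lexicographic order on words, `0` before `1`. -/
def LexLT (r s : Word k) : Prop :=
  ∃ j, (∀ i < j, r i = s i) ∧ r j = 0 ∧ s j = 1

/-- `R` is the (infinite) matrix computed by the greedy algorithm: the first `k` rows form the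
identity matrix, and each later row is the lexicographically first suitable vector (in particular,
a suitable vector always exists). -/
def IsGreedyMatrix (R : ℕ → Word k) : Prop :=
  (∀ i : Fin k, R i = Pi.single i 1) ∧
  ∀ t, Suitable R t (R (k + t)) ∧ ∀ r, Suitable R t r → r ≠ R (k + t) → LexLT (R (k + t)) r

end Greedy

/-! ### A random access machine with unit-cost operations on `w`-bit words -/

/-- The arithmetic operations of the machine. -/
inductive ArithOp
  | add
  | sub
  | mul
  | div

/-- Natural-number arithmetic; subtraction is truncated at `0` and division rounds down. -/
def ArithOp.eval : ArithOp → ℕ → ℕ → ℕ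
  | add, a, b => a + b
  | sub, a, b => a - b
  | mul, a, b => a * b
  | div, a, b => a / b

/-- Programs. Registers and arrays are named by numerals that are fixed in the program text, so
a program uses finitely many of each; array cells are addressed indirectly, through registers. -/
inductive Program
  /-- `r := v` -/
  | const (r v : ℕ)
  /-- `r := a op b` -/
  | arith (op : ArithOp) (r a b : ℕ)
  /-- `r := A[i]` -/
  | load (r A i : ℕ)
  /-- `A[i] := r` -/
  | store (A i r : ℕ)
  /-- `P; Q` -/
  | seq (P Q : Program)
  /-- `if a < b then P else Q` -/
  | branch (a b : ℕ) (P Q : Program)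
  /-- `while a < b do P` -/
  | loop (a b : ℕ) (P : Program)

/-- The memory of the machine: the contents of the registers and of the cells of the arrays. -/
structure MachineState where
  reg : ℕ → ℕ
  mem : ℕ → ℕ → ℕ

/-- Overwrite register `r`. -/
def MachineState.setReg (s : MachineState) (r v : ℕ) : MachineState :=
  { s with reg := Function.update s.reg r v }

/-- Overwrite the cell with address `i` of array `A`. -/
def MachineState.setMem (s : MachineState) (A i v : ℕ) : MachineState :=
  { s with mem := Function.update s.mem A (Function.update (s.mem A) i v) }

/-- `Run w P s s' t`: on the machine with `w`-bit words, program `P` started in state `s` halts in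
state `s'` after exactly `t` steps. Every elementary operation and every test takes one step. An
operation whose result does not fit into a word blocks the machine. -/
inductive Run (w : ℕ) : Program → MachineState → MachineState → ℕ → Prop
  | const (s : MachineState) (r v : ℕ) (h : v < 2 ^ w) :
      Run w (.const r v) s (s.setReg r v) 1
  | arith (s : MachineState) (op : ArithOp) (r a b : ℕ)
      (h : op.eval (s.reg a) (s.reg b) < 2 ^ w) :
      Run w (.arith op r a b) s (s.setReg r (op.eval (s.reg a) (s.reg b))) 1
  | load (s : MachineState) (r A i : ℕ) :
      Run w (.load r A i) s (s.setReg r (s.mem A (s.reg i))) 1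
  | store (s : MachineState) (A i r : ℕ) :
      Run w (.store A i r) s (s.setMem A (s.reg i) (s.reg r)) 1
  | seq {P Q : Program} {s s' s'' : MachineState} {t t' : ℕ}
      (hP : Run w P s s' t) (hQ : Run w Q s' s'' t') :
      Run w (.seq P Q) s s'' (t + t')
  | branch_true {a b : ℕ} {P Q : Program} {s s' : MachineState} {t : ℕ}
      (h : s.reg a < s.reg b) (hP : Run w P s s' t) :
      Run w (.branch a b P Q) s s' (t + 1)
  | branch_false {a b : ℕ} {P Q : Program} {s s' : MachineState} {t : ℕ}
      (h : ¬ s.reg a < s.reg b) (hQ : Run w Q s s' t) :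
      Run w (.branch a b P Q) s s' (t + 1)
  | loop_true {a b : ℕ} {P : Program} {s s' s'' : MachineState} {t t' : ℕ}
      (h : s.reg a < s.reg b) (hP : Run w P s s' t) (hL : Run w (.loop a b P) s' s'' t') :
      Run w (.loop a b P) s s'' (t + t' + 1)
  | loop_false {a b : ℕ} {P : Program} {s : MachineState} (h : ¬ s.reg a < s.reg b) :
      Run w (.loop a b P) s s 1

/-- The initial state: registers `0` and `1` hold `k` and `n`, array `0` starts with the input
bits, and everything else is `0`. -/
def initialState (k n : ℕ) {l : ℕ} (x : Word l) : MachineState where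
  reg r := if r = 0 then k else if r = 1 then n else 0
  mem A i := if h : A = 0 ∧ i < l then (x ⟨i, h.2⟩).val else 0

/-- On `w`-bit words and parameters `k`, `n`, program `P` maps the input `x` to the output `z`,
written to the beginning of array `1`, within at most `T` steps. -/
def ComputesWithin (P : Program) (w k n : ℕ) {l l' : ℕ} (x : Word l) (z : Word l') (T : ℕ) :
    Prop :=
  ∃ s t, Run w P (initialState k n x) s t ∧ t ≤ T ∧ ∀ i : Fin l', s.mem 1 i = (z i).val

/-- The `n`-bit prefixes of the encodings of `k`-bit words are computed by one program in time
`O(T k n)` on words of `O(k + log n)` bits. -/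
def RatelessCode.EncodesInTime (C : RatelessCode) (T : ℕ → ℕ → ℕ) : Prop :=
  ∃ (P : Program) (c : ℕ), ∀ k n : ℕ, 1 ≤ k → 1 ≤ n → ∀ m : Word k,
    ComputesWithin P (c * (k + Nat.log 2 n + 1)) k n m (C.encPrefix n m) (c * T k n)

/-- Noisy `n`-bit codewords are decoded to `k`-bit words by one program in time `O(T k n)` on words
of `O(k + log n)` bits. -/
def RatelessCode.DecodesInTime (C : RatelessCode) (T : ℕ → ℕ → ℕ) : Prop :=
  ∃ (P : Program) (c : ℕ), ∀ k n : ℕ, 1 ≤ k → 1 ≤ n → ∀ y : Word n,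
    ComputesWithin P (c * (k + Nat.log 2 n + 1)) k n y (C.dec n k y) (c * T k n)

end Rateless

end

/-! Existence of rows. For distinct words `s` and `s'` the signs of `s ⬝ᵥ r` and `s' ⬝ᵥ r` are
orthogonal as functions of a uniform `r`, so Chebyshev's inequality controls how unevenly `r` cuts a
set. An unmarked class has at least `2 n ^ 2` words, hence fewer than a fraction `1 / (2 n)` of all
vectors fail to split it, and over the `n` classes fewer than half fail somewhere. At most half of
all vectors fail to elevate the class of minimum weight. So some vector passes every condition
(`exists_suitable`). The price is the marking: at most `2 n ^ 4` words are exempt from splitting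
(`card_marked_le`).

Spectrum. A split class sends about half of its words one weight up and keeps the other half, which
is Pascal's rule up to a factor `1 + 1 / √n`. These factors multiply to at most `exp (3 √n)`, so the
unmarked words are spread over the weights as in a random code, up to a subexponential factor
(`card_unmarked_le`). Below capacity this leaves less than one unmarked word in each class of small
weight, so all light words are marked and there are only polynomially many of them
(`weightClass_subset_marked`). Elevation removes an eighth of the lightest class with each row, so
the class is empty after `O(log n)` rows. With a linear number of spare rows the minimum distance
reaches order `n / log n` (`min_weight_lower_bound`).

Error. A decoding error needs a nonzero codeword that does not increase the weight of the noise when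
added to it. Either the noise is atypically heavy (Chernoff), or an unmarked word is responsible
(random-coding bound, exponentially small below capacity), or one of the few marked words is (union
and Bhattacharyya bounds with the minimum distance). See `error_le`. Only the last case has an
exponent as small as `n / log n`.

Complexity. All loops of a greedy step run over the `2 ^ k` words and not over weights; weights and
marks are kept in tables, and parities of inner products are looked up. Each of the `n` rows costs
at most `2 ^ k` candidates times `O(2 ^ k)` steps, and building the table costs `O(k 4 ^ k)` once.
Correctness of the search rests on `exists_suitable`; the programs are verified by a
weakest-precondition calculus (`WP`, `wp_for`) that also counts steps. -/

noncomputable section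

namespace Rateless

/-! ### Random vectors split sets of words -/

/-- The nontrivial additive character of the field with two elements. -/
def sign (z : ZMod 2) : ℤ := if z = 1 then -1 else 1

theorem sign_add (a b : ZMod 2) : sign (a + b) = sign a * sign b := by
  revert a b; decide

theorem word_add_self {k : ℕ} (x : Word k) : x + x = 0 :=
  funext fun i => CharTwo.add_self_eq_zero (x i)

theorem word_eq_of_add_eq_zero {k : ℕ} {x y : Word k} (h : x + y = 0) : x = y :=
  funext fun i => CharTwo.add_eq_zero.mp (congrFun h i)

/-- If `x i = 1`, translation of `r` by the `i`-th unit vector flips every sign, so the sum equals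
its own negative. -/
theorem sum_sign_dotProduct {k : ℕ} {x : Word k} (hx : x ≠ 0) :
    ∑ r : Word k, sign (x ⬝ᵥ r) = 0 := by
  obtain ⟨i, hi⟩ : ∃ i, x i ≠ 0 := Function.ne_iff.mp hx
  have hi : x i = 1 := by
    revert hi; generalize x i = z; revert z; decide
  have h := Equiv.sum_comp (Equiv.addRight (Pi.single i 1 : Word k))
    (fun r => sign (x ⬝ᵥ r))
  have h2 : ∀ r : Word k, sign (x ⬝ᵥ (Equiv.addRight (Pi.single i 1 : Word k) r)) =
      - sign (x ⬝ᵥ r) := by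
    intro r
    rw [Equiv.coe_addRight, dotProduct_add, sign_add]
    simp [hi, sign]
  rw [Finset.sum_congr rfl fun r _ => h2 r, Finset.sum_neg_distrib] at h
  linarith

theorem sum_sign_eq {k : ℕ} (r : Word k) (S : Finset (Word k)) :
    ∑ s ∈ S, sign (s ⬝ᵥ r) = (S.card : ℤ) - 2 * ((elevated r S).card : ℤ) := by
  have h : ∀ z : ZMod 2, sign z = 1 - 2 * (if z = 1 then 1 else 0) := by decide
  simp only [h, Finset.sum_sub_distrib, ← Finset.mul_sum, elevated, Finset.card_filter]
  simp

/-- The deviation is a sum of characters. After squaring, a pair `s`, `s'` contributes the character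
sum of `s + s'`, which vanishes unless `s = s'`. Thus the variance is that of independent fair
coins. -/
theorem sum_sq_deviation {k : ℕ} (S : Finset (Word k)) :
    ∑ r : Word k, ((S.card : ℤ) - 2 * ((elevated r S).card : ℤ)) ^ 2 = (S.card : ℤ) * 2 ^ k := by
  have h : ∀ r : Word k, ((S.card : ℤ) - 2 * ((elevated r S).card : ℤ)) ^ 2 =
      ∑ s ∈ S, ∑ s' ∈ S, sign ((s + s') ⬝ᵥ r) := by
    intro r
    rw [← sum_sign_eq, sq, Finset.sum_mul_sum]
    simp only [add_dotProduct, sign_add]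
  simp only [h]
  rw [Finset.sum_comm]
  have h3 : ∀ s ∈ S, ∑ r : Word k, ∑ s' ∈ S, sign ((s + s') ⬝ᵥ r) = 2 ^ k := by
    intro s hs
    rw [Finset.sum_comm, Finset.sum_eq_single_of_mem s hs]
    · have : s + s = 0 := word_add_self s
      simp [this, sign]
    · intro s' _ hne
      apply sum_sign_dotProduct
      intro h0
      exact hne (word_eq_of_add_eq_zero h0).symm
  rw [Finset.sum_congr rfl h3]
  simp

/-- Chebyshev's inequality for the splitting of a set by a random vector. -/
theorem card_deviating_lt {k : ℕ} (S : Finset (Word k)) {a : ℝ}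
    (hS : 0 < S.card) (F : Finset (Word k))
    (hF : ∀ r ∈ F, a < ((S.card : ℝ) - 2 * ((elevated r S).card : ℝ)) ^ 2) :
    a * F.card < (S.card : ℝ) * 2 ^ k := by
  have hs : ∑ r : Word k, ((S.card : ℝ) - 2 * ((elevated r S).card : ℝ)) ^ 2 = (S.card : ℝ) * 2 ^ k := by
    exact_mod_cast sum_sq_deviation S
  -- The inequality has to be strict: in `exists_suitable` the bounds for splitting and for
  -- elevation would otherwise add up to exactly `2 ^ k`. For empty `F` strictness comes from `S`
  -- being nonempty.
  rcases F.eq_empty_or_nonempty with rfl | hne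
  · simp only [Finset.card_empty, Nat.cast_zero, mul_zero]
    positivity
  · calc a * F.card = ∑ _r ∈ F, a := by simp [mul_comm]
      _ < ∑ r ∈ F, ((S.card : ℝ) - 2 * ((elevated r S).card : ℝ)) ^ 2 :=
          Finset.sum_lt_sum_of_nonempty hne hF
      _ ≤ ∑ r : Word k, ((S.card : ℝ) - 2 * ((elevated r S).card : ℝ)) ^ 2 :=
          Finset.sum_le_univ_sum_of_nonneg fun r => sq_nonneg _
      _ = _ := hs

theorem splits_of_sq_le {k n : ℕ} (hn : 0 < n) {r : Word k} {S : Finset (Word k)}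
    (h : (n : ℝ) * ((S.card : ℝ) - 2 * ((elevated r S).card : ℝ)) ^ 2 ≤ (S.card : ℝ) ^ 2) :
    Splits (1 / (2 * √(n : ℝ))) r S := by
  have hq : 0 < √(n : ℝ) := by positivity
  have hsq : √(n : ℝ) ^ 2 = n := Real.sq_sqrt (by positivity)
  have h2 : (√(n : ℝ) * ((S.card : ℝ) - 2 * ((elevated r S).card : ℝ))) ^ 2 ≤ (S.card : ℝ) ^ 2 := by
    rw [mul_pow, hsq]; exact h
  have h3 := abs_le_of_sq_le_sq' h2 (by positivity)
  have e1 : (1 / 2 - 1 / (2 * √(n : ℝ))) * (S.card : ℝ) =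
      (√(n : ℝ) * S.card - S.card) / (2 * √(n : ℝ)) := by field_simp
  have e2 : (1 / 2 + 1 / (2 * √(n : ℝ))) * (S.card : ℝ) =
      (√(n : ℝ) * S.card + S.card) / (2 * √(n : ℝ)) := by field_simp
  constructor
  · rw [e1, div_le_iff₀ (by positivity)]; nlinarith
  · rw [e2, le_div_iff₀ (by positivity)]; nlinarith

/-- This form has no square root. It is what Chebyshev's inequality bounds, and what the program can
test in integers. -/
theorem splits_iff_sq_le {k n : ℕ} (hn : 0 < n) {r : Word k} {S : Finset (Word k)} :
    Splits (1 / (2 * √(n : ℝ))) r S ↔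
      (n : ℝ) * ((S.card : ℝ) - 2 * ((elevated r S).card : ℝ)) ^ 2 ≤ (S.card : ℝ) ^ 2 := by
  refine ⟨fun ⟨h1, h2⟩ => ?_, splits_of_sq_le hn⟩
  have hq : 0 < √(n : ℝ) := by positivity
  have hsq : √(n : ℝ) ^ 2 = n := Real.sq_sqrt (by positivity)
  have e1 : (1 / 2 - 1 / (2 * √(n : ℝ))) * (S.card : ℝ) =
      (√(n : ℝ) * S.card - S.card) / (2 * √(n : ℝ)) := by field_simp
  have e2 : (1 / 2 + 1 / (2 * √(n : ℝ))) * (S.card : ℝ) =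
      (√(n : ℝ) * S.card + S.card) / (2 * √(n : ℝ)) := by field_simp
  rw [e1, div_le_iff₀ (by positivity)] at h1
  rw [e2, le_div_iff₀ (by positivity)] at h2
  have : (√(n : ℝ) * ((S.card : ℝ) - 2 * ((elevated r S).card : ℝ))) ^ 2 ≤ (S.card : ℝ) ^ 2 := by
    apply sq_le_sq'
    · nlinarith
    · nlinarith
  rwa [mul_pow, hsq] at this

theorem splits_empty {k : ℕ} (ε : ℝ) (r : Word k) : Splits ε r ∅ := by
  simp [Splits, elevated]

-- Chebyshev leaves fewer than `n 2 ^ k / |S|` bad vectors. The threshold `2 n ^ 2` of the marking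
-- rule is chosen so that this is at most `2 ^ k / (2 n)`, which survives a union bound over `n`
-- classes.
open Classical in
theorem card_not_splits_lt {k n : ℕ} (hn : 0 < n) (S : Finset (Word k))
    (hS : S = ∅ ∨ 2 * n ^ 2 ≤ S.card) :
    ((Finset.univ.filter fun r : Word k => ¬ Splits (1 / (2 * √(n : ℝ))) r S).card : ℝ) * (2 * n) <
      2 ^ k := by
  rcases hS with rfl | hS
  · simp [splits_empty]
  · have hS0 : 0 < S.card := lt_of_lt_of_le (by positivity) hS
    have hn' : (0 : ℝ) < n := by exact_mod_cast hn
    have hS0' : (0 : ℝ) < S.card := by exact_mod_cast hS0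
    have hS' : 2 * (n : ℝ) ^ 2 ≤ S.card := by exact_mod_cast hS
    set F := Finset.univ.filter fun r : Word k => ¬ Splits (1 / (2 * √(n : ℝ))) r S
    have := card_deviating_lt S (a := (S.card : ℝ) ^ 2 / n) hS0 F (by
      intro r hr
      have hr := (Finset.mem_filter.mp hr).2
      rw [splits_iff_sq_le hn] at hr
      rw [div_lt_iff₀ hn']
      linarith)
    have h2 : (S.card : ℝ) * F.card < n * 2 ^ k := by
      have e : (S.card : ℝ) ^ 2 / n * F.card = S.card * ((S.card * F.card) / n) := by ring
      rw [e] at this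
      have := lt_of_mul_lt_mul_left this hS0'.le
      rw [div_lt_iff₀ hn'] at this
      linarith
    have h3 : 2 * (n : ℝ) ^ 2 * F.card ≤ S.card * F.card :=
      mul_le_mul_of_nonneg_right hS' (by positivity)
    have h4 : n * ((F.card : ℝ) * (2 * n)) < n * 2 ^ k := by nlinarith
    exact lt_of_mul_lt_mul_left h4 hn'.le

-- With at least four words, failure means a deviation above `3 / 4` of the size, and Chebyshev
-- gives a fraction below `16 / (9 * 4) < 1 / 2`. With fewer words, failure means that nothing is
-- elevated; then `r` is orthogonal to any chosen `s ∈ S`, and exactly half of the vectors are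
-- orthogonal to a nonzero `s`.
open Classical in
theorem card_not_elevates_le {k : ℕ} (S : Finset (Word k)) (hS : ∀ s ∈ S, s ≠ 0) :
    2 * (Finset.univ.filter fun r : Word k => ¬ Elevates (1 / 8) r S).card ≤ 2 ^ k := by
  rcases S.eq_empty_or_nonempty with rfl | hne
  · simp [Elevates, elevated]
  set F := Finset.univ.filter fun r : Word k => ¬ Elevates (1 / 8) r S
  have hF : ∀ r ∈ F, 8 * (elevated r S).card < S.card := by
    intro r hr
    have hr := (Finset.mem_filter.mp hr).2
    rw [Elevates, not_le] at hr
    have : 8 * ((elevated r S).card : ℝ) < S.card := by linarith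
    exact_mod_cast this
  have hS0 : 0 < S.card := hne.card_pos
  have hS0' : (0 : ℝ) < S.card := by exact_mod_cast hS0
  by_cases h4 : 4 ≤ S.card
  · have := card_deviating_lt S (a := (9 / 16) * (S.card : ℝ) ^ 2) hS0 F (by
      intro r hr
      have : 8 * ((elevated r S).card : ℝ) < S.card := by exact_mod_cast hF r hr
      have h2 : (3 / 4 : ℝ) * S.card < (S.card : ℝ) - 2 * ((elevated r S).card : ℝ) := by linarith
      nlinarith)
    have h4' : (4 : ℝ) ≤ S.card := by exact_mod_cast h4
    have h5 : (S.card : ℝ) * ((9 / 16) * S.card * F.card) < S.card * 2 ^ k := by nlinarith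
    have h6 := lt_of_mul_lt_mul_left h5 hS0'.le
    have h7 : (2 : ℝ) * F.card ≤ 2 ^ k := by
      have : (0 : ℝ) ≤ F.card := by positivity
      nlinarith
    exact_mod_cast h7
  · obtain ⟨s, hs⟩ := hne
    have hz := sum_sign_eq (k := k) s Finset.univ
    have hsum : ∑ r : Word k, sign (r ⬝ᵥ s) = 0 := by
      rw [← sum_sign_dotProduct (hS s hs)]
      exact Finset.sum_congr rfl fun r _ => by rw [dotProduct_comm]
    rw [hsum] at hz
    have hle : F ⊆ Finset.univ \ elevated s Finset.univ := by
      intro r hr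
      have := hF r hr
      have h0 : (elevated r S).card = 0 := by omega
      rw [Finset.card_eq_zero] at h0
      simp only [elevated, Finset.mem_sdiff, Finset.mem_univ, Finset.mem_filter, true_and]
      intro h1
      have : s ∈ elevated r S := by
        simp only [elevated, Finset.mem_filter]
        exact ⟨hs, by rw [dotProduct_comm]; exact h1⟩
      rw [h0] at this
      simp at this
    have h1 := Finset.card_le_card hle
    rw [Finset.card_sdiff_of_subset (Finset.subset_univ _)] at h1
    have hc : (Finset.univ : Finset (Word k)).card = 2 ^ k := by simp
    rw [hc] at hz h1
    have : (2 ^ k : ℤ) = 2 * ((elevated s Finset.univ).card : ℤ) := by push_cast at hz; omega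
    have : 2 ^ k = 2 * (elevated s (Finset.univ : Finset (Word k))).card := by exact_mod_cast this
    omega

/-! ### Marking, and the existence of a suitable row. -/

theorem ne_zero_of_mem_weightClass {k : ℕ} {R : ℕ → Word k} {n i : ℕ} (hi : 0 < i) {x : Word k}
    (hx : x ∈ weightClass R n i) : x ≠ 0 := by
  rintro rfl
  simp [weightClass, hammingNorm] at hx
  omega

theorem disjoint_weightClass {k : ℕ} {R : ℕ → Word k} {n i j : ℕ} (h : i ≠ j) :
    Disjoint (weightClass R n i) (weightClass R n j) := by
  rw [Finset.disjoint_left]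
  intro x hx hy
  simp only [weightClass, Finset.mem_filter, Finset.mem_univ, true_and] at hx hy
  exact h (hx.symm.trans hy)

theorem mem_marked_succ {k : ℕ} {R : ℕ → Word k} {t i : ℕ} {x : Word k}
    (hx : x ∈ weightClass R (k + t) i) :
    x ∈ marked R (t + 1) ↔ x ∈ marked R t ∨ (i ∈ Finset.Icc 1 (k + t) ∧
      (weightClass R (k + t) i \ marked R t).card < 2 * (k + t) ^ 2) := by
  rw [marked, Finset.mem_union, Finset.mem_biUnion]
  refine or_congr_right ⟨?_, ?_⟩
  · rintro ⟨j, hj, hxj⟩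
    split_ifs at hxj with h
    · have : j = i := by
        by_contra hne
        exact Finset.disjoint_left.mp (disjoint_weightClass hne) hxj hx
      subst this
      exact ⟨hj, h⟩
    · simp at hxj
  · rintro ⟨hi, h⟩
    exact ⟨i, hi, by rw [if_pos h]; exact hx⟩

/-- The classes are disjoint, so marking one does not touch another: a small class becomes fully
marked, and a large one keeps its unmarked words. This is the hypothesis of `card_not_splits_lt`. -/
theorem weightClass_sdiff_marked {k : ℕ} (R : ℕ → Word k) (t : ℕ) {i : ℕ}
    (hi : i ∈ Finset.Icc 1 (k + t)) :
    weightClass R (k + t) i \ marked R (t + 1) = ∅ ∨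
      2 * (k + t) ^ 2 ≤ (weightClass R (k + t) i \ marked R (t + 1)).card := by
  by_cases h : (weightClass R (k + t) i \ marked R t).card < 2 * (k + t) ^ 2
  · left
    rw [Finset.sdiff_eq_empty_iff_subset]
    intro x hx
    exact (mem_marked_succ hx).mpr (Or.inr ⟨hi, h⟩)
  · right
    have : weightClass R (k + t) i \ marked R (t + 1) = weightClass R (k + t) i \ marked R t := by
      ext x
      simp only [Finset.mem_sdiff]
      refine and_congr_right fun hx => ?_
      rw [mem_marked_succ hx]
      tauto
    rw [this]
    exact not_lt.mp h

theorem exists_suitable {k : ℕ} (R : ℕ → Word k) (t : ℕ) : ∃ r, Suitable R t r := by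
  classical
  by_contra hno
  push Not at hno
  set n := k + t with hn
  let F : ℕ → Finset (Word k) := fun i => Finset.univ.filter fun r : Word k =>
    ¬ Splits (1 / (2 * √(n : ℝ))) r (weightClass R n i \ marked R (t + 1))
  obtain ⟨E, hE, hEF⟩ : ∃ E : Finset (Word k), 2 * E.card ≤ 2 ^ k ∧ ∀ r, r ∉ E →
      ∀ d, IsLeast {d : ℕ | 0 < d ∧ (weightClass R n d).Nonempty} d →
        Elevates (1 / 8) r (weightClass R n d) := by
    by_cases h : ∃ d, IsLeast {d : ℕ | 0 < d ∧ (weightClass R n d).Nonempty} d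
    · obtain ⟨d, hd⟩ := h
      refine ⟨_, card_not_elevates_le (weightClass R n d)
        (fun s hs => ne_zero_of_mem_weightClass hd.1.1 hs), ?_⟩
      intro r hr d' hd'
      rw [hd'.unique hd]
      by_contra hc
      exact hr (Finset.mem_filter.mpr ⟨Finset.mem_univ _, hc⟩)
    · exact ⟨∅, by simp, fun r _ d hd => absurd ⟨d, hd⟩ h⟩
  have hcover : (Finset.univ : Finset (Word k)) ⊆ E ∪ (Finset.Icc 1 n).biUnion F := by
    intro r _
    by_contra hr
    rw [Finset.mem_union, not_or, Finset.mem_biUnion] at hr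
    apply hno r
    refine ⟨fun i hi => ?_, hEF r hr.1⟩
    by_contra hc
    exact hr.2 ⟨i, hi, by simp only [F, Finset.mem_filter, Finset.mem_univ, true_and]; exact hc⟩
  have hcard := (Finset.card_le_card hcover).trans
    ((Finset.card_union_le _ _).trans (Nat.add_le_add_left Finset.card_biUnion_le _))
  have hc : (Finset.univ : Finset (Word k)).card = 2 ^ k := by simp
  rw [hc] at hcard
  have hcard' : (2 ^ k : ℝ) ≤ E.card + ∑ i ∈ Finset.Icc 1 n, ((F i).card : ℝ) := by
    exact_mod_cast hcard
  have hE' : 2 * (E.card : ℝ) ≤ 2 ^ k := by exact_mod_cast hE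
  -- For `n = 0` there is no class to split, and the bound `2 ^ k / (2 n)` would be a division by
  -- zero.
  rcases Nat.eq_zero_or_pos n with h0 | hpos
  · rw [h0] at hcard'
    have : (0 : ℝ) < 2 ^ k := by positivity
    simp at hcard'
    linarith
  · have hpos' : (0 : ℝ) < n := by exact_mod_cast hpos
    have hlt : ∑ i ∈ Finset.Icc 1 n, ((F i).card : ℝ) < ∑ _i ∈ Finset.Icc 1 n, (2 ^ k / (2 * n) : ℝ) := by
      apply Finset.sum_lt_sum_of_nonempty
      · exact ⟨1, by simp; omega⟩
      · intro i hi
        rw [lt_div_iff₀ (by positivity)]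
        exact card_not_splits_lt hpos _ (weightClass_sdiff_marked R t hi)
    have : ∑ _i ∈ Finset.Icc 1 n, (2 ^ k / (2 * n) : ℝ) = 2 ^ k / 2 := by
      rw [Finset.sum_const, Nat.card_Icc]
      simp
      field_simp
    linarith

/-! ### Words as binary numerals -/

/-- The word of length `k` that is the binary expansion of `x`, most significant bit first. -/
def toWord (k x : ℕ) : Word k := fun j => ((x / 2 ^ (k - 1 - (j : ℕ)) : ℕ) : ZMod 2)

theorem toWord_apply_eq_one {k x : ℕ} {j : Fin k} :
    toWord k x j = 1 ↔ x.testBit (k - 1 - j) = true := by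
  rw [toWord, Nat.testBit_eq_decide_div_mod_eq, decide_eq_true_eq, ZMod.natCast_eq_one_iff_odd,
    Nat.odd_iff]

theorem toWord_apply_eq_zero {k x : ℕ} {j : Fin k} :
    toWord k x j = 0 ↔ x.testBit (k - 1 - j) = false := by
  rw [toWord, Nat.testBit_eq_decide_div_mod_eq, decide_eq_false_iff_not, ZMod.natCast_eq_zero_iff,
    Nat.dvd_iff_mod_eq_zero]
  omega

theorem testBit_eq_of_toWord {k a b : ℕ} {j : Fin k} (h : toWord k a j = toWord k b j) :
    a.testBit (k - 1 - j) = b.testBit (k - 1 - j) := by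
  have := (toWord_apply_eq_one (x := a) (j := j)).symm.trans
    ((Eq.congr_left h).trans (toWord_apply_eq_one (x := b) (j := j)))
  exact Bool.eq_iff_iff.mpr this

theorem testBit_eq_of_le {k a b i : ℕ} (ha : a < 2 ^ k) (hb : b < 2 ^ k) (hi : k ≤ i) :
    a.testBit i = b.testBit i := by
  have hp : 2 ^ k ≤ 2 ^ i := Nat.pow_le_pow_right (by norm_num) hi
  rw [Nat.testBit_eq_false_of_lt (ha.trans_le hp), Nat.testBit_eq_false_of_lt (hb.trans_le hp)]

theorem toWord_injOn {k a b : ℕ} (ha : a < 2 ^ k) (hb : b < 2 ^ k)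
    (h : toWord k a = toWord k b) : a = b := by
  apply Nat.eq_of_testBit_eq
  intro i
  by_cases hi : i < k
  · have := testBit_eq_of_toWord (congrFun h ⟨k - 1 - i, by omega⟩)
    have e : k - 1 - (k - 1 - i) = i := by omega
    simpa only [e] using this
  · exact testBit_eq_of_le ha hb (by omega)

/-- The most significant bit comes first, so lexicographic order is numerical order; the
lexicographically first suitable vector is the one with the least number. -/
theorem lt_of_lexLT_toWord {k a b : ℕ} (ha : a < 2 ^ k) (hb : b < 2 ^ k)
    (h : LexLT (toWord k a) (toWord k b)) : a < b := by
  obtain ⟨j, hj, h0, h1⟩ := h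
  refine Nat.lt_of_testBit (k - 1 - j) (toWord_apply_eq_zero.mp h0) (toWord_apply_eq_one.mp h1) ?_
  intro i hi
  by_cases hik : i < k
  · have hlt : (⟨k - 1 - i, by omega⟩ : Fin k) < j := by
      rw [Fin.lt_def]
      show k - 1 - i < j
      omega
    have := testBit_eq_of_toWord (hj _ hlt)
    have e : k - 1 - (k - 1 - i) = i := by omega
    simpa only [e] using this
  · exact testBit_eq_of_le ha hb (by omega)

theorem lexLT_or_lexLT {k : ℕ} {r s : Word k} (h : r ≠ s) : LexLT r s ∨ LexLT s r := by
  classical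
  obtain ⟨j, hj, hmin⟩ : ∃ j, r j ≠ s j ∧ ∀ i < j, r i = s i := by
    obtain ⟨i, hi⟩ := Function.ne_iff.mp h
    obtain ⟨j, hj, hm⟩ := WellFounded.has_min (wellFounded_lt (α := Fin k)) {i | r i ≠ s i} ⟨i, hi⟩
    exact ⟨j, hj, fun i hi => by_contra fun hc => hm i hc hi⟩
  have hz : ∀ a b : ZMod 2, a ≠ b → (a = 0 ∧ b = 1) ∨ (b = 0 ∧ a = 1) := by decide
  rcases hz _ _ hj with ⟨h0, h1⟩ | ⟨h0, h1⟩
  · exact Or.inl ⟨j, hmin, h0, h1⟩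
  · exact Or.inr ⟨j, fun i hi => (hmin i hi).symm, h0, h1⟩

/-- Words of length `k` are numbered by the numbers below `2 ^ k`. -/
def wordEquiv (k : ℕ) : Fin (2 ^ k) ≃ Word k :=
  Equiv.ofBijective (fun x => toWord k x) <| by
    rw [Fintype.bijective_iff_injective_and_card]
    refine ⟨fun a b h => Fin.ext (toWord_injOn a.2 b.2 h), ?_⟩
    simp

theorem exists_toWord {k : ℕ} (r : Word k) : ∃ x, x < 2 ^ k ∧ toWord k x = r :=
  ⟨(wordEquiv k).symm r, ((wordEquiv k).symm r).2, (wordEquiv k).apply_symm_apply r⟩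

theorem sum_word {k : ℕ} {M : Type*} [AddCommMonoid M] (f : Word k → M) :
    ∑ r, f r = ∑ x ∈ Finset.range (2 ^ k), f (toWord k x) := by
  rw [← Equiv.sum_comp (wordEquiv k) f, Finset.sum_range]
  rfl

theorem card_filter_word {k : ℕ} (p : Word k → Prop) [DecidablePred p] :
    (Finset.univ.filter p).card =
      ∑ x ∈ Finset.range (2 ^ k), if p (toWord k x) then 1 else 0 := by
  rw [Finset.card_filter, sum_word]

theorem toWord_eq_zero_iff {k x : ℕ} (hx : x < 2 ^ k) : toWord k x = 0 ↔ x = 0 := by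
  have h0 : toWord k 0 = 0 := by
    funext j
    simp [toWord]
  refine ⟨fun h => toWord_injOn hx (by positivity) (h.trans h0.symm), ?_⟩
  rintro rfl
  exact h0

theorem toWord_two_pow {k i : ℕ} (hi : i < k) :
    toWord k (2 ^ (k - 1 - i)) = Pi.single ⟨i, hi⟩ 1 := by
  funext j
  by_cases h : j = ⟨i, hi⟩
  · subst h
    rw [Pi.single_eq_same, toWord_apply_eq_one]
    simp
  · rw [Pi.single_eq_of_ne h, toWord_apply_eq_zero, Nat.testBit_two_pow_of_ne]
    have : (j : ℕ) ≠ i := fun hc => h (Fin.ext hc)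
    omega

/-- The inner product of two binary numerals of length `k`, before reduction modulo two. -/
def bitDot (k a b : ℕ) : ℕ := ∑ i ∈ Finset.range k, (a / 2 ^ i % 2) * (b / 2 ^ i % 2)

theorem toWord_dotProduct (k a b : ℕ) :
    toWord k a ⬝ᵥ toWord k b = ((bitDot k a b : ℕ) : ZMod 2) := by
  rw [bitDot, Nat.cast_sum, ← Finset.sum_range_reflect, Finset.sum_range, dotProduct]
  refine Finset.sum_congr rfl fun j _ => ?_
  rw [Nat.cast_mul, ZMod.natCast_mod, ZMod.natCast_mod]
  rfl

theorem toWord_dotProduct_eq_one {k a b : ℕ} :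
    toWord k a ⬝ᵥ toWord k b = 1 ↔ bitDot k a b % 2 = 1 := by
  rw [toWord_dotProduct, ZMod.natCast_eq_one_iff_odd, Nat.odd_iff]

/-! ### The greedy matrix exists -/

theorem weightClass_congr {k n i : ℕ} {R R' : ℕ → Word k} (h : ∀ j < n, R j = R' j) :
    weightClass R n i = weightClass R' n i := by
  unfold weightClass
  congr! 4 with x
  rw [h _ (Fin.is_lt _)]

theorem marked_succ_congr {k t : ℕ} {R R' : ℕ → Word k} (h : ∀ j < k + t, R j = R' j)
    (h' : marked R t = marked R' t) : marked R (t + 1) = marked R' (t + 1) := by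
  show _ ∪ _ = _ ∪ _
  rw [h']
  congr 1
  refine Finset.biUnion_congr rfl fun i _ => ?_
  rw [weightClass_congr h]

theorem marked_congr {k t : ℕ} {R R' : ℕ → Word k} (h : ∀ j < k + t, R j = R' j) :
    marked R (t + 1) = marked R' (t + 1) := by
  induction t with
  | zero => exact marked_succ_congr h rfl
  | succ t ih => exact marked_succ_congr h (ih fun j hj => h j (by omega))

/-- Iteration `t` looks at the first `k + t` rows only. Hence the matrix can be built by successive
updates, and `Suitable` may be stated for the finished infinite matrix. -/
theorem suitable_congr {k t : ℕ} {R R' : ℕ → Word k} (h : ∀ j < k + t, R j = R' j) (r : Word k) :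
    Suitable R t r ↔ Suitable R' t r := by
  unfold Suitable
  simp only [weightClass_congr h, marked_congr h]

theorem exists_suitable_toWord {k : ℕ} (R : ℕ → Word k) (t : ℕ) :
    ∃ x, x < 2 ^ k ∧ Suitable R t (toWord k x) := by
  obtain ⟨r, hr⟩ := exists_suitable R t
  obtain ⟨x, hx, rfl⟩ := exists_toWord r
  exact ⟨x, hx, hr⟩

open Classical in
/-- The number of the lexicographically first suitable vector. -/
def nextIndex {k : ℕ} (R : ℕ → Word k) (t : ℕ) : ℕ := Nat.find (exists_suitable_toWord R t)

open Classical in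
theorem nextIndex_spec {k : ℕ} (R : ℕ → Word k) (t : ℕ) :
    nextIndex R t < 2 ^ k ∧ Suitable R t (toWord k (nextIndex R t)) :=
  Nat.find_spec (exists_suitable_toWord R t)

open Classical in
theorem nextIndex_le {k : ℕ} {R : ℕ → Word k} {t x : ℕ} (hx : x < 2 ^ k)
    (h : Suitable R t (toWord k x)) : nextIndex R t ≤ x :=
  Nat.find_min' (exists_suitable_toWord R t) ⟨hx, h⟩

theorem nextIndex_congr {k t : ℕ} {R R' : ℕ → Word k} (h : ∀ j < k + t, R j = R' j) :
    nextIndex R t = nextIndex R' t := by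
  apply le_antisymm
  · exact nextIndex_le (nextIndex_spec R' t).1
      ((suitable_congr h _).mpr (nextIndex_spec R' t).2)
  · exact nextIndex_le (nextIndex_spec R t).1
      ((suitable_congr h _).mp (nextIndex_spec R t).2)

/-- The matrix after `t` iterations of the greedy algorithm. -/
def greedyAux (k : ℕ) : ℕ → ℕ → Word k
  | 0 => fun j => if h : j < k then Pi.single ⟨j, h⟩ 1 else 0
  | t + 1 => Function.update (greedyAux k t) (k + t) (toWord k (nextIndex (greedyAux k t) t))

/-- The greedy matrix. -/
def greedyMatrix (k j : ℕ) : Word k := greedyAux k (j + 1 - k) j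

theorem greedyAux_eq {k t j : ℕ} (h : j < k + t) : greedyAux k t j = greedyMatrix k j := by
  induction t with
  | zero =>
    rw [greedyMatrix, show j + 1 - k = 0 by omega]
  | succ t ih =>
    rcases Nat.lt_or_ge j (k + t) with hlt | hge
    · rw [greedyAux, Function.update_of_ne (by omega), ih hlt]
    · rw [greedyMatrix, show j + 1 - k = t + 1 by omega]

theorem greedyMatrix_lt {k j : ℕ} (h : j < k) : greedyMatrix k j = Pi.single ⟨j, h⟩ 1 := by
  rw [← greedyAux_eq (t := 0) (by omega), greedyAux]
  exact dif_pos h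

theorem greedyMatrix_add (k t : ℕ) :
    greedyMatrix k (k + t) = toWord k (nextIndex (greedyMatrix k) t) := by
  rw [← greedyAux_eq (t := t + 1) (by omega), greedyAux, Function.update_self,
    nextIndex_congr fun j hj => greedyAux_eq hj]

theorem isGreedyMatrix_greedyMatrix (k : ℕ) : IsGreedyMatrix (greedyMatrix k) := by
  refine ⟨fun i => greedyMatrix_lt i.2, fun t => ?_⟩
  rw [greedyMatrix_add]
  have hs := nextIndex_spec (greedyMatrix k) t
  refine ⟨hs.2, fun r hr hne => ?_⟩
  obtain ⟨x, hx, rfl⟩ := exists_toWord r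
  rcases lexLT_or_lexLT hne with h | h
  · have := lt_of_lexLT_toWord hx hs.1 h
    have := nextIndex_le hx hr
    omega
  · exact h

/-! ### The weight spectrum of the greedy code -/

theorem hammingNorm_eq_sum {n : ℕ} (c : Word n) :
    hammingNorm c = ∑ i, if c i = 1 then 1 else 0 := by
  rw [hammingNorm, Finset.card_filter]
  refine Finset.sum_congr rfl fun i _ => ?_
  have : ∀ z : ZMod 2, (if z ≠ 0 then 1 else 0) = if z = 1 then 1 else 0 := by decide
  exact this (c i)

theorem hammingNorm_prefix_succ {n : ℕ} (f : ℕ → ZMod 2) :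
    hammingNorm (fun j : Fin (n + 1) => f j) =
      hammingNorm (fun j : Fin n => f j) + if f n = 1 then 1 else 0 := by
  rw [hammingNorm_eq_sum, hammingNorm_eq_sum, Fin.sum_univ_castSucc]
  simp

/-- The number of words of length `n` and weight `i`. -/
def sphereCard (n i : ℕ) : ℕ := (Finset.univ.filter fun c : Word n => hammingNorm c = i).card

/-- Pascal's rule, by splitting off the last bit. The weight classes of the code imitate this
recursion in `card_unmarked_le`. -/
theorem sphereCard_succ (n i : ℕ) :
    sphereCard (n + 1) (i + 1) = sphereCard n (i + 1) + sphereCard n i := by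
  have h : ∀ (z : ZMod 2) (c : Word n),
      hammingNorm (Fin.snocEquiv (fun _ : Fin (n + 1) => ZMod 2) (z, c)) =
        hammingNorm c + if z = 1 then 1 else 0 := by
    intro z c
    show hammingNorm (Fin.snoc c z : Word (n + 1)) = _
    rw [hammingNorm_eq_sum, hammingNorm_eq_sum, Fin.sum_univ_castSucc]
    simp
  unfold sphereCard
  rw [Finset.card_filter, ← Equiv.sum_comp (Fin.snocEquiv fun _ : Fin (n + 1) => ZMod 2),
    Fintype.sum_prod_type, show (Finset.univ : Finset (ZMod 2)) = {0, 1} from rfl,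
    Finset.sum_pair (by decide), Finset.card_filter, Finset.card_filter]
  congr 1
  · refine Finset.sum_congr rfl fun c _ => ?_
    rw [h]; simp
  · refine Finset.sum_congr rfl fun c _ => ?_
    rw [h]; simp

section Spectrum

variable {k : ℕ} {R : ℕ → Word k}

theorem mem_weightClass {n i : ℕ} {x : Word k} :
    x ∈ weightClass R n i ↔ hammingNorm (fun j : Fin n => R j ⬝ᵥ x) = i := by
  simp [weightClass]

theorem mem_elevated {r x : Word k} {S : Finset (Word k)} :
    x ∈ elevated r S ↔ x ∈ S ∧ r ⬝ᵥ x = 1 := by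
  rw [elevated, Finset.mem_filter, dotProduct_comm]

theorem mem_weightClass_succ {n i : ℕ} {x : Word k} :
    x ∈ weightClass R (n + 1) i ↔
      hammingNorm (fun j : Fin n => R j ⬝ᵥ x) + (if R n ⬝ᵥ x = 1 then 1 else 0) = i := by
  rw [mem_weightClass, hammingNorm_prefix_succ fun j => R j ⬝ᵥ x]

theorem hammingNorm_prefix_mono (x : Word k) {n n' : ℕ} (h : n ≤ n') :
    hammingNorm (fun j : Fin n => R j ⬝ᵥ x) ≤ hammingNorm (fun j : Fin n' => R j ⬝ᵥ x) := by
  induction n', h using Nat.le_induction with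
  | base => rfl
  | succ m _ ih =>
    rw [hammingNorm_prefix_succ fun j => R j ⬝ᵥ x]
    omega

theorem prefix_eq (hR : IsGreedyMatrix R) (x : Word k) : (fun j : Fin k => R j ⬝ᵥ x) = x := by
  funext j
  rw [hR.1 j, single_dotProduct, one_mul]

theorem hammingNorm_prefix_pos (hR : IsGreedyMatrix R) {x : Word k} (hx : x ≠ 0) {n : ℕ}
    (hn : k ≤ n) : 0 < hammingNorm (fun j : Fin n => R j ⬝ᵥ x) := by
  refine lt_of_lt_of_le ?_ (hammingNorm_prefix_mono x hn)
  rw [prefix_eq hR]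
  exact hammingNorm_pos_iff.mpr hx

/-- Because the first `k` rows are the identity, only the zero word has weight `0`, and no row
elevates it. This is the boundary case for which the algorithm demands no splitting. -/
theorem elevated_weightClass_zero (hR : IsGreedyMatrix R) (r : Word k) {n : ℕ} (hn : k ≤ n)
    (M : Finset (Word k)) : elevated r (weightClass R n 0 \ M) = ∅ := by
  rw [Finset.eq_empty_iff_forall_notMem]
  intro x hx
  rw [mem_elevated, Finset.mem_sdiff, mem_weightClass] at hx
  by_cases h0 : x = 0
  · simp [h0] at hx
  · have := hammingNorm_prefix_pos hR h0 hn
    omega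

theorem weightClass_of_lt {n i : ℕ} (h : n < i) : weightClass R n i = ∅ := by
  rw [Finset.eq_empty_iff_forall_notMem]
  intro x hx
  rw [mem_weightClass] at hx
  have := hammingNorm_le_card_fintype (x := fun j : Fin n => R j ⬝ᵥ x)
  rw [Fintype.card_fin] at this
  omega

theorem marked_subset_succ (R : ℕ → Word k) (t : ℕ) : marked R t ⊆ marked R (t + 1) :=
  Finset.subset_union_left

/-- A word gets weight `i + 1` either by having it already and not being elevated, or by being
elevated from weight `i`. The count is written additively to avoid a truncated difference. -/
theorem card_unmarked_succ_le {n : ℕ} (i : ℕ) (M : Finset (Word k)) :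
    (weightClass R (n + 1) (i + 1) \ M).card + (elevated (R n) (weightClass R n (i + 1) \ M)).card ≤
      (weightClass R n (i + 1) \ M).card + (elevated (R n) (weightClass R n i \ M)).card := by
  have hsub : weightClass R (n + 1) (i + 1) \ M ⊆
      ((weightClass R n (i + 1) \ M) \ elevated (R n) (weightClass R n (i + 1) \ M)) ∪
        elevated (R n) (weightClass R n i \ M) := by
    intro x hx
    rw [Finset.mem_sdiff, mem_weightClass_succ] at hx
    simp only [Finset.mem_union, Finset.mem_sdiff, mem_elevated, mem_weightClass]
    by_cases h : R n ⬝ᵥ x = 1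
    · rw [if_pos h] at hx
      exact Or.inr ⟨⟨by omega, hx.2⟩, h⟩
    · rw [if_neg h] at hx
      exact Or.inl ⟨⟨by omega, hx.2⟩, fun hc => h hc.2⟩
  have h1 := (Finset.card_le_card hsub).trans (Finset.card_union_le _ _)
  have h2 : elevated (R n) (weightClass R n (i + 1) \ M) ⊆ weightClass R n (i + 1) \ M :=
    Finset.filter_subset _ _
  rw [Finset.card_sdiff_of_subset h2] at h1
  have := Finset.card_le_card h2
  omega

/-- One induction step of `card_unmarked_le`: the factor is at most `exp (1 / √n)`, and `√(n + 1) -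
√n = 1 / (√(n + 1) + √n) ≥ 1 / (3 √n)` because `√(n + 1) ≤ 2 √n`. -/
theorem one_add_inv_sqrt_mul_exp_le {n : ℕ} (hn : 0 < n) :
    (1 + 1 / √(n : ℝ)) * Real.exp (3 * √(n : ℝ)) ≤ Real.exp (3 * √((n + 1 : ℕ) : ℝ)) := by
  have hq : 0 < √(n : ℝ) := by positivity
  have h1 : 1 + 1 / √(n : ℝ) ≤ Real.exp (1 / √(n : ℝ)) := by
    linarith [Real.add_one_le_exp (1 / √(n : ℝ))]
  refine (mul_le_mul_of_nonneg_right h1 (Real.exp_pos _).le).trans ?_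
  rw [← Real.exp_add]
  apply Real.exp_le_exp.mpr
  have hsq : √(n : ℝ) ^ 2 = n := Real.sq_sqrt (by positivity)
  have hsq' : √((n + 1 : ℕ) : ℝ) ^ 2 = n + 1 := by
    rw [Real.sq_sqrt (by positivity)]; push_cast; ring
  have hle : √((n + 1 : ℕ) : ℝ) ≤ 2 * √(n : ℝ) := by
    apply Real.sqrt_le_iff.mpr
    have : (1 : ℝ) ≤ n := by exact_mod_cast hn
    refine ⟨by positivity, ?_⟩
    rw [mul_pow, hsq]; push_cast; linarith
  have hlt : √(n : ℝ) ≤ √((n + 1 : ℕ) : ℝ) := Real.sqrt_le_sqrt (by push_cast; linarith)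
  rw [← le_sub_iff_add_le, div_le_iff₀ hq]
  nlinarith

/-- The unmarked part of each weight class is at most subexponentially larger than expected in a
random code. -/
theorem card_unmarked_le (hR : IsGreedyMatrix R) (hk : 0 < k) (t : ℕ) {i : ℕ} (hi : 0 < i) :
    ((weightClass R (k + t) i \ marked R t).card : ℝ) ≤
      Real.exp (3 * √((k + t : ℕ) : ℝ)) * (sphereCard (k + t) i / 2 ^ t) := by
  induction t generalizing i with
  | zero =>
    -- Under the identity rows the weight of a codeword is the weight of the word, so the initial
    -- count is exact.
    have : (weightClass R (k + 0) i \ marked R 0).card = sphereCard k i := by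
      rw [marked, Finset.sdiff_empty, add_zero, weightClass, sphereCard]
      simp only [prefix_eq hR]
    rw [this, add_zero, pow_zero, div_one]
    exact le_mul_of_one_le_left (by positivity) (Real.one_le_exp (by positivity))
  | succ t ih =>
    obtain ⟨i, rfl⟩ : ∃ j, i = j + 1 := ⟨i - 1, by omega⟩
    set n := k + t with hn
    have hn0 : 0 < n := by omega
    have hq : 0 < √(n : ℝ) := by positivity
    set E := Real.exp (3 * √(n : ℝ)) with hE
    have hsplit := (hR.2 t).1.1
    have hstep := card_unmarked_succ_le (R := R) (n := n) i (marked R (t + 1))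
    have hstep' : ((weightClass R (n + 1) (i + 1) \ marked R (t + 1)).card : ℝ) +
        ((elevated (R n) (weightClass R n (i + 1) \ marked R (t + 1))).card : ℝ) ≤
      ((weightClass R n (i + 1) \ marked R (t + 1)).card : ℝ) +
        ((elevated (R n) (weightClass R n i \ marked R (t + 1))).card : ℝ) := by
      exact_mod_cast hstep
    have hmono : ∀ i, ((weightClass R n i \ marked R (t + 1)).card : ℝ) ≤
        ((weightClass R n i \ marked R t).card : ℝ) := fun i => by
      exact_mod_cast Finset.card_le_card
        (Finset.sdiff_subset_sdiff le_rfl (marked_subset_succ R t))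
    have he : 1 / (2 * √(n : ℝ)) = (1 / 2) * (1 / √(n : ℝ)) := by field_simp
    set e := 1 / √(n : ℝ) with he'
    have he0 : 0 < e := by positivity
    -- The words that stay in class `i + 1` and those that rise from class `i` are each bounded by
    -- the fraction `(1 + e) / 2` of the bound for their class; Pascal's rule adds the two spheres.
    have hA : ((weightClass R n (i + 1) \ marked R (t + 1)).card : ℝ) -
        ((elevated (R n) (weightClass R n (i + 1) \ marked R (t + 1))).card : ℝ) ≤
        (1 + e) / 2 * (E * (sphereCard n (i + 1) / 2 ^ t)) := by
      refine le_trans ?_ (mul_le_mul_of_nonneg_left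
        ((hmono (i + 1)).trans (ih (Nat.succ_pos i))) (by positivity))
      by_cases hin : i + 1 ≤ n
      · have := (hsplit (i + 1) (Finset.mem_Icc.mpr ⟨by omega, hin⟩)).1
        rw [he] at this
        linarith
      · rw [weightClass_of_lt (by omega)]
        simp [elevated]
    have hB : ((elevated (R n) (weightClass R n i \ marked R (t + 1))).card : ℝ) ≤
        (1 + e) / 2 * (E * (sphereCard n i / 2 ^ t)) := by
      rcases Nat.eq_zero_or_pos i with h0 | hpos
      · rw [h0, elevated_weightClass_zero hR _ (by omega)]
        simp only [Finset.card_empty, Nat.cast_zero]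
        positivity
      · refine le_trans ?_ (mul_le_mul_of_nonneg_left
          ((hmono i).trans (ih hpos)) (by positivity))
        by_cases hin : i ≤ n
        · have := (hsplit i (Finset.mem_Icc.mpr ⟨hpos, hin⟩)).2
          rw [he] at this
          linarith
        · rw [weightClass_of_lt (by omega)]
          simp [elevated]
    have hfin := one_add_inv_sqrt_mul_exp_le hn0
    have hs : (sphereCard (n + 1) (i + 1) : ℝ) = sphereCard n (i + 1) + sphereCard n i := by
      exact_mod_cast sphereCard_succ n i
    calc ((weightClass R (n + 1) (i + 1) \ marked R (t + 1)).card : ℝ)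
        ≤ (1 + e) / 2 * (E * (sphereCard n (i + 1) / 2 ^ t)) +
          (1 + e) / 2 * (E * (sphereCard n i / 2 ^ t)) := by linarith
      _ = ((1 + e) * E) * (sphereCard (n + 1) (i + 1) / 2 ^ (t + 1)) := by
          rw [hs, pow_succ]; field_simp
      _ ≤ _ := mul_le_mul_of_nonneg_right hfin (by positivity)

/-- Whole classes are marked, but only their fewer than `2 n ^ 2` unmarked words are new. With `n`
classes an iteration adds at most `2 n ^ 3` words, and these sum to at most `2 n ^ 4`. -/
theorem card_marked_le (R : ℕ → Word k) (t : ℕ) : (marked R t).card ≤ 2 * (k + t) ^ 4 := by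
  induction t with
  | zero => simp [marked]
  | succ t ih =>
    set n := k + t
    have hsub : marked R (t + 1) ⊆ marked R t ∪ (Finset.Icc 1 n).biUnion fun i =>
        if (weightClass R n i \ marked R t).card < 2 * n ^ 2
        then weightClass R n i \ marked R t else ∅ := by
      intro x hx
      rw [marked, Finset.mem_union, Finset.mem_biUnion] at hx
      rw [Finset.mem_union, Finset.mem_biUnion]
      by_cases hm : x ∈ marked R t
      · exact Or.inl hm
      · rcases hx with hx | ⟨i, hi, hx⟩
        · exact Or.inl hx
        · refine Or.inr ⟨i, hi, ?_⟩
          split_ifs at hx ⊢ with h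
          · exact Finset.mem_sdiff.mpr ⟨hx, hm⟩
          · simp at hx
    have h1 : ((Finset.Icc 1 n).biUnion fun i =>
        if (weightClass R n i \ marked R t).card < 2 * n ^ 2
        then weightClass R n i \ marked R t else ∅).card ≤ n * (2 * n ^ 2) := by
      refine Finset.card_biUnion_le.trans ((Finset.sum_le_card_nsmul _ _ (2 * n ^ 2) ?_).trans ?_)
      · intro i _
        split_ifs with h
        · exact h.le
        · simp
      · simp
    have h2 := (Finset.card_le_card hsub).trans (Finset.card_union_le _ _)
    have h3 : 2 * n ^ 4 + n * (2 * n ^ 2) ≤ 2 * (n + 1) ^ 4 := by ring_nf; nlinarith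
    show _ ≤ 2 * (n + 1) ^ 4
    omega

/-- As long as all words of minimum weight are marked, `L` further rows increase the minimum
weight if `(7 / 8) ^ L * 2 n ^ 4 < 1`. -/
theorem min_weight_lt_add (hR : IsGreedyMatrix R) {j t L N : ℕ} (hj : 0 < j)
    (hmin : ∀ d, 0 < d → d < j → weightClass R (k + t) d = ∅)
    (hmark : ∀ s, t ≤ s → s ≤ t + L → weightClass R (k + s) j ⊆ marked R s)
    (hN : k + t + L ≤ N) (hL : (7 / 8 : ℝ) ^ L * (2 * (N : ℝ) ^ 4) < 1) :
    ∀ d, 0 < d → d < j + 1 → weightClass R (k + (t + L)) d = ∅ := by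
  have hlow : ∀ l d, 0 < d → d < j → weightClass R (k + (t + l)) d = ∅ := by
    intro l d hd hdj
    rw [Finset.eq_empty_iff_forall_notMem]
    intro x hx
    rw [mem_weightClass] at hx
    have hmono := hammingNorm_prefix_mono (R := R) x (show k + t ≤ k + (t + l) by omega)
    have hx0 : x ≠ 0 := by
      rintro rfl
      simp [hammingNorm] at hx
      omega
    have hpos := hammingNorm_prefix_pos hR hx0 (show k ≤ k + t by omega)
    have := hmin _ hpos (by omega)
    rw [Finset.eq_empty_iff_forall_notMem] at this
    exact this x (mem_weightClass.mpr rfl)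
  -- Class `j` receives no words, since class `j - 1` is empty or consists of the zero word, and it
  -- loses at least an eighth of its words while it is the class of minimum weight.
  have hshrink : ∀ l, ((weightClass R (k + (t + l)) j).card : ℝ) ≤
      (7 / 8 : ℝ) ^ l * (weightClass R (k + t) j).card := by
    intro l
    induction l with
    | zero => simp
    | succ l ih =>
      set n := k + (t + l) with hn
      obtain ⟨i, rfl⟩ : ∃ i, j = i + 1 := ⟨j - 1, by omega⟩
      have h1 := card_unmarked_succ_le (R := R) (n := n) i ∅
      have h2 : elevated (R n) (weightClass R n i \ ∅) = ∅ := by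
        rcases Nat.eq_zero_or_pos i with h0 | hpos
        · rw [h0]; exact elevated_weightClass_zero hR _ (by omega) _
        · rw [hlow l i hpos (by omega)]; simp [elevated]
      rw [h2] at h1
      simp only [Finset.sdiff_empty, Finset.card_empty, add_zero] at h1
      have h1' : ((weightClass R (n + 1) (i + 1)).card : ℝ) +
          (elevated (R n) (weightClass R n (i + 1))).card ≤ (weightClass R n (i + 1)).card := by
        exact_mod_cast h1
      have h3 : (1 / 8 : ℝ) * (weightClass R n (i + 1)).card ≤
          (elevated (R n) (weightClass R n (i + 1))).card := by
        by_cases hne : (weightClass R n (i + 1)).Nonempty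
        · refine (hR.2 (t + l)).1.2 (i + 1) ⟨⟨Nat.succ_pos i, hne⟩, ?_⟩
          rintro d ⟨hd, x, hx⟩
          by_contra hlt
          have := hlow l d hd (by omega)
          rw [this] at hx
          simp at hx
        · rw [Finset.not_nonempty_iff_eq_empty] at hne
          simp [hne, elevated]
      have h4 : k + (t + (l + 1)) = n + 1 := by omega
      rw [h4, pow_succ]
      linarith
  intro d hd hdj
  rcases Nat.lt_succ_iff_lt_or_eq.mp hdj with hlt | rfl
  · exact hlow L d hd hlt
  · rw [← Finset.card_eq_zero]
    have h1 := hshrink L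
    have h2 : ((weightClass R (k + t) d).card : ℝ) ≤ 2 * (N : ℝ) ^ 4 := by
      have h3 : (weightClass R (k + t) d).card ≤ 2 * (k + t) ^ 4 :=
        (Finset.card_le_card (hmark t le_rfl (by omega))).trans (card_marked_le R t)
      have h4 : (k + t) ^ 4 ≤ N ^ 4 := Nat.pow_le_pow_left (by omega) 4
      have : (weightClass R (k + t) d).card ≤ 2 * N ^ 4 := by omega
      exact_mod_cast this
    have h5 : ((weightClass R (k + (t + L)) d).card : ℝ) < 1 :=
      lt_of_le_of_lt (h1.trans (mul_le_mul_of_nonneg_left h2 (by positivity))) hL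
    have : (weightClass R (k + (t + L)) d).card < 1 := by exact_mod_cast h5
    omega

/-- `J` rounds of `min_weight_lt_add`, with `L` rows for each weight from `1` to `J`. -/
theorem min_weight_ge (hR : IsGreedyMatrix R) {t L J N : ℕ}
    (hmark : ∀ s, t ≤ s → s ≤ t + J * L → ∀ j, 0 < j → j ≤ J → weightClass R (k + s) j ⊆ marked R s)
    (hN : k + t + J * L ≤ N) (hL : (7 / 8 : ℝ) ^ L * (2 * (N : ℝ) ^ 4) < 1) {x : Word k}
    (hx : x ≠ 0) : J < hammingNorm (fun i : Fin N => R i ⬝ᵥ x) := by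
  have key : ∀ j, j ≤ J → ∀ d, 0 < d → d < j + 1 → weightClass R (k + (t + j * L)) d = ∅ := by
    intro j
    induction j with
    | zero => intro _ d h1 h2; omega
    | succ j ih =>
      intro hj
      have hle : j * L + L ≤ J * L := by
        calc j * L + L = (j + 1) * L := by ring
          _ ≤ J * L := Nat.mul_le_mul_right L hj
      have := min_weight_lt_add hR (j := j + 1) (t := t + j * L) (L := L) (N := N) (Nat.succ_pos j)
        (ih (by omega)) (fun s h1 h2 => hmark s (by omega) (by omega) (j + 1) (Nat.succ_pos j) hj)
        (by omega) hL
      have e : t + (j + 1) * L = t + j * L + L := by ring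
      rwa [e]
  refine lt_of_lt_of_le ?_ (hammingNorm_prefix_mono (R := R) x
    (show k + (t + J * L) ≤ N by omega))
  by_contra hc
  have hpos := hammingNorm_prefix_pos hR hx (show k ≤ k + (t + J * L) by omega)
  have := key J le_rfl _ hpos (by omega)
  rw [Finset.eq_empty_iff_forall_notMem] at this
  exact this x (mem_weightClass.mpr rfl)

end Spectrum

/-! ### The binary symmetric channel -/

theorem sum_prod_word {n : ℕ} (g : Fin n → ZMod 2 → ℝ) :
    ∑ e : Word n, ∏ i, g i (e i) = ∏ i, (g i 0 + g i 1) := by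
  have h : ∀ i, g i 0 + g i 1 = ∑ z : ZMod 2, g i z := fun i => by
    rw [show (Finset.univ : Finset (ZMod 2)) = {0, 1} from rfl, Finset.sum_pair (by decide)]
  simp only [h]
  rw [Finset.prod_univ_sum, Fintype.piFinset_univ]

theorem pow_hammingNorm {n : ℕ} (a : ℝ) (c : Word n) :
    a ^ hammingNorm c = ∏ i, if c i = 1 then a else 1 := by
  rw [hammingNorm_eq_sum, ← Finset.prod_pow_eq_pow_sum]
  refine Finset.prod_congr rfl fun i _ => ?_
  split_ifs <;> simp

theorem sum_bscProb (p : ℝ) (n : ℕ) : ∑ e : Word n, bscProb p e = 1 := by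
  unfold bscProb
  rw [sum_prod_word fun _ z => if z = 1 then p else 1 - p]
  simp

theorem bscProb_pos {p : ℝ} (h0 : 0 < p) (h1 : p < 1) {n : ℕ} (e : Word n) : 0 < bscProb p e := by
  refine Finset.prod_pos fun i _ => ?_
  split_ifs <;> linarith

/-- Bhattacharyya bound: the probability that a word of weight `w`, added to the noise, does not
increase its weight. -/
theorem sum_bscProb_weight_add_le {p : ℝ} (h0 : 0 < p) (h1 : p < 1 / 2) {n : ℕ} (c : Word n) :
    ∑ e : Word n with hammingNorm (e + c) ≤ hammingNorm e, bscProb p e ≤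
      (2 * √(p * (1 - p))) ^ hammingNorm c := by
  have hq : 0 < 1 - p := by linarith
  set a := √p with ha
  set b := √(1 - p) with hb
  have ha0 : 0 < a := Real.sqrt_pos.mpr h0
  have hb0 : 0 < b := Real.sqrt_pos.mpr hq
  have hab : a ≤ b := Real.sqrt_le_sqrt (by linarith)
  have ha2 : a * a = p := Real.mul_self_sqrt h0.le
  have hb2 : b * b = 1 - p := Real.mul_self_sqrt hq.le
  have hmul : √(p * (1 - p)) = a * b := Real.sqrt_mul h0.le _
  have hl : 1 ≤ b / a := (one_le_div ha0).mpr hab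
  -- The indicator is bounded by the tilt `(b / a) ^ (|e| - |e + c|)` with `b / a = √((1 - p) / p)`.
  -- The expectation then factors over the coordinates: a coordinate outside the support of `c`
  -- gives `1`, one inside gives `2 a b`.
  have hone : ∀ e : Word n, hammingNorm (e + c) ≤ hammingNorm e →
      1 ≤ (b / a) ^ hammingNorm e * (a / b) ^ hammingNorm (e + c) := by
    intro e he
    have : (a / b) ^ hammingNorm (e + c) = ((b / a) ^ hammingNorm (e + c))⁻¹ := by
      rw [← inv_pow, inv_div]
    rw [this, ← div_eq_mul_inv, one_le_div (by positivity)]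
    exact pow_le_pow_right₀ hl he
  calc ∑ e : Word n with hammingNorm (e + c) ≤ hammingNorm e, bscProb p e
      ≤ ∑ e : Word n with hammingNorm (e + c) ≤ hammingNorm e,
          bscProb p e * ((b / a) ^ hammingNorm e * (a / b) ^ hammingNorm (e + c)) := by
        refine Finset.sum_le_sum fun e he => ?_
        exact le_mul_of_one_le_right (bscProb_pos h0 (by linarith) e).le
          (hone e (Finset.mem_filter.mp he).2)
    _ ≤ ∑ e : Word n, bscProb p e * ((b / a) ^ hammingNorm e * (a / b) ^ hammingNorm (e + c)) := by
        refine Finset.sum_le_sum_of_subset_of_nonneg (Finset.filter_subset _ _) fun e _ _ => ?_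
        have := bscProb_pos h0 (by linarith) e
        positivity
    _ = ∑ e : Word n, ∏ i, ((if e i = 1 then p else 1 - p) *
          ((if e i = 1 then b / a else 1) * (if e i + c i = 1 then a / b else 1))) := by
        refine Finset.sum_congr rfl fun e _ => ?_
        rw [pow_hammingNorm, pow_hammingNorm, bscProb, Finset.prod_mul_distrib,
          Finset.prod_mul_distrib]
        rfl
    _ = ∏ i, if c i = 1 then 2 * √(p * (1 - p)) else 1 := by
        rw [sum_prod_word fun i z => ((if z = 1 then p else 1 - p) *
          ((if z = 1 then b / a else 1) * (if z + c i = 1 then a / b else 1)))]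
        refine Finset.prod_congr rfl fun i _ => ?_
        have hz : c i = 0 ∨ c i = 1 := by
          generalize c i = z; revert z; decide
        have h2 : (1 : ZMod 2) + 1 ≠ 1 := by decide
        rcases hz with hz | hz <;> rw [hz]
        · have e : b / a * (a / b) = 1 := by field_simp
          simp [e]
        · have e1 : (1 - p) * (a / b) = a * b := by rw [← hb2]; field_simp
          have e2 : p * (b / a) = a * b := by rw [← ha2]; field_simp
          simp only [zero_ne_one, if_false, zero_add, if_true, one_mul, h2, mul_one, e1, e2, hmul]
          ring
    _ = _ := (pow_hammingNorm _ _).symm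

/-- Chernoff bound for the weight of the noise. -/
theorem sum_bscProb_lt_weight_le {p γ : ℝ} (h0 : 0 < p) (h1 : p < 1) (hγ : 0 < γ) (hγ1 : γ ≤ 1)
    (n : ℕ) : ∑ e : Word n with (p + γ) * n < hammingNorm e, bscProb p e ≤
      Real.exp (-((1 - p) * γ ^ 2 * n)) := by
  -- Exponential tilting with parameter `γ` itself. With `exp γ ≤ 1 + γ + γ ^ 2` the exponent per
  -- coordinate becomes `-γ (p + γ) + p (γ + γ ^ 2) = -(1 - p) γ ^ 2`.
  have hone : ∀ e : Word n, (p + γ) * n < hammingNorm e →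
      1 ≤ Real.exp (-(γ * ((p + γ) * n))) * Real.exp γ ^ hammingNorm e := by
    intro e he
    rw [← Real.exp_nat_mul, ← Real.exp_add]
    apply Real.one_le_exp
    nlinarith
  calc ∑ e : Word n with (p + γ) * n < hammingNorm e, bscProb p e
      ≤ ∑ e : Word n with (p + γ) * n < hammingNorm e,
          bscProb p e * (Real.exp (-(γ * ((p + γ) * n))) * Real.exp γ ^ hammingNorm e) :=
        Finset.sum_le_sum fun e he => le_mul_of_one_le_right (bscProb_pos h0 h1 e).le
          (hone e (Finset.mem_filter.mp he).2)
    _ ≤ ∑ e : Word n, bscProb p e * (Real.exp (-(γ * ((p + γ) * n))) * Real.exp γ ^ hammingNorm e) := by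
        refine Finset.sum_le_sum_of_subset_of_nonneg (Finset.filter_subset _ _) fun e _ _ => ?_
        have := bscProb_pos h0 h1 e
        positivity
    _ = Real.exp (-(γ * ((p + γ) * n))) * ∑ e : Word n, ∏ i,
          ((if e i = 1 then p else 1 - p) * (if e i = 1 then Real.exp γ else 1)) := by
        rw [Finset.mul_sum]
        refine Finset.sum_congr rfl fun e _ => ?_
        rw [pow_hammingNorm, bscProb, Finset.prod_mul_distrib]
        ring
    _ = Real.exp (-(γ * ((p + γ) * n))) * (1 - p + p * Real.exp γ) ^ n := by
        rw [sum_prod_word fun i z => ((if z = 1 then p else 1 - p) *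
          (if z = 1 then Real.exp γ else 1))]
        simp
    _ ≤ Real.exp (-(γ * ((p + γ) * n))) * Real.exp (p * (γ + γ ^ 2)) ^ n := by
        refine mul_le_mul_of_nonneg_left (pow_le_pow_left₀ ?_ ?_ n) (Real.exp_pos _).le
        · have := Real.exp_pos γ
          have : 0 < 1 - p := by linarith
          positivity
        · have h2 := abs_le.mp (Real.abs_exp_sub_one_sub_id_le (x := γ) (by rw [abs_of_pos hγ]; exact hγ1))
          have h3 := Real.add_one_le_exp (p * (γ + γ ^ 2))
          nlinarith [h2.2]
    _ = _ := by
        rw [← Real.exp_nat_mul, ← Real.exp_add]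
        congr 1
        ring

theorem bscProb_eq_exp {p : ℝ} (h0 : 0 < p) (h1 : p < 1) {n : ℕ} (e : Word n) :
    bscProb p e = Real.exp (n * Real.log (1 - p) -
      hammingNorm e * (Real.log (1 - p) - Real.log p)) := by
  have h : ∀ i, (if e i = 1 then p else 1 - p) = Real.exp (Real.log (1 - p) -
      (if e i = 1 then 1 else 0) * (Real.log (1 - p) - Real.log p)) := by
    intro i
    split_ifs
    · rw [one_mul, sub_sub_cancel, Real.exp_log h0]
    · rw [zero_mul, sub_zero, Real.exp_log (by linarith)]
  rw [bscProb, Finset.prod_congr rfl fun i _ => h i, ← Real.exp_sum, Finset.sum_sub_distrib,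
    ← Finset.sum_mul, hammingNorm_eq_sum]
  simp

theorem entropy_mul_log_two (p : ℝ) :
    entropy p * Real.log 2 = -p * Real.log p - (1 - p) * Real.log (1 - p) := by
  have : Real.log 2 ≠ 0 := (Real.log_pos one_lt_two).ne'
  unfold entropy Real.logb
  field_simp

/-- The size of a Hamming ball. -/
theorem card_ball_le {p γ : ℝ} (h0 : 0 < p) (h1 : p < 1 / 2) (n : ℕ) :
    ((Finset.univ.filter fun c : Word n => (hammingNorm c : ℝ) ≤ (p + γ) * n).card : ℝ) ≤
      Real.exp (n * (entropy p * Real.log 2 + γ * (Real.log (1 - p) - Real.log p))) := by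
  set S := Finset.univ.filter fun c : Word n => (hammingNorm c : ℝ) ≤ (p + γ) * n
  set l := Real.log (1 - p) - Real.log p with hl
  have hl0 : 0 < l := sub_pos.mpr (Real.log_lt_log h0 (by linarith))
  -- As `p < 1 / 2`, lighter noise is likelier. Every word of the ball has at least the probability
  -- assigned to weight `(p + γ) n`, and the probabilities sum to at most one.
  have h : (S.card : ℝ) * Real.exp (n * Real.log (1 - p) - (p + γ) * n * l) ≤ 1 := by
    calc (S.card : ℝ) * Real.exp (n * Real.log (1 - p) - (p + γ) * n * l)
        = ∑ _e ∈ S, Real.exp (n * Real.log (1 - p) - (p + γ) * n * l) := by simp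
      _ ≤ ∑ e ∈ S, bscProb p e := by
          refine Finset.sum_le_sum fun e he => ?_
          rw [bscProb_eq_exp h0 (by linarith)]
          apply Real.exp_le_exp.mpr
          have := mul_le_mul_of_nonneg_right (Finset.mem_filter.mp he).2 hl0.le
          linarith
      _ ≤ ∑ e : Word n, bscProb p e := Finset.sum_le_sum_of_subset_of_nonneg
          (Finset.subset_univ _) fun e _ _ => (bscProb_pos h0 (by linarith) e).le
      _ = 1 := sum_bscProb p n
  rw [← le_div_iff₀ (Real.exp_pos _), one_div, ← Real.exp_neg] at h
  refine h.trans (Real.exp_le_exp.mpr (le_of_eq ?_))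
  rw [entropy_mul_log_two]
  rw [hl]
  ring

/-! ### Confusion probabilities and their sum over all words. -/

theorem hammingNorm_comp_perm {n : ℕ} (σ : Equiv.Perm (Fin n)) (c : Word n) :
    hammingNorm (fun i => c (σ i)) = hammingNorm c := by
  rw [hammingNorm_eq_sum, hammingNorm_eq_sum]
  exact Equiv.sum_comp σ fun i => if c i = 1 then 1 else 0

theorem exists_perm_of_hammingNorm_eq {n : ℕ} {c c' : Word n} (h : hammingNorm c = hammingNorm c') :
    ∃ σ : Equiv.Perm (Fin n), ∀ i, c' (σ i) = c i := by
  have hc : Fintype.card {i // c i ≠ 0} = Fintype.card {i // c' i ≠ 0} := by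
    rw [Fintype.card_subtype, Fintype.card_subtype]
    exact h
  obtain ⟨e⟩ := Fintype.card_eq.mp hc
  refine ⟨e.extendSubtype, fun i => ?_⟩
  have hz : ∀ a b : ZMod 2, (a ≠ 0 ↔ b ≠ 0) → a = b := by decide
  apply hz
  by_cases hi : c i ≠ 0
  · exact iff_of_true (e.extendSubtype_mem i hi) hi
  · exact iff_of_false (e.extendSubtype_not_mem i hi) hi

/-- The probability that the weight of the noise is at most `ρ` and does not increase when `c` is
added. -/
def confusion (p ρ : ℝ) {n : ℕ} (c : Word n) : ℝ :=
  ∑ e : Word n with hammingNorm (e + c) ≤ hammingNorm e ∧ (hammingNorm e : ℝ) ≤ ρ, bscProb p e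

/-- A permutation of coordinates takes `c` to `c'` and preserves both weights and noise
probabilities. So a bound on the number of codewords of each weight is all that a comparison with a
random code needs. -/
theorem confusion_eq_of_hammingNorm_eq (p ρ : ℝ) {n : ℕ} {c c' : Word n}
    (h : hammingNorm c = hammingNorm c') : confusion p ρ c = confusion p ρ c' := by
  obtain ⟨σ, hσ⟩ := exists_perm_of_hammingNorm_eq h
  unfold confusion
  rw [Finset.sum_filter, Finset.sum_filter]
  rw [← Equiv.sum_comp (Equiv.arrowCongr σ.symm (Equiv.refl (ZMod 2)))]
  refine Finset.sum_congr rfl fun e _ => ?_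
  have e1 : (Equiv.arrowCongr σ.symm (Equiv.refl (ZMod 2))) e = fun i => e (σ i) := by
    funext i
    simp [Equiv.arrowCongr]
  have e2 : (fun i => e (σ i)) + c = fun i => (e + c') (σ i) := by
    funext i
    simp [hσ]
  have e3 : bscProb p (fun i => e (σ i)) = bscProb p e :=
    Equiv.prod_comp σ fun i => if e i = 1 then p else 1 - p
  rw [e1, e2, e3]
  simp only [hammingNorm_comp_perm]

theorem confusion_nonneg {p : ℝ} (h0 : 0 < p) (h1 : p < 1) (ρ : ℝ) {n : ℕ} (c : Word n) :
    0 ≤ confusion p ρ c :=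
  Finset.sum_nonneg fun e _ => (bscProb_pos h0 h1 e).le

/-- For fixed noise `e` of weight at most `ρ`, every counted `c` has `e + c` in the ball of radius
`ρ`. So at most one ball of words `c` is counted, and averaging over `e` preserves the bound. -/
theorem sum_confusion_le {p : ℝ} (h0 : 0 < p) (h1 : p < 1) (ρ : ℝ) (n : ℕ) :
    ∑ c : Word n, confusion p ρ c ≤
      ((Finset.univ.filter fun c : Word n => (hammingNorm c : ℝ) ≤ ρ).card : ℝ) := by
  set B := Finset.univ.filter fun c : Word n => (hammingNorm c : ℝ) ≤ ρ with hB
  unfold confusion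
  simp only [Finset.sum_filter]
  rw [Finset.sum_comm]
  calc ∑ e : Word n, ∑ c : Word n, (if hammingNorm (e + c) ≤ hammingNorm e ∧
        (hammingNorm e : ℝ) ≤ ρ then bscProb p e else 0)
      ≤ ∑ e : Word n, B.card * bscProb p e := by
        refine Finset.sum_le_sum fun e _ => ?_
        rw [← Equiv.sum_comp (Equiv.addLeft (-e)), ← nsmul_eq_mul, ← Finset.sum_const,
          hB, Finset.sum_filter]
        refine Finset.sum_le_sum fun c _ => ?_
        simp only [Equiv.coe_addLeft, add_neg_cancel_left]
        have := (bscProb_pos h0 h1 e).le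
        by_cases h : hammingNorm c ≤ hammingNorm e ∧ (hammingNorm e : ℝ) ≤ ρ
        · rw [if_pos h, if_pos]
          exact le_trans (by exact_mod_cast h.1) h.2
        · rw [if_neg h]
          split_ifs <;> simp [this]
    _ = B.card := by rw [← Finset.mul_sum, sum_bscProb, mul_one]

/-! ### The error probability of maximum-likelihood decoding -/

section Error

variable {k : ℕ} {R : ℕ → Word k}

/-- The random-coding bound. `card_unmarked_le` compares the unmarked words of each weight with the
full sphere, and confusion is constant on spheres, so the sum is at most the comparison factor times
the sum over all words. -/
theorem sum_confusion_unmarked_le (hR : IsGreedyMatrix R) (hk : 0 < k) {p : ℝ} (h0 : 0 < p)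
    (h1 : p < 1) (ρ : ℝ) (t : ℕ) :
    ∑ x ∈ Finset.univ.filter fun x : Word k => x ≠ 0 ∧ x ∉ marked R t,
      confusion p ρ (fun i : Fin (k + t) => R i ⬝ᵥ x) ≤
    Real.exp (3 * √((k + t : ℕ) : ℝ)) / 2 ^ t *
      ((Finset.univ.filter fun c : Word (k + t) => (hammingNorm c : ℝ) ≤ ρ).card : ℝ) := by
  classical
  set n := k + t with hn
  obtain ⟨φ, hφ⟩ : ∃ φ : ℕ → ℝ, ∀ c : Word n, confusion p ρ c = φ (hammingNorm c) := by
    refine ⟨fun i => if h : ∃ c : Word n, hammingNorm c = i then confusion p ρ h.choose else 0, ?_⟩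
    intro c
    have h : ∃ c' : Word n, hammingNorm c' = hammingNorm c := ⟨c, rfl⟩
    simp only [dif_pos h]
    exact confusion_eq_of_hammingNorm_eq p ρ h.choose_spec.symm
  set U := Finset.univ.filter fun x : Word k => x ≠ 0 ∧ x ∉ marked R t
  have hmaps : ∀ x ∈ U, hammingNorm (fun i : Fin n => R i ⬝ᵥ x) ∈ Finset.range (n + 1) := by
    intro x _
    have := hammingNorm_le_card_fintype (x := fun j : Fin n => R j ⬝ᵥ x)
    rw [Fintype.card_fin] at this
    exact Finset.mem_range.mpr (by omega)
  have hmaps' : ∀ c ∈ (Finset.univ : Finset (Word n)), hammingNorm c ∈ Finset.range (n + 1) := by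
    intro c _
    have := hammingNorm_le_card_fintype (x := c)
    rw [Fintype.card_fin] at this
    exact Finset.mem_range.mpr (by omega)
  refine le_trans ?_ (mul_le_mul_of_nonneg_left (sum_confusion_le h0 h1 ρ n) (by positivity))
  simp only [hφ]
  rw [← Finset.sum_fiberwise_of_maps_to hmaps, ← Finset.sum_fiberwise_of_maps_to hmaps',
    Finset.mul_sum]
  refine Finset.sum_le_sum fun i _ => ?_
  have s1 : ∑ x ∈ U with hammingNorm (fun i : Fin n => R i ⬝ᵥ x) = i,
      φ (hammingNorm fun i : Fin n => R i ⬝ᵥ x) = ∑ x ∈ U with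
        hammingNorm (fun i : Fin n => R i ⬝ᵥ x) = i, φ i :=
    Finset.sum_congr rfl fun x hx => by rw [(Finset.mem_filter.mp hx).2]
  have s2 : ∑ c : Word n with hammingNorm c = i, φ (hammingNorm c) =
      ∑ c : Word n with hammingNorm c = i, φ i :=
    Finset.sum_congr rfl fun x hx => by rw [(Finset.mem_filter.mp hx).2]
  rw [s1, s2, Finset.sum_const, Finset.sum_const, nsmul_eq_mul, nsmul_eq_mul, ← mul_assoc]
  by_cases hne : ∃ c : Word n, hammingNorm c = i
  · obtain ⟨c, rfl⟩ := hne
    refine mul_le_mul_of_nonneg_right ?_ (by rw [← hφ]; exact confusion_nonneg h0 h1 ρ c)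
    rcases Nat.eq_zero_or_pos (hammingNorm c) with hz | hpos
    · have : (U.filter fun x => hammingNorm (fun i : Fin n => R i ⬝ᵥ x) = hammingNorm c) = ∅ := by
        rw [Finset.eq_empty_iff_forall_notMem]
        intro x hx
        rw [Finset.mem_filter] at hx
        have := hammingNorm_prefix_pos hR (Finset.mem_filter.mp hx.1).2.1 (show k ≤ n by omega)
        omega
      rw [this]
      simp only [Finset.card_empty, Nat.cast_zero]
      positivity
    · have h2 : (U.filter fun x => hammingNorm (fun i : Fin n => R i ⬝ᵥ x) = hammingNorm c) ⊆
          weightClass R n (hammingNorm c) \ marked R t := by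
        intro x hx
        rw [Finset.mem_filter] at hx
        exact Finset.mem_sdiff.mpr ⟨mem_weightClass.mpr hx.2, (Finset.mem_filter.mp hx.1).2.2⟩
      have h3 := card_unmarked_le hR hk t hpos
      have h4 : ((U.filter fun x => hammingNorm (fun i : Fin n => R i ⬝ᵥ x) = hammingNorm c).card
        : ℝ) ≤ (weightClass R n (hammingNorm c) \ marked R t).card := by
        exact_mod_cast Finset.card_le_card h2
      refine h4.trans (h3.trans (le_of_eq ?_))
      unfold sphereCard
      ring
  · have : (U.filter fun x => hammingNorm (fun i : Fin n => R i ⬝ᵥ x) = i) = ∅ := by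
      rw [Finset.eq_empty_iff_forall_notMem]
      intro x hx
      exact hne ⟨_, (Finset.mem_filter.mp hx).2⟩
    have h2 : (Finset.univ.filter fun c : Word n => hammingNorm c = i) = ∅ := by
      rw [Finset.eq_empty_iff_forall_notMem]
      intro x hx
      exact hne ⟨_, (Finset.mem_filter.mp hx).2⟩
    rw [this, h2]
    simp

variable {C : RatelessCode} {G : (k : ℕ) → ℕ → Word k}

/-- By linearity the difference of the sent and the decoded word depends on the noise through
weights alone, which removes `m` from the analysis. -/
theorem exists_confusing_word (hG : C.IsGeneratedBy G) (hC : C.IsMaximumLikelihood) {k n : ℕ}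
    (m : Word k) (e : Word n) (h : C.dec n k (C.encPrefix n m + e) ≠ m) :
    ∃ x : Word k, x ≠ 0 ∧ hammingNorm (e + fun i : Fin n => G k i ⬝ᵥ x) ≤ hammingNorm e := by
  set y := C.encPrefix n m + e
  refine ⟨m - C.dec n k y, sub_ne_zero.mpr h.symm, ?_⟩
  have h1 := hC n k y m
  rw [hammingDist_comm, hammingDist_comm y, hammingDist_eq_hammingNorm, hammingDist_eq_hammingNorm] at h1
  have e1 : -C.encPrefix n m + y = e := by simp [y]
  have e2 : -C.encPrefix n (C.dec n k y) + y =
      e + fun i : Fin n => G k i ⬝ᵥ (m - C.dec n k y) := by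
    funext i
    simp only [y, RatelessCode.encPrefix, hG k, Pi.neg_apply, Pi.add_apply, dotProduct_sub]
    ring
  rwa [e1, e2] at h1

/-- The three terms are the union bound over heavy noise, confusion with one of the at most `2 n ^
4` marked words, all of weight at least `d`, and confusion with an unmarked word under typical
noise. -/
theorem error_le (hG : C.IsGeneratedBy G) (hGr : IsGreedyMatrix (G k))
    (hC : C.IsMaximumLikelihood) (hk : 0 < k) {p γ : ℝ} (h0 : 0 < p) (h1 : p < 1 / 2)
    (hγ : 0 < γ) (hγ1 : γ ≤ 1) (t : ℕ) {d : ℕ}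
    (hd : ∀ x : Word k, x ≠ 0 → d ≤ hammingNorm (fun i : Fin (k + t) => G k i ⬝ᵥ x)) :
    C.errorProb p k (k + t) ≤ Real.exp (-((1 - p) * γ ^ 2 * (k + t : ℕ))) +
      2 * ((k + t : ℕ) : ℝ) ^ 4 * (2 * √(p * (1 - p))) ^ d +
      Real.exp (3 * √((k + t : ℕ) : ℝ)) / 2 ^ t * Real.exp ((k + t : ℕ) *
        (entropy p * Real.log 2 + γ * (Real.log (1 - p) - Real.log p))) := by
  classical
  set n := k + t with hn
  have hp1 : p < 1 := by linarith
  refine ciSup_le fun m => ?_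
  set ρ := (p + γ) * n with hρ
  set enc : Word k → Word n := fun x i => G k i ⬝ᵥ x with henc
  set T := Finset.univ.filter fun e : Word n => ρ < hammingNorm e
  set P : Word k → Finset (Word n) := fun x =>
    Finset.univ.filter fun e : Word n => hammingNorm (e + enc x) ≤ hammingNorm e
  set Q : Word k → Finset (Word n) := fun x =>
    Finset.univ.filter fun e : Word n => hammingNorm (e + enc x) ≤ hammingNorm e ∧
      (hammingNorm e : ℝ) ≤ ρ
  set V := Finset.univ.filter fun x : Word k => x ≠ 0 ∧ x ∈ marked (G k) t
  set U := Finset.univ.filter fun x : Word k => x ≠ 0 ∧ x ∉ marked (G k) t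
  have hsub : (Finset.univ.filter fun e : Word n => C.dec n k (C.encPrefix n m + e) ≠ m) ⊆
      T ∪ V.biUnion P ∪ U.biUnion Q := by
    intro e he
    obtain ⟨x, hx0, hx⟩ := exists_confusing_word hG hC m e (Finset.mem_filter.mp he).2
    simp only [T, V, U, P, Q, Finset.mem_union, Finset.mem_biUnion, Finset.mem_filter,
      Finset.mem_univ, true_and]
    by_cases hT : ρ < hammingNorm e
    · exact Or.inl (Or.inl hT)
    · by_cases hm : x ∈ marked (G k) t
      · exact Or.inl (Or.inr ⟨x, ⟨hx0, hm⟩, hx⟩)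
      · exact Or.inr ⟨x, ⟨hx0, hm⟩, hx, not_lt.mp hT⟩
  have hnn : ∀ e : Word n, 0 ≤ bscProb p e := fun e => (bscProb_pos h0 hp1 e).le
  have hunion : ∀ A B : Finset (Word n), ∑ e ∈ A ∪ B, bscProb p e ≤
      ∑ e ∈ A, bscProb p e + ∑ e ∈ B, bscProb p e := fun A B => by
    rw [← Finset.sum_union_inter]
    exact le_add_of_nonneg_right (Finset.sum_nonneg fun e _ => hnn e)
  have hbi : ∀ (S : Finset (Word k)) (A : Word k → Finset (Word n)),
      ∑ e ∈ S.biUnion A, bscProb p e ≤ ∑ x ∈ S, ∑ e ∈ A x, bscProb p e := by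
    intro S A
    induction S using Finset.induction_on with
    | empty => simp
    | insert a S ha ih =>
      rw [Finset.biUnion_insert, Finset.sum_insert ha]
      exact (hunion _ _).trans (add_le_add_right ih _)
  have hVU : ∑ x ∈ V, ∑ e ∈ P x, bscProb p e ≤ 2 * (n : ℝ) ^ 4 * (2 * √(p * (1 - p))) ^ d := by
    have hb1 : 2 * √(p * (1 - p)) ≤ 1 := by
      have : √(p * (1 - p)) ≤ 1 / 2 := by
        apply Real.sqrt_le_iff.mpr
        exact ⟨by norm_num, by nlinarith [sq_nonneg (p - 1 / 2)]⟩
      linarith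
    have hle : ∀ x ∈ V, ∑ e ∈ P x, bscProb p e ≤ (2 * √(p * (1 - p))) ^ d := by
      intro x hx
      refine (sum_bscProb_weight_add_le h0 h1 (enc x)).trans ?_
      exact pow_le_pow_of_le_one (by positivity) hb1 (hd x (Finset.mem_filter.mp hx).2.1)
    refine (Finset.sum_le_card_nsmul _ _ _ hle).trans ?_
    rw [nsmul_eq_mul]
    have hcard : V.card ≤ 2 * n ^ 4 := by
      refine (Finset.card_le_card ?_).trans (card_marked_le (G k) t)
      intro x hx
      exact (Finset.mem_filter.mp hx).2.2
    have hcard' : (V.card : ℝ) ≤ 2 * (n : ℝ) ^ 4 := by exact_mod_cast hcard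
    exact mul_le_mul_of_nonneg_right hcard' (by positivity)
  have hU : ∑ x ∈ U, ∑ e ∈ Q x, bscProb p e ≤ Real.exp (3 * √(n : ℝ)) / 2 ^ t *
      Real.exp (n * (entropy p * Real.log 2 + γ * (Real.log (1 - p) - Real.log p))) :=
    (sum_confusion_unmarked_le hGr hk h0 hp1 ρ t).trans
      (mul_le_mul_of_nonneg_left (card_ball_le h0 h1 n) (by positivity))
  calc ∑ e : Word n with C.dec n k (C.encPrefix n m + e) ≠ m, bscProb p e
      ≤ ∑ e ∈ T ∪ V.biUnion P ∪ U.biUnion Q, bscProb p e :=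
        Finset.sum_le_sum_of_subset_of_nonneg hsub fun e _ _ => hnn e
    _ ≤ ∑ e ∈ T, bscProb p e + ∑ e ∈ V.biUnion P, bscProb p e + ∑ e ∈ U.biUnion Q, bscProb p e :=
        (hunion _ _).trans (add_le_add_left (hunion _ _) _)
    _ ≤ _ := add_le_add (add_le_add (sum_bscProb_lt_weight_le h0 hp1 hγ hγ1 n)
        ((hbi V P).trans hVU)) ((hbi U Q).trans hU)

/-- A crude bound on the error probability, for short codes. -/
theorem error_le_one_sub (hG : C.IsGeneratedBy G) (hGr : ∀ k, IsGreedyMatrix (G k))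
    (hC : C.IsMaximumLikelihood) {p : ℝ} (h0 : 0 < p) (h1 : p < 1) {k n : ℕ} (hkn : k ≤ n) :
    C.errorProb p k n ≤ 1 - (1 - p) ^ n := by
  classical
  refine ciSup_le fun m => ?_
  -- Zero noise is always decoded correctly: a confusing word would have a codeword of weight zero,
  -- which is impossible for `x ≠ 0` once the systematic part is present.
  have hz : bscProb p (0 : Word n) = (1 - p) ^ n := by simp [bscProb]
  rw [← hz, ← sum_bscProb p n, ← Finset.sum_erase_eq_sub (Finset.mem_univ (0 : Word n))]
  refine Finset.sum_le_sum_of_subset_of_nonneg ?_ fun e _ _ => (bscProb_pos h0 h1 e).le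
  intro e he
  refine Finset.mem_erase.mpr ⟨?_, Finset.mem_univ _⟩
  rintro rfl
  obtain ⟨x, hx0, hx⟩ := exists_confusing_word hG hC m 0 (Finset.mem_filter.mp he).2
  rw [zero_add, hammingNorm_zero] at hx
  have := hammingNorm_prefix_pos (hGr k) hx0 hkn
  omega

theorem error_zero {p : ℝ} (n : ℕ) : C.errorProb p 0 n = 0 := by
  unfold RatelessCode.errorProb
  have : ∀ m : Word 0, ∑ e : Word n with C.dec n 0 (C.encPrefix n m + e) ≠ m, bscProb p e = 0 := by
    intro m
    rw [Finset.filter_false_of_mem (fun e _ => by simp [Subsingleton.elim _ m])]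
    simp
  simp [this]

end Error

/-! ### The error exponent -/

theorem entropy_pos {p : ℝ} (h0 : 0 < p) (h1 : p < 1) : 0 < entropy p := by
  have h2 : 0 < Real.log 2 := Real.log_pos one_lt_two
  have h3 := entropy_mul_log_two p
  have h4 : Real.log p < 0 := Real.log_neg h0 h1
  have h5 : Real.log (1 - p) < 0 := Real.log_neg (by linarith) (by linarith)
  have h6 : 0 < entropy p * Real.log 2 := by rw [h3]; nlinarith
  exact pos_of_mul_pos_left h6 h2.le

theorem exp_div_two_pow (a : ℝ) (t : ℕ) :
    Real.exp a / 2 ^ t = Real.exp (a - t * Real.log 2) := by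
  rw [Real.exp_sub, Real.exp_nat_mul, Real.exp_log two_pos]

section

variable {k : ℕ} {R : ℕ → Word k}

/-- Below capacity, all light words are marked. -/
theorem weightClass_subset_marked (hR : IsGreedyMatrix R) (hk : 0 < k) {p δ : ℝ} (h0 : 0 < p)
    (h1 : p < 1 / 2) {s d : ℕ} (hks : (k : ℝ) ≤ (1 - entropy p - δ) * (k + s : ℕ))
    (hs : 3 < √((k + s : ℕ) : ℝ) * (δ * Real.log 2)) (hd : 0 < d) (hdp : (d : ℝ) ≤ p * (k + s : ℕ)) :
    weightClass R (k + s) d ⊆ marked R s := by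
  set n := k + s with hn
  have hlog : 0 < Real.log 2 := Real.log_pos one_lt_two
  have hsphere : (sphereCard n d : ℝ) ≤ Real.exp (n * (entropy p * Real.log 2)) := by
    have := card_ball_le (γ := 0) h0 h1 n
    rw [add_zero, zero_mul, add_zero] at this
    refine le_trans ?_ this
    exact_mod_cast Finset.card_le_card fun c hc => by
      rw [Finset.mem_filter] at hc ⊢
      exact ⟨hc.1, by rw [hc.2]; exact hdp⟩
  have h := card_unmarked_le hR hk s hd
  -- Since `s = n - k ≥ (H + δ) n`, the bound `exp (3 √n) 2 ^ (n H) / 2 ^ s` has exponent at most `3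
  -- √n - δ n log 2`, which is negative by `hs`. A cardinality below one is zero.
  have h2 : Real.exp (3 * √(n : ℝ)) * (sphereCard n d / 2 ^ s) < 1 := by
    calc Real.exp (3 * √(n : ℝ)) * (sphereCard n d / 2 ^ s)
        ≤ Real.exp (3 * √(n : ℝ)) * (Real.exp (n * (entropy p * Real.log 2)) / 2 ^ s) := by
          gcongr
      _ = Real.exp (3 * √(n : ℝ) + (n * (entropy p * Real.log 2) - s * Real.log 2)) := by
          rw [exp_div_two_pow, ← Real.exp_add]
      _ < 1 := by
          rw [Real.exp_lt_one_iff]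
          have e : (s : ℝ) = n - k := by rw [hn]; push_cast; ring
          have hq : 0 < √(n : ℝ) := by
            apply Real.sqrt_pos.mpr
            have : 0 < n := by omega
            exact_mod_cast this
          have hsq : √(n : ℝ) * √(n : ℝ) = n := Real.mul_self_sqrt (by positivity)
          have h3 : 3 * √(n : ℝ) < δ * Real.log 2 * n := by
            have := mul_lt_mul_of_pos_right hs hq
            rw [show √(n : ℝ) * (δ * Real.log 2) * √(n : ℝ) =
              δ * Real.log 2 * (√(n : ℝ) * √(n : ℝ)) by ring, hsq] at this
            exact this
          have h4 := mul_le_mul_of_nonneg_right hks hlog.le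
          rw [e]
          nlinarith
  have h3 : ((weightClass R n d \ marked R s).card : ℝ) < 1 := lt_of_le_of_lt h h2
  have h4 : (weightClass R n d \ marked R s).card = 0 := by
    have : (weightClass R n d \ marked R s).card < 1 := by exact_mod_cast h3
    omega
  exact Finset.sdiff_eq_empty_iff_subset.mp (Finset.card_eq_zero.mp h4)

/-- The minimum distance of the greedy code below capacity is of order `n / log n`. -/
theorem min_weight_lower_bound (hR : IsGreedyMatrix R) (hk : 0 < k) {p δ : ℝ} (h0 : 0 < p)
    (h1 : p < 1 / 2) (hδ : 0 < δ) (hδ1 : δ < 1 - entropy p) {n : ℕ}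
    (hkn : (k : ℝ) ≤ (1 - entropy p - δ) * n) (hlog : 1 ≤ Real.log n)
    (hn : 6 < √(n : ℝ) * (δ / 2 * Real.log 2)) {x : Word k} (hx : x ≠ 0) :
    ⌊δ / 2 * p / 80 * (n / Real.log n)⌋₊ + 1 ≤ hammingNorm (fun i : Fin n => R i ⬝ᵥ x) := by
  -- `L` is large enough for `(7 / 8) ^ L` to beat `2 n ^ 4`. `α` is small enough that `J L` is at
  -- most `61 α n ≤ δ n / 2`, and that weights up to `J` stay below `p` times the number of rows.
  set α := δ / 2 * p / 80 with hα
  set J := ⌊α * (n / Real.log n)⌋₊ with hJ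
  set L := ⌈60 * Real.log n⌉₊ with hL
  have hH := entropy_pos h0 (by linarith)
  have hl2 : 0 < Real.log 2 := Real.log_pos one_lt_two
  have hα0 : 0 < α := by positivity
  have hn0 : (0 : ℝ) < n := by
    rcases Nat.eq_zero_or_pos n with h | h
    · rw [h] at hlog; norm_num at hlog
    · exact_mod_cast h
  have hu0 : 0 ≤ α * (n / Real.log n) := by positivity
  have hJle : (J : ℝ) ≤ α * (n / Real.log n) := Nat.floor_le hu0
  have hLle : (L : ℝ) ≤ 61 * Real.log n := by
    have := Nat.ceil_lt_add_one (show 0 ≤ 60 * Real.log n by positivity)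
    linarith
  have hJL : (J : ℝ) * L ≤ α * 61 * n := by
    calc (J : ℝ) * L ≤ α * (n / Real.log n) * (61 * Real.log n) :=
          mul_le_mul hJle hLle (by positivity) hu0
      _ = α * 61 * n := by field_simp
  have hα61 : α * 61 ≤ δ / 2 := by
    rw [hα]
    nlinarith
  have hJL' : (J : ℝ) * L ≤ δ / 2 * n := hJL.trans (mul_le_mul_of_nonneg_right hα61 hn0.le)
  have hkr : (k : ℝ) + J * L ≤ n := by nlinarith
  have hkJL : k + J * L ≤ n := by exact_mod_cast hkr
  -- The last `J L` rows serve to raise the minimum weight. Throughout them at least `(1 - δ / 2) n`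
  -- rows are present, so the rate is still below capacity by `δ / 2` and all light words are
  -- marked.
  obtain ⟨t, ht⟩ : ∃ t, n = k + t + J * L := ⟨n - J * L - k, by omega⟩
  refine min_weight_ge hR (t := t) (L := L) (J := J) (N := n) ?_ (by omega) ?_ hx
  · intro s hts _ j hj hjJ
    have hns : (n : ℝ) - J * L ≤ (k + s : ℕ) := by
      have : n ≤ k + s + J * L := by omega
      have : (n : ℝ) ≤ (k + s : ℕ) + J * L := by exact_mod_cast this
      linarith
    have hns' : (1 - δ / 2) * n ≤ ((k + s : ℕ) : ℝ) := by linarith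
    have hhalf : (n : ℝ) / 2 ≤ ((k + s : ℕ) : ℝ) := by nlinarith
    refine weightClass_subset_marked hR hk h0 h1 (δ := δ / 2) ?_ ?_ hj ?_
    · refine hkn.trans ?_
      calc (1 - entropy p - δ) * n ≤ (1 - entropy p - δ / 2) * ((1 - δ / 2) * n) := by
            have : (1 - entropy p - δ) ≤ (1 - entropy p - δ / 2) * (1 - δ / 2) := by nlinarith
            nlinarith
        _ ≤ _ := mul_le_mul_of_nonneg_left hns' (by linarith)
    · have hq : √(n : ℝ) / 2 ≤ √((k + s : ℕ) : ℝ) := by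
        apply Real.le_sqrt_of_sq_le
        rw [div_pow, Real.sq_sqrt hn0.le]
        linarith
      have := mul_le_mul_of_nonneg_right hq (show 0 ≤ δ / 2 * Real.log 2 by positivity)
      linarith
    · have h2 : (j : ℝ) ≤ J := by exact_mod_cast hjJ
      have h3 : (n : ℝ) / Real.log n ≤ n := div_le_self hn0.le hlog
      have h4 : α * (n / Real.log n) ≤ α * n := mul_le_mul_of_nonneg_left h3 hα0.le
      have h5 : α * n ≤ p / 2 * n := by
        apply mul_le_mul_of_nonneg_right _ hn0.le
        rw [hα]; nlinarith
      nlinarith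
  -- `(7 / 8) ^ L ≤ exp (-L / 8) ≤ n ^ (-7.5)`, against `2 n ^ 4`.
  · have h78 : (7 / 8 : ℝ) ≤ Real.exp (-(1 / 8)) := by
      have := Real.add_one_le_exp (-(1 / 8) : ℝ)
      linarith
    have hLge : 60 * Real.log n ≤ L := Nat.le_ceil _
    have h4 : (n : ℝ) ^ 4 = Real.exp (4 * Real.log n) := by
      rw [show (4 : ℝ) * Real.log n = ((4 : ℕ) : ℝ) * Real.log n by norm_num, Real.exp_nat_mul,
        Real.exp_log hn0]
    have hlog2 : Real.log 2 < 1 := by linarith [Real.log_two_lt_d9]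
    calc (7 / 8 : ℝ) ^ L * (2 * (n : ℝ) ^ 4)
        ≤ Real.exp (-(1 / 8)) ^ L * (2 * (n : ℝ) ^ 4) := by gcongr
      _ = Real.exp (L * (-(1 / 8)) + (Real.log 2 + 4 * Real.log n)) := by
          rw [← Real.exp_nat_mul, h4, Real.exp_add, Real.exp_add, Real.exp_log two_pos]
      _ < 1 := by
          rw [Real.exp_lt_one_iff]
          linarith

end

/-- In terms of `u = n / log n` the first inequality reads `7 log n ≤ c u`, which absorbs the
factors `2 n ^ 4` and `3`. The second one absorbs `exp (3 √n)`. -/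
theorem exists_forall_ge_log_sq_le {c : ℝ} (hc : 0 < c) :
    ∃ n₀ : ℕ, 3 ≤ n₀ ∧ ∀ n : ℕ, n₀ ≤ n →
      7 * Real.log n ^ 2 ≤ c * n ∧ 6 < √(n : ℝ) * c ∧ 1 ≤ Real.log n := by
  have h1 : ∀ᶠ n : ℕ in Filter.atTop, 7 * Real.log n ^ 2 ≤ c * n := by
    have := (Real.isLittleO_pow_log_id_atTop (n := 2)).bound (show 0 < c / 7 by positivity)
    have := tendsto_natCast_atTop_atTop.eventually this
    filter_upwards [this] with n hn
    rw [Real.norm_of_nonneg (by positivity), id, Real.norm_of_nonneg (by positivity)] at hn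
    linarith
  have h2 : ∀ᶠ n : ℕ in Filter.atTop, 6 < √(n : ℝ) * c := by
    have := (Real.tendsto_sqrt_atTop.comp tendsto_natCast_atTop_atTop).eventually_gt_atTop (6 / c)
    filter_upwards [this] with n hn
    exact (div_lt_iff₀ hc).mp hn
  have h3 : ∀ᶠ n : ℕ in Filter.atTop, 1 ≤ Real.log n :=
    (Real.tendsto_log_atTop.comp tendsto_natCast_atTop_atTop).eventually_ge_atTop 1
  obtain ⟨n₀, hn₀⟩ := Filter.eventually_atTop.mp (h1.and (h2.and h3))
  exact ⟨max 3 n₀, le_max_left _ _, fun n hn => hn₀ n ((le_max_right _ _).trans hn)⟩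

theorem add_three_le_exp {a b c y : ℝ} (ha : a ≤ Real.exp (-(y + Real.log 3)))
    (hb : b ≤ Real.exp (-(y + Real.log 3))) (hc : c ≤ Real.exp (-(y + Real.log 3))) :
    a + b + c ≤ Real.exp (-y) := by
  have : Real.exp (-(y + Real.log 3)) = Real.exp (-y) / 3 := by
    rw [neg_add, ← sub_eq_add_neg, Real.exp_sub, Real.exp_log (by norm_num)]
  rw [this] at ha hb hc
  linarith

variable {C : RatelessCode} {G : (k : ℕ) → ℕ → Word k}

theorem errorProb_le_of_large (hG : C.IsGeneratedBy G) (hGr : ∀ k, IsGreedyMatrix (G k))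
    (hC : C.IsMaximumLikelihood) {p δ : ℝ} (h0 : 0 < p) (h1 : p < 1 / 2) (hδ : 0 < δ)
    (hδ1 : δ < 1 - entropy p) :
    ∃ c : ℝ, 0 < c ∧ ∃ n₀ : ℕ, 3 ≤ n₀ ∧ ∀ k n : ℕ, n₀ ≤ n →
      (k : ℝ) ≤ (1 - entropy p - δ) * n →
      C.errorProb p k n ≤ Real.exp (-(c * ((n : ℝ) / Real.log n))) := by
  have hp1 : 0 < 1 - p := by linarith
  have hH := entropy_pos h0 (by linarith)
  have hl2 : 0 < Real.log 2 := Real.log_pos one_lt_two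
  have hl3 : Real.log 3 ≤ 2 := by linarith [Real.log_le_sub_one_of_pos (show (0 : ℝ) < 3 by norm_num)]
  have hlog2 : Real.log 2 < 1 := by linarith [Real.log_two_lt_d9]
  set l := Real.log (1 - p) - Real.log p with hl
  have hl0 : 0 < l := sub_pos.mpr (Real.log_lt_log h0 (by linarith))
  -- The slack `δ log 2` is shared equally: one half pays for enlarging the radius of the ball from
  -- `p n` to `(p + γ) n`, the other half remains as the exponent of the unmarked term.
  set a₃ := δ / 2 * Real.log 2 with ha₃
  have ha₃0 : 0 < a₃ := by positivity
  set γ := min 1 (a₃ / l) with hγ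
  have hγ0 : 0 < γ := lt_min one_pos (by positivity)
  have hγl : γ * l ≤ a₃ := by
    rw [← le_div_iff₀ hl0]; exact min_le_right _ _
  set a₁ := (1 - p) * γ ^ 2 with ha₁
  have ha₁0 : 0 < a₁ := by positivity
  set β := 2 * √(p * (1 - p)) with hβ
  have hβ0 : 0 < β := by
    have := Real.sqrt_pos.mpr (mul_pos h0 hp1)
    positivity
  have hβ1 : β < 1 := by
    have : √(p * (1 - p)) < 1 / 2 := by
      apply (Real.sqrt_lt' (by norm_num)).mpr
      nlinarith [mul_pos (show 0 < 1 / 2 - p by linarith) (show 0 < 1 / 2 - p by linarith)]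
    linarith
  have hlβ : Real.log β < 0 := Real.log_neg hβ0 hβ1
  set α := δ / 2 * p / 80 with hα
  have hα0 : 0 < α := by positivity
  set a₂ := -Real.log β * α with ha₂
  have ha₂0 : 0 < a₂ := mul_pos (by linarith) hα0
  -- Half of the smallest exponent is kept; the other half absorbs the subexponential factors.
  set c := min a₁ (min a₂ a₃) / 2 with hc
  have hc0 : 0 < c := by
    have : 0 < min a₁ (min a₂ a₃) := lt_min ha₁0 (lt_min ha₂0 ha₃0)
    positivity
  have hca₁ : 2 * c ≤ a₁ := by linarith [min_le_left a₁ (min a₂ a₃)]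
  have hca₂ : 2 * c ≤ a₂ := by
    linarith [min_le_right a₁ (min a₂ a₃), min_le_left a₂ a₃]
  have hca₃ : 2 * c ≤ a₃ := by
    linarith [min_le_right a₁ (min a₂ a₃), min_le_right a₂ a₃]
  obtain ⟨n₀, hn₀3, hn₀⟩ := exists_forall_ge_log_sq_le hc0
  refine ⟨c, hc0, n₀, hn₀3, fun k n hn hkn => ?_⟩
  rcases Nat.eq_zero_or_pos k with rfl | hk
  · rw [error_zero]; exact (Real.exp_pos _).le
  obtain ⟨hlogsq, hsqrt, hlog⟩ := hn₀ n hn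
  have hn0 : (0 : ℝ) < n := by
    have : 0 < n := by omega
    exact_mod_cast this
  have hle1 : (k : ℝ) ≤ n := by nlinarith
  have hkn' : k ≤ n := by exact_mod_cast hle1
  obtain ⟨t, rfl⟩ : ∃ t, n = k + t := ⟨n - k, by omega⟩
  set n := k + t with hn'
  set u := (n : ℝ) / Real.log n with hu
  have hun : u ≤ n := div_le_self hn0.le hlog
  have hcu : 7 * Real.log n ≤ c * u := by
    rw [hu, mul_div_assoc', le_div_iff₀ (by linarith)]
    linarith
  have hcun : c * u ≤ c * n := mul_le_mul_of_nonneg_left hun hc0.le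
  have hs0 : 0 < √(n : ℝ) := Real.sqrt_pos.mpr hn0
  have hss : √(n : ℝ) * √(n : ℝ) = n := Real.mul_self_sqrt hn0.le
  have hs1 : 1 ≤ √(n : ℝ) := by
    rw [Real.one_le_sqrt]
    have : 1 ≤ n := by omega
    exact_mod_cast this
  refine (error_le hG (hGr k) hC hk h0 h1 hγ0 (min_le_left _ _) t
    (d := ⌊α * u⌋₊ + 1) fun x hx => ?_).trans (add_three_le_exp ?_ ?_ ?_)
  · refine min_weight_lower_bound (hGr k) hk h0 h1 hδ hδ1 hkn hlog ?_ hx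
    exact hsqrt.trans_le (mul_le_mul_of_nonneg_left (show c ≤ a₃ by linarith) hs0.le)
  · apply Real.exp_le_exp.mpr
    have h2 := mul_le_mul_of_nonneg_right hca₁ hn0.le
    linarith
  · have h4 : (n : ℝ) ^ 4 = Real.exp (4 * Real.log n) := by
      rw [show (4 : ℝ) * Real.log n = ((4 : ℕ) : ℝ) * Real.log n by norm_num, Real.exp_nat_mul,
        Real.exp_log hn0]
    have h5 : β ^ (⌊α * u⌋₊ + 1) ≤ Real.exp (-(a₂ * u)) := by
      rw [← Real.exp_log (pow_pos hβ0 _), Real.log_pow]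
      apply Real.exp_le_exp.mpr
      have := Nat.lt_floor_add_one (α * u)
      have h6 := mul_le_mul_of_nonpos_left this.le hlβ.le
      push_cast
      rw [ha₂]
      linarith
    calc 2 * (n : ℝ) ^ 4 * β ^ (⌊α * u⌋₊ + 1) ≤ 2 * (n : ℝ) ^ 4 * Real.exp (-(a₂ * u)) := by gcongr
      _ = Real.exp (Real.log 2 + 4 * Real.log n + -(a₂ * u)) := by
          rw [h4, Real.exp_add, Real.exp_add, Real.exp_log two_pos]
      _ ≤ _ := by
          apply Real.exp_le_exp.mpr
          have hu0 : 0 < u := div_pos hn0 (by linarith)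
          have := mul_le_mul_of_nonneg_right hca₂ hu0.le
          linarith
  · rw [exp_div_two_pow, ← Real.exp_add]
    apply Real.exp_le_exp.mpr
    have e : (t : ℝ) = n - k := by rw [hn']; push_cast; ring
    have h6 := mul_le_mul_of_nonneg_right hkn hl2.le
    have h7 : γ * l * n ≤ a₃ * n := mul_le_mul_of_nonneg_right hγl hn0.le
    have h8 : 6 * √(n : ℝ) ≤ c * n := by
      have := mul_le_mul_of_nonneg_left hsqrt.le hs0.le
      rw [← mul_assoc, hss] at this
      linarith
    have h9 : 2 * c * n ≤ a₃ * n := mul_le_mul_of_nonneg_right hca₃ hn0.le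
    rw [e]
    have h11 : a₃ * n = δ * n * Real.log 2 / 2 := by rw [ha₃]; ring
    linarith

/-- Only `n < n₀` remains. There the error is at most `θ < 1`, uniformly in `k`, and `c₁` is chosen
so that `exp (-c₁ n / log n) ≥ θ`, using `n / log n ≤ n₀ / log 2` for `2 ≤ n < n₀`. -/
theorem errorProb_exponent (hG : C.IsGeneratedBy G) (hGr : ∀ k, IsGreedyMatrix (G k))
    (hC : C.IsMaximumLikelihood) {p δ : ℝ} (h0 : 0 < p) (h1 : p < 1 / 2) (hδ : 0 < δ)
    (hδ1 : δ < 1 - entropy p) :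
    ∃ c : ℝ, 0 < c ∧ ∀ k n : ℕ, 2 ≤ n → (k : ℝ) / (1 - entropy p - δ) ≤ (n : ℝ) →
      C.errorProb p k n ≤ Real.exp (-(c * ((n : ℝ) / Real.log n))) := by
  have hH := entropy_pos h0 (by linarith)
  have hl2 : 0 < Real.log 2 := Real.log_pos one_lt_two
  obtain ⟨c₀, hc₀, n₀, hn₀, hlarge⟩ := errorProb_le_of_large hG hGr hC h0 h1 hδ hδ1
  set θ := 1 - (1 - p) ^ n₀ with hθ
  have hθ1 : θ < 1 := by
    have : 0 < (1 - p) ^ n₀ := pow_pos (by linarith) _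
    linarith
  have hθ0 : 0 < θ := by
    have : (1 - p) ^ n₀ < 1 := pow_lt_one₀ (by linarith) (by linarith) (by omega)
    linarith
  have hlθ : Real.log θ < 0 := Real.log_neg hθ0 hθ1
  have hn₀' : (0 : ℝ) < n₀ := by
    have : 0 < n₀ := by omega
    exact_mod_cast this
  set c₁ := -Real.log θ / (n₀ / Real.log 2) with hc₁
  have hc₁0 : 0 < c₁ := div_pos (by linarith) (by positivity)
  refine ⟨min c₀ c₁, lt_min hc₀ hc₁0, fun k n hn2 hkn => ?_⟩
  have hkn : (k : ℝ) ≤ (1 - entropy p - δ) * n := by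
    rw [div_le_iff₀ (by linarith)] at hkn
    linarith
  have hn0 : (0 : ℝ) < n := by
    have : 0 < n := by omega
    exact_mod_cast this
  have hlogn : Real.log 2 ≤ Real.log n := Real.log_le_log two_pos (by exact_mod_cast hn2)
  have hu0 : 0 < (n : ℝ) / Real.log n := div_pos hn0 (by linarith)
  rcases le_or_gt n₀ n with hge | hlt
  · refine (hlarge k n hge hkn).trans (Real.exp_le_exp.mpr ?_)
    have := mul_le_mul_of_nonneg_right (min_le_left c₀ c₁) hu0.le
    linarith
  · have hle1 : (k : ℝ) ≤ n := by nlinarith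
    have hkn' : k ≤ n := by exact_mod_cast hle1
    refine (error_le_one_sub hG hGr hC h0 (by linarith) hkn').trans ?_
    have h2 : (1 - p) ^ n₀ ≤ (1 - p) ^ n :=
      pow_le_pow_of_le_one (by linarith) (by linarith) hlt.le
    have h3 : 1 - (1 - p) ^ n ≤ θ := by linarith
    refine h3.trans ?_
    rw [← Real.exp_log hθ0]
    apply Real.exp_le_exp.mpr
    have h4 : (n : ℝ) / Real.log n ≤ n₀ / Real.log 2 :=
      div_le_div₀ hn₀'.le (by exact_mod_cast hlt.le) hl2 hlogn
    have h5 : c₁ * (n₀ / Real.log 2) = -Real.log θ := by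
      rw [hc₁]; field_simp
    have h6 : min c₀ c₁ * ((n : ℝ) / Real.log n) ≤ c₁ * (n₀ / Real.log 2) :=
      mul_le_mul (min_le_right _ _) h4 hu0.le hc₁0.le
    rw [hθ] at h5 ⊢
    linarith

/-! ### Reasoning about programs -/

/-- The registers that a program may overwrite. -/
def Program.regs : Program → List ℕ
  | .const r _ => [r]
  | .arith _ r _ _ => [r]
  | .load r _ _ => [r]
  | .store _ _ _ => []
  | .seq P Q => P.regs ++ Q.regs
  | .branch _ _ P Q => P.regs ++ Q.regs
  | .loop _ _ P => P.regs

/-- The arrays that a program may overwrite. -/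
def Program.arrays : Program → List ℕ
  | .const _ _ => []
  | .arith _ _ _ _ => []
  | .load _ _ _ => []
  | .store A _ _ => [A]
  | .seq P Q => P.arrays ++ Q.arrays
  | .branch _ _ P Q => P.arrays ++ Q.arrays
  | .loop _ _ P => P.arrays

/-- The states `s` and `s'` agree on everything that `P` does not overwrite. -/
structure Frame (P : Program) (s s' : MachineState) : Prop where
  reg : ∀ r, r ∉ P.regs → s'.reg r = s.reg r
  mem : ∀ A, A ∉ P.arrays → s'.mem A = s.mem A

theorem Frame.refl (P : Program) (s : MachineState) : Frame P s s :=
  ⟨fun _ _ => rfl, fun _ _ => rfl⟩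

@[simp] theorem MachineState.setReg_reg (s : MachineState) (r v r' : ℕ) :
    (s.setReg r v).reg r' = if r' = r then v else s.reg r' := by
  simp [MachineState.setReg, Function.update_apply]

@[simp] theorem MachineState.setReg_mem (s : MachineState) (r v : ℕ) :
    (s.setReg r v).mem = s.mem := rfl

@[simp] theorem MachineState.setMem_reg (s : MachineState) (A i v : ℕ) :
    (s.setMem A i v).reg = s.reg := rfl

@[simp] theorem MachineState.setMem_mem (s : MachineState) (A i v A' : ℕ) :
    (s.setMem A i v).mem A' = if A' = A then Function.update (s.mem A) i v else s.mem A' := by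
  simp [MachineState.setMem, Function.update_apply]

/-- The frame rule. Membership in `regs` and `arrays` is decidable, so `decide` shows which
registers and arrays survive a subprogram, and specifications need only mention what changes. -/
theorem Run.frame {w : ℕ} {P : Program} {s s' : MachineState} {t : ℕ} (h : Run w P s s' t) :
    Frame P s s' := by
  induction h with
  | const s r v h =>
    refine ⟨fun r' hr => ?_, fun _ _ => rfl⟩
    simp only [Program.regs, List.mem_singleton] at hr
    simp [hr]
  | arith s op r a b h =>
    refine ⟨fun r' hr => ?_, fun _ _ => rfl⟩
    simp only [Program.regs, List.mem_singleton] at hr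
    simp [hr]
  | load s r A i =>
    refine ⟨fun r' hr => ?_, fun _ _ => rfl⟩
    simp only [Program.regs, List.mem_singleton] at hr
    simp [hr]
  | store s A i r =>
    refine ⟨fun _ _ => rfl, fun A' hA => ?_⟩
    simp only [Program.arrays, List.mem_singleton] at hA
    simp [hA]
  | seq hP hQ ihP ihQ =>
    refine ⟨fun r hr => ?_, fun A hA => ?_⟩
    · simp only [Program.regs, List.mem_append, not_or] at hr
      rw [ihQ.reg r hr.2, ihP.reg r hr.1]
    · simp only [Program.arrays, List.mem_append, not_or] at hA
      rw [ihQ.mem A hA.2, ihP.mem A hA.1]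
  | branch_true h hP ih =>
    refine ⟨fun r hr => ?_, fun A hA => ?_⟩
    · simp only [Program.regs, List.mem_append, not_or] at hr
      exact ih.reg r hr.1
    · simp only [Program.arrays, List.mem_append, not_or] at hA
      exact ih.mem A hA.1
  | branch_false h hP ih =>
    refine ⟨fun r hr => ?_, fun A hA => ?_⟩
    · simp only [Program.regs, List.mem_append, not_or] at hr
      exact ih.reg r hr.2
    · simp only [Program.arrays, List.mem_append, not_or] at hA
      exact ih.mem A hA.2
  | loop_true h hP hL ihP ihL =>
    refine ⟨fun r hr => ?_, fun A hA => ?_⟩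
    · rw [ihL.reg r hr, ihP.reg r hr]
    · rw [ihL.mem A hA, ihP.mem A hA]
  | loop_false h => exact Frame.refl _ _

/-- Program `P`, started in state `s`, halts, and its final state and running time satisfy `Q`. -/
def WP (w : ℕ) (P : Program) (s : MachineState) (Q : MachineState → ℕ → Prop) : Prop :=
  ∃ s' t, Run w P s s' t ∧ Q s' t

section WP

variable {w : ℕ} {s : MachineState} {P P' : Program} {Q Q' : MachineState → ℕ → Prop}

theorem WP.mono (h : WP w P s Q) (hQ : ∀ s' t, Q s' t → Q' s' t) : WP w P s Q' := by
  obtain ⟨s', t, hr, hq⟩ := h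
  exact ⟨s', t, hr, hQ _ _ hq⟩

theorem WP.frame (h : WP w P s Q) : WP w P s fun s' t => Q s' t ∧ Frame P s s' := by
  obtain ⟨s', t, hr, hq⟩ := h
  exact ⟨s', t, hr, hq, hr.frame⟩

-- This and the following rules are equivalences, so that `simp` executes straight-line code
-- symbolically.
@[simp] theorem wp_const {r v : ℕ} : WP w (.const r v) s Q ↔ v < 2 ^ w ∧ Q (s.setReg r v) 1 := by
  constructor
  · rintro ⟨s', t, hr, hq⟩
    cases hr with
    | const _ _ _ h => exact ⟨h, hq⟩
  · rintro ⟨h, hq⟩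
    exact ⟨_, _, .const s r v h, hq⟩

@[simp] theorem wp_arith {op : ArithOp} {r a b : ℕ} : WP w (.arith op r a b) s Q ↔
    op.eval (s.reg a) (s.reg b) < 2 ^ w ∧ Q (s.setReg r (op.eval (s.reg a) (s.reg b))) 1 := by
  constructor
  · rintro ⟨s', t, hr, hq⟩
    cases hr with
    | arith _ _ _ _ _ h => exact ⟨h, hq⟩
  · rintro ⟨h, hq⟩
    exact ⟨_, _, .arith s op r a b h, hq⟩

@[simp] theorem wp_load {r A i : ℕ} : WP w (.load r A i) s Q ↔ Q (s.setReg r (s.mem A (s.reg i))) 1 := by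
  constructor
  · rintro ⟨s', t, hr, hq⟩
    cases hr
    exact hq
  · intro hq
    exact ⟨_, _, .load s r A i, hq⟩

@[simp] theorem wp_store {A i r : ℕ} :
    WP w (.store A i r) s Q ↔ Q (s.setMem A (s.reg i) (s.reg r)) 1 := by
  constructor
  · rintro ⟨s', t, hr, hq⟩
    cases hr
    exact hq
  · intro hq
    exact ⟨_, _, .store s A i r, hq⟩

@[simp] theorem wp_seq : WP w (.seq P P') s Q ↔
    WP w P s fun s₁ t₁ => WP w P' s₁ fun s₂ t₂ => Q s₂ (t₁ + t₂) := by
  constructor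
  · rintro ⟨s', t, hr, hq⟩
    cases hr with
    | seq hP hQ => exact ⟨_, _, hP, _, _, hQ, hq⟩
  · rintro ⟨s₁, t₁, hP, s₂, t₂, hQ, hq⟩
    exact ⟨_, _, .seq hP hQ, hq⟩

@[simp] theorem wp_branch {a b : ℕ} : WP w (.branch a b P P') s Q ↔
    if s.reg a < s.reg b then WP w P s fun s' t => Q s' (t + 1)
    else WP w P' s fun s' t => Q s' (t + 1) := by
  constructor
  · rintro ⟨s', t, hr, hq⟩
    cases hr with
    | branch_true h hP => rw [if_pos h]; exact ⟨_, _, hP, hq⟩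
    | branch_false h hP => rw [if_neg h]; exact ⟨_, _, hP, hq⟩
  · intro h
    split_ifs at h with hab
    · obtain ⟨s', t, hP, hq⟩ := h
      exact ⟨_, _, .branch_true hab hP, hq⟩
    · obtain ⟨s', t, hP, hq⟩ := h
      exact ⟨_, _, .branch_false hab hP, hq⟩

/-- `for i < b do P`, where register `2` holds the number one. -/
def Program.forLoop (i b : ℕ) (P : Program) : Program :=
  .seq (.const i 0) (.loop i b (.seq P (.arith .add i i 2)))

/-- The rule for counted loops with invariant `I` and at most `T` steps per iteration. -/
theorem wp_for {i b N T : ℕ} (I : ℕ → MachineState → Prop)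
    (hreg : i ∉ P.regs ∧ b ∉ P.regs ∧ 2 ∉ P.regs ∧ i ≠ b ∧ i ≠ 2)
    (hone : s.reg 2 = 1) (hb : s.reg b = N) (hw : N < 2 ^ w)
    (hI : ∀ m s v, I m s → I m (s.setReg i v)) (hI0 : I 0 s)
    (hstep : ∀ m < N, ∀ s₁, Frame (.forLoop i b P) s s₁ → s₁.reg i = m → I m s₁ →
      WP w P s₁ fun s₂ t => t ≤ T ∧ I (m + 1) s₂) :
    WP w (.forLoop i b P) s fun s' t =>
      t ≤ N * (T + 2) + 2 ∧ I N s' ∧ Frame (.forLoop i b P) s s' := by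
  obtain ⟨hi, hbP, h2, hib, hi2⟩ := hreg
  have hregs : ∀ r, r ∉ (Program.forLoop i b P).regs ↔ r ≠ i ∧ r ∉ P.regs := by
    intro r
    simp only [Program.forLoop, Program.regs, List.mem_append, List.mem_singleton, not_or]
    tauto
  have harr : ∀ A, A ∉ (Program.forLoop i b P).arrays ↔ A ∉ P.arrays := by
    intro A
    simp only [Program.forLoop, Program.arrays, List.mem_append, List.not_mem_nil, not_or]
    tauto
  -- Induction on the number `j` of iterations still to run. Each costs two steps beyond the body,
  -- for the test and the increment; the initialisation and the last test are the final `+ 2`.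
  have key : ∀ j m, m + j = N → ∀ s₁, Frame (.forLoop i b P) s s₁ → s₁.reg i = m → I m s₁ →
      WP w (.loop i b (.seq P (.arith .add i i 2))) s₁ fun s' t => t ≤ j * (T + 2) + 1 ∧ I N s' := by
    intro j
    induction j with
    | zero =>
      intro m hm s₁ hf him hIm
      have hbN : s₁.reg b = N := (hf.reg b ((hregs b).mpr ⟨hib.symm, hbP⟩)).trans hb
      obtain rfl : m = N := by omega
      exact ⟨s₁, 1, .loop_false (by omega), by omega, hIm⟩
    | succ j ih =>
      intro m hm s₁ hf him hIm
      have hbN : s₁.reg b = N := (hf.reg b ((hregs b).mpr ⟨hib.symm, hbP⟩)).trans hb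
      have h21 : s₁.reg 2 = 1 := (hf.reg 2 ((hregs 2).mpr ⟨hi2.symm, h2⟩)).trans hone
      obtain ⟨s₂, t, hr, ht, hI2⟩ := hstep m (by omega) s₁ hf him hIm
      have hf2 := hr.frame
      have hi2' : s₂.reg i = m := (hf2.reg i hi).trans him
      have h22 : s₂.reg 2 = 1 := (hf2.reg 2 h2).trans h21
      have hsum : ArithOp.add.eval (s₂.reg i) (s₂.reg 2) = m + 1 := by
        rw [hi2', h22]; rfl
      have hr3 := Run.arith (w := w) s₂ .add i i 2 (by rw [hsum]; omega)
      rw [hsum] at hr3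
      obtain ⟨s', t', hr', ht', hI'⟩ := ih (m + 1) (by omega) (s₂.setReg i (m + 1))
        ⟨fun r hr => by
          rw [hregs] at hr
          rw [MachineState.setReg_reg, if_neg hr.1, hf2.reg r hr.2,
            hf.reg r ((hregs r).mpr hr)],
        fun A hA => by
          rw [harr] at hA
          rw [MachineState.setReg_mem, hf2.mem A hA, hf.mem A ((harr A).mpr hA)]⟩
        (by simp) (hI _ _ _ hI2)
      refine ⟨s', _, .loop_true (by omega) (.seq hr hr3) hr', ?_, hI'⟩
      have : (j + 1) * (T + 2) = j * (T + 2) + T + 2 := by ring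
      omega
  obtain ⟨s', t, hr, ht, hI'⟩ := key N 0 (by omega) (s.setReg i 0)
    ⟨fun r hr => by
      rw [hregs] at hr
      rw [MachineState.setReg_reg, if_neg hr.1], fun A _ => rfl⟩ (by simp) (hI _ _ _ hI0)
  have hfull : Run w (.forLoop i b P) s s' (1 + t) :=
    .seq (.const s i 0 (by positivity)) hr
  exact ⟨s', 1 + t, hfull, by omega, hI', hfull.frame⟩

end WP

/-- A single step that changes only an auxiliary register. -/
def Program.skip : Program := .const 31 0

/-- `P; Q; …` -/
def Program.block : List Program → Program
  | [] => .skip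
  | [P] => P
  | P :: Q :: L => .seq P (Program.block (Q :: L))

attribute [simp] Program.block ArithOp.eval

@[simp] theorem wp_skip {w : ℕ} {s : MachineState} {Q : MachineState → ℕ → Prop} :
    WP w .skip s Q ↔ Q (s.setReg 31 0) 1 := by
  rw [Program.skip, wp_const]
  exact and_iff_right (by positivity)

/-! ### The greedy step as a program -/

/-- The conventions that hold throughout the programs below: `k` and `n` are in registers `0` and
`1`, registers `2` to `6` hold constants, array `7` is a table of inner products, and the word size
suffices. -/
structure Context (k n w : ℕ) (s : MachineState) : Prop where
  reg0 : s.reg 0 = k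
  reg1 : s.reg 1 = n
  reg2 : s.reg 2 = 1
  reg3 : s.reg 3 = 2 ^ k
  reg4 : s.reg 4 = 2
  reg5 : s.reg 5 = 8
  reg6 : s.reg 6 = 0
  table : ∀ a < 2 ^ k, ∀ b < 2 ^ k, s.mem 7 (a * 2 ^ k + b) = bitDot k a b % 2
  fits : 64 * ((2 ^ k * 2 ^ k) * ((n + 1) * (n + 1))) ≤ 2 ^ w

theorem Context.of_frame {k n w : ℕ} {s s' : MachineState} {P : Program} (h : Context k n w s)
    (hf : Frame P s s') (hP : (∀ r < 7, r ∉ P.regs) ∧ 7 ∉ P.arrays) : Context k n w s' where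
  reg0 := (hf.reg 0 (hP.1 0 (by norm_num))).trans h.reg0
  reg1 := (hf.reg 1 (hP.1 1 (by norm_num))).trans h.reg1
  reg2 := (hf.reg 2 (hP.1 2 (by norm_num))).trans h.reg2
  reg3 := (hf.reg 3 (hP.1 3 (by norm_num))).trans h.reg3
  reg4 := (hf.reg 4 (hP.1 4 (by norm_num))).trans h.reg4
  reg5 := (hf.reg 5 (hP.1 5 (by norm_num))).trans h.reg5
  reg6 := (hf.reg 6 (hP.1 6 (by norm_num))).trans h.reg6
  table := by rw [hf.mem 7 hP.2]; exact h.table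
  fits := h.fits

theorem Context.setReg {k n w : ℕ} {s : MachineState} (h : Context k n w s) {r : ℕ} (hr : 7 ≤ r)
    (v : ℕ) : Context k n w (s.setReg r v) := by
  have hne : ∀ r' < 7, (s.setReg r v).reg r' = s.reg r' := fun r' h' => by
    rw [MachineState.setReg_reg, if_neg (by omega)]
  exact ⟨(hne 0 (by norm_num)).trans h.reg0, (hne 1 (by norm_num)).trans h.reg1,
    (hne 2 (by norm_num)).trans h.reg2, (hne 3 (by norm_num)).trans h.reg3,
    (hne 4 (by norm_num)).trans h.reg4, (hne 5 (by norm_num)).trans h.reg5,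
    (hne 6 (by norm_num)).trans h.reg6, h.table, h.fits⟩

/-- Weakenings of `fits`, linear in the products that occur, with which `omega` excludes overflow.
-/
theorem Context.bounds {k n w : ℕ} {s : MachineState} (h : Context k n w s) :
    64 * 2 ^ k ≤ 2 ^ w ∧ 64 * (2 ^ k * 2 ^ k) ≤ 2 ^ w ∧ 64 * ((n + 1) * (n + 1)) ≤ 2 ^ w ∧
      64 * (n + 1) ≤ 2 ^ w ∧ 64 * ((2 ^ k * 2 ^ k) * (n + 1)) ≤ 2 ^ w ∧
      64 * (2 ^ k + (n + 1)) ≤ 2 * 2 ^ w := by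
  have hK : 1 ≤ 2 ^ k := Nat.one_le_two_pow
  have hf := h.fits
  generalize 2 ^ k = K at *
  have h1 : K * 1 ≤ K * K := Nat.mul_le_mul_left K hK
  have h2 : (n + 1) * 1 ≤ (n + 1) * (n + 1) := Nat.mul_le_mul_left _ (by omega)
  have h3 : (K * K) * 1 ≤ (K * K) * (n + 1) := Nat.mul_le_mul_left _ (by omega)
  have h4 : (K * K) * (n + 1) ≤ (K * K) * ((n + 1) * (n + 1)) := Nat.mul_le_mul_left _ (by omega)
  have h5 : 1 * ((n + 1) * (n + 1)) ≤ (K * K) * ((n + 1) * (n + 1)) :=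
    Nat.mul_le_mul_right _ (by omega)
  omega

theorem sum_ite_le (m : ℕ) (p : ℕ → Prop) [DecidablePred p] (f : ℕ → ℕ) (hf : ∀ x, f x ≤ 1) :
    ∑ x ∈ Finset.range m, (if p x then f x else 0) ≤ m := by
  refine (Finset.sum_le_card_nsmul _ _ 1 fun x _ => ?_).trans ?_
  · split_ifs
    · exact hf x
    · exact zero_le_one
  · simp

/-- The number of unmarked words of weight `c`, according to tables of weights and marks. -/
def classCount (k : ℕ) (wt mk : ℕ → ℕ) (c : ℕ) : ℕ :=
  ∑ x ∈ Finset.range (2 ^ k), if wt x = c ∧ mk x = 0 then 1 else 0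

/-- The number of unmarked words of weight `c` that are elevated by the word with number `r`. -/
def classElevated (k : ℕ) (wt mk : ℕ → ℕ) (r c : ℕ) : ℕ :=
  ∑ x ∈ Finset.range (2 ^ k), if wt x = c ∧ mk x = 0 then bitDot k r x % 2 else 0

/-- The number of words of weight `d`. -/
def weightCount (k : ℕ) (wt : ℕ → ℕ) (d : ℕ) : ℕ :=
  ∑ x ∈ Finset.range (2 ^ k), if wt x = d then 1 else 0

/-- The number of words of weight `d` that are elevated by the word with number `r`. -/
def weightElevated (k : ℕ) (wt : ℕ → ℕ) (r d : ℕ) : ℕ :=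
  ∑ x ∈ Finset.range (2 ^ k), if wt x = d then bitDot k r x % 2 else 0

theorem classCount_le (k : ℕ) (wt mk : ℕ → ℕ) (c : ℕ) : classCount k wt mk c ≤ 2 ^ k :=
  sum_ite_le _ _ (fun _ => 1) fun _ => le_rfl

theorem classElevated_le (k : ℕ) (wt mk : ℕ → ℕ) (r c : ℕ) :
    classElevated k wt mk r c ≤ 2 ^ k :=
  sum_ite_le _ _ (fun x => bitDot k r x % 2) fun x => by omega

theorem weightElevated_le (k : ℕ) (wt : ℕ → ℕ) (r d : ℕ) : weightElevated k wt r d ≤ 2 ^ k :=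
  sum_ite_le _ _ (fun x => bitDot k r x % 2) fun x => by omega

theorem classCount_eq_zero {k : ℕ} {wt mk : ℕ → ℕ} {c : ℕ} (h : ∀ x < 2 ^ k, wt x ≠ c) :
    classCount k wt mk c = 0 :=
  Finset.sum_eq_zero fun x hx => if_neg fun hh => h x (Finset.mem_range.mp hx) hh.1

theorem classElevated_eq_zero {k : ℕ} {wt mk : ℕ → ℕ} {r c : ℕ} (h : ∀ x < 2 ^ k, wt x ≠ c) :
    classElevated k wt mk r c = 0 :=
  Finset.sum_eq_zero fun x hx => if_neg fun hh => h x (Finset.mem_range.mp hx) hh.1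

/-- Count, for every weight, the unmarked words. -/
def countUnmarked : Program :=
  .forLoop 10 3 <| .block [.load 11 2 10, .load 12 3 10,
    .branch 12 2 (.block [.load 13 4 11, .arith .add 13 13 2, .store 4 11 13]) .skip]

theorem wp_countUnmarked {k n w : ℕ} {s : MachineState} (hc : Context k n w s)
    (h0 : ∀ c, s.mem 4 c = 0) :
    WP w countUnmarked s fun s' t => t ≤ 2 ^ k * 32 + 2 ∧
      ∀ c, s'.mem 4 c = classCount k (s.mem 2) (s.mem 3) c := by
  have hb := hc.bounds
  refine (wp_for (T := 30) (fun m s' => ∀ c, s'.mem 4 c =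
    ∑ x ∈ Finset.range m, if s.mem 2 x = c ∧ s.mem 3 x = 0 then 1 else 0)
    (by decide) hc.reg2 hc.reg3 (by have := Nat.one_le_two_pow (n := k); omega)
    (fun m s v h => h) (by simpa using h0) ?_).mono fun s' t h => ⟨h.1, h.2.1⟩
  intro m hm s₁ hf him hI
  have hc₁ := hc.of_frame hf (by decide)
  have h2 := hf.mem 2 (by decide)
  have h3 := hf.mem 3 (by decide)
  have hle : s₁.mem 4 (s.mem 2 m) ≤ m := by
    rw [hI]
    exact sum_ite_le m _ (fun _ => 1) fun _ => le_rfl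
  simp [him, hc₁.reg2, h2, h3, -Finset.sum_boole]
  split_ifs with h
  · refine ⟨by omega, fun c => ?_⟩
    rw [Finset.sum_range_succ, ← hI, Function.update_apply]
    by_cases h' : s.mem 2 m = c
    · simp [h', h]
    · rw [if_neg (Ne.symm h'), if_neg (fun hh => h' hh.1)]
      rfl
  · intro c
    rw [Finset.sum_range_succ, ← hI, if_neg (fun hh => h hh.2)]
    rfl

/-- Mark all weight classes with few unmarked words. -/
def markClasses : Program :=
  .block [.arith .mul 14 20 20, .arith .add 14 14 14, .forLoop 10 3 <|
    .block [.load 11 2 10, .load 13 4 11, .branch 13 14 (.store 3 10 2) .skip]]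

theorem wp_markClasses {k n w N : ℕ} {s : MachineState} (hc : Context k n w s)
    (hN : s.reg 20 = N) (hNn : N ≤ n) :
    WP w markClasses s fun s' t => t ≤ 2 ^ k * 32 + 4 ∧
      ∀ x, s'.mem 3 x =
        if x < 2 ^ k ∧ s.mem 4 (s.mem 2 x) < N * N + N * N then 1 else s.mem 3 x := by
  have hb := hc.bounds
  have hNN : N * N ≤ (n + 1) * (n + 1) := Nat.mul_le_mul (by omega) (by omega)
  simp only [markClasses, Program.block, wp_seq, wp_arith, ArithOp.eval]
  simp [hN]
  refine ⟨by omega, by omega, ?_⟩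
  have hc' := (hc.setReg (show 7 ≤ 14 by norm_num) (N * N)).setReg (show 7 ≤ 14 by norm_num)
    (N * N + N * N)
  refine (wp_for (T := 30) (fun m s' => ∀ x, s'.mem 3 x =
    if x < m ∧ s.mem 4 (s.mem 2 x) < N * N + N * N then 1 else s.mem 3 x)
    (by decide) hc'.reg2 hc'.reg3 (by have := Nat.one_le_two_pow (n := k); omega)
    (fun m s v h => h) (by simp) ?_).mono fun s' t h => ⟨by omega, h.2.1⟩
  intro m hm s₁ hf him hI
  have hc₁ := hc'.of_frame hf (by decide)
  have h2 := hf.mem 2 (by decide)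
  have h4 := hf.mem 4 (by decide)
  have h14 := hf.reg 14 (by decide)
  simp at h2 h4 h14
  have key : ∀ x, (x < m + 1 ∧ s.mem 4 (s.mem 2 x) < N * N + N * N) ↔
      (x < m ∧ s.mem 4 (s.mem 2 x) < N * N + N * N) ∨
      (x = m ∧ s.mem 4 (s.mem 2 m) < N * N + N * N) := by
    intro x
    constructor
    · rintro ⟨h, h'⟩
      rcases Nat.lt_succ_iff_lt_or_eq.mp h with h | rfl
      · exact Or.inl ⟨h, h'⟩
      · exact Or.inr ⟨rfl, h'⟩
    · rintro (⟨h, h'⟩ | ⟨rfl, h'⟩)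
      · exact ⟨by omega, h'⟩
      · exact ⟨by omega, h'⟩
  simp [him, hc₁.reg2, h2, h4, h14, -Order.lt_add_one_iff]
  split_ifs with h
  · intro x
    rw [Function.update_apply]
    by_cases hx : x = m
    · rw [if_pos hx, if_pos ((key x).mpr (Or.inr ⟨hx, h⟩))]
    · rw [if_neg hx, hI]
      refine if_congr ?_ rfl rfl
      rw [key]
      tauto
  · intro x
    rw [hI]
    refine if_congr ?_ rfl rfl
    rw [key]
    tauto

/-- Find the minimum positive weight. -/
def findMinWeight : Program :=
  .block [.arith .add 15 20 2, .forLoop 10 3 <| .block [.load 11 2 10,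
    .branch 11 15 (.branch 6 11 (.arith .add 15 11 6) .skip) .skip]]

theorem wp_findMinWeight {k n w N : ℕ} {s : MachineState} (hc : Context k n w s)
    (hN : s.reg 20 = N) (hNn : N ≤ n) :
    WP w findMinWeight s fun s' t => t ≤ 2 ^ k * 32 + 4 ∧
      0 < s'.reg 15 ∧ (∀ x < 2 ^ k, 0 < s.mem 2 x → s'.reg 15 ≤ s.mem 2 x) ∧
      (s'.reg 15 = N + 1 ∨ ∃ x < 2 ^ k, s.mem 2 x = s'.reg 15) := by
  have hb := hc.bounds
  simp only [findMinWeight, Program.block, wp_seq, wp_arith, ArithOp.eval]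
  simp [hN, hc.reg2]
  refine ⟨by omega, ?_⟩
  -- Register `15` starts at `N + 1`, above every weight that `N` rows can produce. The value
  -- survives only if no nonzero weight is found.
  have hc' := hc.setReg (show 7 ≤ 15 by norm_num) (N + 1)
  refine (wp_for (T := 30) (fun m s' => 0 < s'.reg 15 ∧ s'.reg 15 ≤ N + 1 ∧
    (∀ x < m, 0 < s.mem 2 x → s'.reg 15 ≤ s.mem 2 x) ∧
      (s'.reg 15 = N + 1 ∨ ∃ x < m, s.mem 2 x = s'.reg 15))
    (by decide) hc'.reg2 hc'.reg3 (by have := Nat.one_le_two_pow (n := k); omega)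
    (fun m s v h => by simpa using h) (by simp) ?_).mono
    fun s' t h => ⟨by omega, h.2.1.1, h.2.1.2.2⟩
  intro m hm s₁ hf him ⟨hI1, hI2, hI3, hI4⟩
  have hc₁ := hc'.of_frame hf (by decide)
  have h2 := hf.mem 2 (by decide)
  simp at h2
  simp [him, hc₁.reg6, h2, -Order.lt_add_one_iff]
  have hlt : ∀ d, d ≤ s₁.reg 15 → (0 < s.mem 2 m → d ≤ s.mem 2 m) →
      ∀ x < m + 1, 0 < s.mem 2 x → d ≤ s.mem 2 x := by
    intro d hd hdm x hx hx0
    rcases Nat.lt_succ_iff_lt_or_eq.mp hx with h | rfl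
    · exact hd.trans (hI3 x h hx0)
    · exact hdm hx0
  have hex : (s₁.reg 15 = N + 1 ∨ ∃ x < m + 1, s.mem 2 x = s₁.reg 15) := by
    rcases hI4 with h | ⟨x, hx, h⟩
    · exact Or.inl h
    · exact Or.inr ⟨x, by omega, h⟩
  split_ifs with h h'
  · exact ⟨by omega, h', by omega, hlt _ h.le fun _ => le_rfl, Or.inr ⟨m, by omega, rfl⟩⟩
  · exact ⟨hI1, hI2, hlt _ le_rfl fun h0 => absurd h0 h', hex⟩
  · exact ⟨hI1, hI2, hlt _ le_rfl fun h0 => not_lt.mp h, hex⟩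

/-- Count the words of minimum positive weight. -/
def countMinWeight : Program :=
  .block [.const 16 0, .forLoop 10 3 <| .block [.load 11 2 10,
    .branch 11 15 .skip (.branch 15 11 .skip (.arith .add 16 16 2))]]

/-- The only test of the machine is `<`, so equality is tested by two failing strict comparisons. -/
theorem wp_countMinWeight {k n w : ℕ} {s : MachineState} (hc : Context k n w s) :
    WP w countMinWeight s fun s' t => t ≤ 2 ^ k * 32 + 4 ∧
      s'.reg 16 = weightCount k (s.mem 2) (s.reg 15) := by
  have hb := hc.bounds
  simp only [countMinWeight, Program.block, wp_seq, wp_const]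
  refine ⟨by positivity, ?_⟩
  have hc' := hc.setReg (show 7 ≤ 16 by norm_num) 0
  refine (wp_for (T := 30) (fun m s' => s'.reg 16 =
      ∑ x ∈ Finset.range m, if s.mem 2 x = s.reg 15 then 1 else 0)
    (by decide) hc'.reg2 hc'.reg3 (by have := Nat.one_le_two_pow (n := k); omega)
    (fun m s v h => by simpa using h) (by simp) ?_).mono
    fun s' t h => ⟨by omega, h.2.1⟩
  intro m hm s₁ hf him hI
  have hc₁ := hc'.of_frame hf (by decide)
  have h2 := hf.mem 2 (by decide)
  have h15 := hf.reg 15 (by decide)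
  have hle : s₁.reg 16 ≤ m := by
    rw [hI]
    exact sum_ite_le m _ (fun _ => 1) fun _ => le_rfl
  simp at h2 h15
  simp [him, hc₁.reg2, h2, h15, Finset.sum_range_succ, ← hI, -Finset.sum_boole]
  have hw : s₁.reg 16 + 1 < 2 ^ w := by omega
  split_ifs <;> omega

/-- Count, for every weight, the unmarked words that are elevated by the candidate in register
`23`, and count the elevated words of minimum positive weight. -/
def tally : Program :=
  .block [.const 24 0, .arith .mul 30 23 3, .forLoop 10 3 <| .block [
    .load 11 2 10, .load 12 3 10, .arith .add 13 30 10, .load 13 7 13,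
    .branch 12 2 (.block [.load 14 6 11, .arith .add 14 14 13, .store 6 11 14]) .skip,
    .branch 11 15 .skip (.branch 15 11 .skip (.arith .add 24 24 13))]]

theorem wp_tally {k n w r : ℕ} {s : MachineState} (hc : Context k n w s) (hr : s.reg 23 = r)
    (hrk : r < 2 ^ k) (h0 : ∀ c, s.mem 6 c = 0) :
    WP w tally s fun s' t => t ≤ 2 ^ k * 32 + 5 ∧
      (∀ c, s'.mem 6 c = classElevated k (s.mem 2) (s.mem 3) r c) ∧
      s'.reg 24 = weightElevated k (s.mem 2) r (s.reg 15) := by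
  have hb := hc.bounds
  have hrK : r * 2 ^ k ≤ 2 ^ k * 2 ^ k := Nat.mul_le_mul_right _ hrk.le
  simp only [tally, Program.block, wp_seq, wp_const, wp_arith, ArithOp.eval]
  simp [hr, hc.reg3]
  refine ⟨by omega, ?_⟩
  have hc' := (hc.setReg (show 7 ≤ 24 by norm_num) 0).setReg (show 7 ≤ 30 by norm_num) (r * 2 ^ k)
  refine (wp_for (T := 30) (fun m s' =>
      (∀ c, s'.mem 6 c = ∑ x ∈ Finset.range m,
        if s.mem 2 x = c ∧ s.mem 3 x = 0 then bitDot k r x % 2 else 0) ∧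
      s'.reg 24 = ∑ x ∈ Finset.range m,
        if s.mem 2 x = s.reg 15 then bitDot k r x % 2 else 0)
    (by decide) hc'.reg2 hc'.reg3 (by have := Nat.one_le_two_pow (n := k); omega)
    (fun m s v h => by simpa using h) (by simpa using h0) ?_).mono
    fun s' t h => ⟨by omega, h.2.1⟩
  intro m hm s₁ hf him ⟨hI1, hI2⟩
  have hc₁ := hc'.of_frame hf (by decide)
  have h2 := hf.mem 2 (by decide)
  have h3 := hf.mem 3 (by decide)
  have h15 := hf.reg 15 (by decide)
  have h30 := hf.reg 30 (by decide)
  simp at h2 h3 h15 h30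
  have hdot := hc₁.table r hrk m hm
  have hle1 : ∀ c, s₁.mem 6 c ≤ m := fun c => by
    rw [hI1]
    exact sum_ite_le m _ (fun x => bitDot k r x % 2) fun x => by omega
  have hle2 : s₁.reg 24 ≤ m := by
    rw [hI2]
    exact sum_ite_le m _ (fun x => bitDot k r x % 2) fun x => by omega
  have hl := hle1 (s.mem 2 m)
  simp [him, hc₁.reg2, h2, h3, h15, h30, hdot, Finset.sum_range_succ, ← hI1, ← hI2]
  refine ⟨by omega, ?_⟩
  have hw24 : s₁.reg 24 + bitDot k r m % 2 < 2 ^ w := by omega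
  have hw6 : s₁.mem 6 (s.mem 2 m) + bitDot k r m % 2 < 2 ^ w := by omega
  have hupd : ∀ c, s.mem 3 m = 0 → Function.update (s₁.mem 6) (s.mem 2 m)
      (s₁.mem 6 (s.mem 2 m) + bitDot k r m % 2) c =
      s₁.mem 6 c + if s.mem 2 m = c ∧ s.mem 3 m = 0 then bitDot k r m % 2 else 0 := by
    intro c h
    rw [Function.update_apply]
    by_cases h' : s.mem 2 m = c
    · simp [h', h]
    · rw [if_neg (Ne.symm h'), if_neg (fun hh => h' hh.1)]
      rfl
  split_ifs with a b c b c
  · exact ⟨hw6, fun c => hupd c a, fun h => by omega⟩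
  · exact ⟨hw6, fun c => hupd c a, fun h => by omega⟩
  · exact ⟨hw6, hw24, fun c => hupd c a, fun h => by omega⟩
  · exact ⟨fun h => absurd h a, fun h => by omega⟩
  · exact ⟨fun h => absurd h a, fun h => by omega⟩
  · exact ⟨hw24, fun h => absurd h a, fun h => by omega⟩

/-- The condition for `e` elevated words among `c` words to be a `1 / (2 √N)`-split, in integer
arithmetic. -/
def Balanced (N c e : ℕ) : Prop :=
  (c - (e + e) + (e + e - c)) * (c - (e + e) + (e + e - c)) * N ≤ c * c

/-- Check whether all unmarked parts of weight classes are split. -/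
def checkSplits : Program :=
  .block [.const 25 1, .forLoop 10 3 <| .block [.load 12 3 10, .branch 12 2 (.block [
    .load 11 2 10, .load 13 4 11, .load 14 6 11, .arith .add 14 14 14, .arith .sub 17 13 14,
    .arith .sub 18 14 13, .arith .add 17 17 18, .arith .mul 17 17 17, .arith .mul 17 17 20,
    .arith .mul 18 13 13, .branch 18 17 (.const 25 0) .skip]) .skip]]

/-- One of the two truncated differences is zero, so their sum is `|c - 2 e|`, and the test is
`splits_iff_sq_le`. Classes are visited through their unmarked words, perhaps repeatedly, which
keeps the cost independent of `n`. -/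
theorem wp_checkSplits {k n w N : ℕ} {s : MachineState} (hc : Context k n w s)
    (hN : s.reg 20 = N) (hNn : N ≤ n) (h4 : ∀ c, s.mem 4 c ≤ 2 ^ k) (h6 : ∀ c, s.mem 6 c ≤ 2 ^ k) :
    WP w checkSplits s fun s' t => t ≤ 2 ^ k * 32 + 5 ∧ s'.reg 25 ≤ 1 ∧
      (s'.reg 25 = 1 ↔
        ∀ x < 2 ^ k, s.mem 3 x = 0 → Balanced N (s.mem 4 (s.mem 2 x)) (s.mem 6 (s.mem 2 x))) := by
  have hb := hc.bounds
  simp only [checkSplits, Program.block, wp_seq, wp_const]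
  refine ⟨by omega, ?_⟩
  have hc' := hc.setReg (show 7 ≤ 25 by norm_num) 1
  refine (wp_for (T := 30) (fun m s' => s'.reg 25 ≤ 1 ∧ (s'.reg 25 = 1 ↔
        ∀ x < m, s.mem 3 x = 0 → Balanced N (s.mem 4 (s.mem 2 x)) (s.mem 6 (s.mem 2 x))))
    (by decide) hc'.reg2 hc'.reg3 (by have := Nat.one_le_two_pow (n := k); omega)
    (fun m s v h => by simpa using h) (by simp) ?_).mono
    fun s' t h => ⟨by omega, h.2.1⟩
  intro m hm s₁ hf him ⟨hI1, hI2⟩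
  have hc₁ := hc'.of_frame hf (by decide)
  have e2 := hf.mem 2 (by decide)
  have e3 := hf.mem 3 (by decide)
  have e4 := hf.mem 4 (by decide)
  have e6 := hf.mem 6 (by decide)
  have e20 := hf.reg 20 (by decide)
  simp at e2 e3 e4 e6 e20
  rw [hN] at e20
  have key : (∀ x < m + 1, s.mem 3 x = 0 →
        Balanced N (s.mem 4 (s.mem 2 x)) (s.mem 6 (s.mem 2 x))) ↔
      (∀ x < m, s.mem 3 x = 0 → Balanced N (s.mem 4 (s.mem 2 x)) (s.mem 6 (s.mem 2 x))) ∧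
      (s.mem 3 m = 0 → Balanced N (s.mem 4 (s.mem 2 m)) (s.mem 6 (s.mem 2 m))) := by
    constructor
    · exact fun h => ⟨fun x hx => h x (by omega), h m (by omega)⟩
    · rintro ⟨h, h'⟩ x hx
      rcases Nat.lt_succ_iff_lt_or_eq.mp hx with hx | rfl
      · exact h x hx
      · exact h'
  rw [← hI2] at key
  simp only [key]
  simp [him, hc₁.reg2, e2, e3, e4, e6, e20]
  have hc4 := h4 (s.mem 2 m)
  have hc6 := h6 (s.mem 2 m)
  unfold Balanced
  generalize s.mem 4 (s.mem 2 m) = c at *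
  generalize s.mem 6 (s.mem 2 m) = e at *
  set d := c - (e + e) + (e + e - c) with hd
  have hd2 : d ≤ 2 * 2 ^ k := by omega
  have hdd : d * d ≤ (2 * 2 ^ k) * (2 * 2 ^ k) := Nat.mul_le_mul hd2 hd2
  have hddN : d * d * N ≤ (2 * 2 ^ k) * (2 * 2 ^ k) * (n + 1) := Nat.mul_le_mul hdd (by omega)
  have hcc : c * c ≤ 2 ^ k * 2 ^ k := Nat.mul_le_mul hc4 hc4
  have hw1 : d * d < 2 ^ w := by
    rw [show 2 * 2 ^ k * (2 * 2 ^ k) = 4 * (2 ^ k * 2 ^ k) by ring] at hdd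
    have := Nat.one_le_two_pow (n := w)
    omega
  have hw2 : d * d * N < 2 ^ w := by
    rw [show 2 * 2 ^ k * (2 * 2 ^ k) * (n + 1) = 4 * (2 ^ k * 2 ^ k * (n + 1)) by ring] at hddN
    have := Nat.one_le_two_pow (n := w)
    omega
  have := Nat.one_le_two_pow (n := w)
  split_ifs with a b
  · refine ⟨by omega, by omega, by omega, by omega, hw1, hw2, by omega, fun _ => ⟨a, not_le.mpr b⟩⟩
  · refine ⟨by omega, by omega, by omega, by omega, hw1, hw2, by omega, hI1, fun _ _ => not_lt.mp b⟩
  · exact ⟨hI1, fun _ h => absurd h a⟩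

/-- Set the entries of array `A` for all weights to zero. -/
def clear (A : ℕ) : Program :=
  .forLoop 10 3 <| .block [.load 11 2 10, .store A 11 6]

/-- Only cells indexed by weights that occur can be nonzero. Resetting just these takes `O(2 ^ k)`
steps, whatever the range of the weights. -/
theorem wp_clear {k n w A : ℕ} {s : MachineState} (hc : Context k n w s) (hA : A ≠ 2 ∧ A ≠ 7)
    (h : ∀ c, s.mem A c = 0 ∨ ∃ x < 2 ^ k, s.mem 2 x = c) :
    WP w (clear A) s fun s' t => t ≤ 2 ^ k * 32 + 2 ∧ ∀ c, s'.mem A c = 0 := by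
  have hb := hc.bounds
  refine (wp_for (T := 30) (fun m s' => ∀ c, s'.mem A c = 0 ∨ ∃ x < 2 ^ k, m ≤ x ∧ s.mem 2 x = c)
    (by simp [Program.regs]) hc.reg2 hc.reg3 (by have := Nat.one_le_two_pow (n := k); omega)
    (fun m s v h => h) (by simpa using h) ?_).mono fun s' t h => ⟨h.1, fun c => ?_⟩
  · intro m hm s₁ hf him hI
    have h2 := hf.mem 2 (by simp [Program.arrays, Program.forLoop, hA.1.symm])
    have h6 := hf.reg 6 (by simp [Program.regs, Program.forLoop])
    simp [him, h2, h6, hc.reg6, Function.update_apply]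
    intro c
    by_cases hcm : c = s.mem 2 m
    · exact Or.inl fun h => absurd hcm h
    · rcases hI c with h | ⟨x, hx, hmx, hxc⟩
      · exact Or.inl fun _ => h
      · refine Or.inr ⟨x, hx, ?_, hxc⟩
        by_contra hlt
        obtain rfl : x = m := by omega
        exact hcm hxc.symm
  · rcases h.2.1 c with h | ⟨x, hx, hmx, _⟩
    · exact h
    · omega

/-- Test the candidate with number `K - 1 - i`, where `i` is in register `22`, and store it in
register `21` if it is suitable. -/
def testCandidate : Program :=
  .block [.arith .sub 23 3 2, .arith .sub 23 23 22, tally, checkSplits, clear 6,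
    .arith .mul 24 24 5, .branch 24 16 .skip (.branch 25 2 .skip (.arith .add 21 23 6))]

/-- The candidate with number `r` passes the test, according to the tables of weights, marks and
counts. -/
def Passes (k N d : ℕ) (wt mk cnt : ℕ → ℕ) (r : ℕ) : Prop :=
  (∀ x < 2 ^ k, mk x = 0 → Balanced N (cnt (wt x)) (classElevated k wt mk r (wt x))) ∧
    weightCount k wt d ≤ weightElevated k wt r d * 8

open Classical in
theorem wp_testCandidate {k n w N i : ℕ} {s : MachineState} (hc : Context k n w s)
    (hN : s.reg 20 = N) (hNn : N ≤ n) (hi : s.reg 22 = i) (hik : i < 2 ^ k)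
    (h4 : ∀ c, s.mem 4 c ≤ 2 ^ k) (h6 : ∀ c, s.mem 6 c = 0)
    (h16 : s.reg 16 = weightCount k (s.mem 2) (s.reg 15)) :
    WP w testCandidate s fun s' t => t ≤ 2 ^ k * 96 + 30 ∧ (∀ c, s'.mem 6 c = 0) ∧
      s'.reg 21 = if Passes k N (s.reg 15) (s.mem 2) (s.mem 3) (s.mem 4) (2 ^ k - 1 - i)
        then 2 ^ k - 1 - i else s.reg 21 := by
  have hb := hc.bounds
  set r := 2 ^ k - 1 - i with hr
  have hrk : r < 2 ^ k := by omega
  have hw := Nat.one_le_two_pow (n := w)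
  simp only [testCandidate, Program.block, wp_seq, wp_arith, ArithOp.eval]
  simp [hi, hc.reg2, hc.reg3]
  refine ⟨by omega, by omega, ?_⟩
  have hc₀ := (hc.setReg (show 7 ≤ 23 by norm_num) (2 ^ k - 1)).setReg
    (show 7 ≤ 23 by norm_num) (2 ^ k - 1 - i)
  refine (wp_tally (r := r) hc₀ (by simp [hr]) hrk (by simpa using h6)).frame.mono ?_
  rintro s₁ t₁ ⟨⟨ht₁, h61, h24⟩, hf₁⟩
  have hc₁ := hc₀.of_frame hf₁ (by decide)
  have e2 := hf₁.mem 2 (by decide)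
  have e3 := hf₁.mem 3 (by decide)
  have e4 := hf₁.mem 4 (by decide)
  have e15 := hf₁.reg 15 (by decide)
  have e16 := hf₁.reg 16 (by decide)
  have e20 := hf₁.reg 20 (by decide)
  have e21 := hf₁.reg 21 (by decide)
  have e23 := hf₁.reg 23 (by decide)
  simp at e2 e3 e4 e15 e16 e20 e21 e23 h61 h24
  have h6le : ∀ c, s₁.mem 6 c ≤ 2 ^ k := fun c => by
    rw [h61]; exact classElevated_le _ _ _ _ _
  have h24le : s₁.reg 24 ≤ 2 ^ k := by
    rw [h24]; exact weightElevated_le _ _ _ _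
  refine (wp_checkSplits hc₁ (e20.trans hN) hNn (by rw [e4]; exact h4) h6le).frame.mono ?_
  rintro s₂ t₂ ⟨⟨ht₂, h25, h25'⟩, hf₂⟩
  have hc₂ := hc₁.of_frame hf₂ (by decide)
  have e2' := (hf₂.mem 2 (by decide)).trans e2
  have e6' := hf₂.mem 6 (by decide)
  refine (wp_clear (A := 6) hc₂ (by norm_num) fun c => ?_).frame.mono ?_
  · rw [e6', e2', h61]
    by_contra hno
    push Not at hno
    exact hno.1 (classElevated_eq_zero hno.2)
  rintro s₃ t₃ ⟨⟨ht₃, h63⟩, hf₃⟩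
  have hc₃ := hc₂.of_frame hf₃ (by decide)
  have f16 : s₃.reg 16 = s.reg 16 :=
    (hf₃.reg 16 (by decide)).trans ((hf₂.reg 16 (by decide)).trans e16)
  have f21 : s₃.reg 21 = s.reg 21 :=
    (hf₃.reg 21 (by decide)).trans ((hf₂.reg 21 (by decide)).trans e21)
  have f23 : s₃.reg 23 = r :=
    (hf₃.reg 23 (by decide)).trans ((hf₂.reg 23 (by decide)).trans e23)
  have f24 : s₃.reg 24 = s₁.reg 24 :=
    (hf₃.reg 24 (by decide)).trans (hf₂.reg 24 (by decide))
  have f25 : s₃.reg 25 = s₂.reg 25 := hf₃.reg 25 (by decide)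
  have hpass : Passes k N (s.reg 15) (s.mem 2) (s.mem 3) (s.mem 4) r ↔
      s₂.reg 25 = 1 ∧ s.reg 16 ≤ s₁.reg 24 * 8 := by
    rw [h25', h16, h24, Passes, e2, e3, e4]
    simp only [h61]
  simp only [hpass]
  simp [hc₃.reg2, hc₃.reg5, hc₃.reg6, f16, f21, f23, f24, f25, h63]
  refine ⟨by omega, ?_⟩
  split_ifs <;> omega

/-- Find the first candidate that passes the test. -/
def search : Program := .forLoop 22 3 testCandidate

/-- Candidates are tried in decreasing order and each success overwrites register `21`, so the last
one kept is the smallest; no early exit is needed. After `m` rounds the tested numbers are those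
with `2 ^ k ≤ r + m`. -/
theorem wp_search {k n w N : ℕ} {s : MachineState} (hc : Context k n w s)
    (hN : s.reg 20 = N) (hNn : N ≤ n) (h4 : ∀ c, s.mem 4 c ≤ 2 ^ k) (h6 : ∀ c, s.mem 6 c = 0)
    (h16 : s.reg 16 = weightCount k (s.mem 2) (s.reg 15)) :
    WP w search s fun s' t => t ≤ 2 ^ k * (2 ^ k * 96 + 32) + 2 ∧ (∀ c, s'.mem 6 c = 0) ∧
      ((∃ r < 2 ^ k, Passes k N (s.reg 15) (s.mem 2) (s.mem 3) (s.mem 4) r) →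
        s'.reg 21 < 2 ^ k ∧ Passes k N (s.reg 15) (s.mem 2) (s.mem 3) (s.mem 4) (s'.reg 21) ∧
        ∀ r < 2 ^ k, Passes k N (s.reg 15) (s.mem 2) (s.mem 3) (s.mem 4) r → s'.reg 21 ≤ r) := by
  have hb := hc.bounds
  set p := Passes k N (s.reg 15) (s.mem 2) (s.mem 3) (s.mem 4) with hp
  refine (wp_for (T := 2 ^ k * 96 + 30) (fun m s' => (∀ c, s'.mem 6 c = 0) ∧
    ((∃ r < 2 ^ k, 2 ^ k ≤ r + m ∧ p r) → s'.reg 21 < 2 ^ k ∧ p (s'.reg 21) ∧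
      ∀ r < 2 ^ k, 2 ^ k ≤ r + m → p r → s'.reg 21 ≤ r))
    (by decide) hc.reg2 hc.reg3 (by have := Nat.one_le_two_pow (n := k); omega)
    (fun m s v h => by simpa using h) ⟨h6, ?_⟩ ?_).mono fun s' t ⟨h1, ⟨h2, h3⟩, _⟩ => ⟨h1, h2, ?_⟩
  · rintro ⟨r, hr, hr', _⟩
    omega
  · intro m hm s₁ hf him ⟨hI1, hI2⟩
    have hc₁ := hc.of_frame hf (by decide)
    have e2 := hf.mem 2 (by decide)
    have e3 := hf.mem 3 (by decide)
    have e4 := hf.mem 4 (by decide)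
    have e15 := hf.reg 15 (by decide)
    have e16 := hf.reg 16 (by decide)
    have e20 := hf.reg 20 (by decide)
    refine (wp_testCandidate hc₁ (e20.trans hN) hNn him hm (by rw [e4]; exact h4) hI1
      (by rw [e16, e15, e2]; exact h16)).mono ?_
    rintro s₂ t ⟨ht, h6', h21⟩
    rw [e2, e3, e4, e15, ← hp] at h21
    refine ⟨ht, h6', ?_⟩
    by_cases hpr : p (2 ^ k - 1 - m)
    · rw [if_pos hpr] at h21
      rw [h21]
      intro _
      exact ⟨by omega, hpr, fun r _ hrm _ => by omega⟩
    · rw [if_neg hpr] at h21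
      rw [h21]
      have hne : ∀ r < 2 ^ k, 2 ^ k ≤ r + (m + 1) → p r → 2 ^ k ≤ r + m := by
        intro r hr hrm hpr'
        by_contra hlt
        obtain rfl : r = 2 ^ k - 1 - m := by omega
        exact hpr hpr'
      rintro ⟨r, hr, hrm, hpr'⟩
      obtain ⟨i1, i2, i3⟩ := hI2 ⟨r, hr, hne r hr hrm hpr', hpr'⟩
      exact ⟨i1, i2, fun r hr hrm hpr' => i3 r hr (hne r hr hrm hpr') hpr'⟩
  · rintro ⟨r, hr, hpr⟩
    obtain ⟨i1, i2, i3⟩ := h3 ⟨r, hr, by omega, hpr⟩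
    exact ⟨i1, i2, fun r hr hpr => i3 r hr (by omega) hpr⟩

/-- One iteration of the greedy algorithm: the number of the new row is left in register `21`. -/
def greedyStep : Program :=
  .block [countUnmarked, markClasses, findMinWeight, countMinWeight, search, clear 4]

/-- Array `2` holds the weights and array `3` the marks of all words; arrays `4` and `6` are
counters indexed by weight, zero on entry and restored to zero. `N`, the number of rows, is in
register `20`. -/
theorem wp_greedyStep {k n w N : ℕ} {s : MachineState} (hc : Context k n w s)
    (hN : s.reg 20 = N) (hNn : N ≤ n) (h4 : ∀ c, s.mem 4 c = 0) (h6 : ∀ c, s.mem 6 c = 0) :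
    WP w greedyStep s fun s' t => t ≤ 2 ^ k * 2 ^ k * 400 ∧ (∀ c, s'.mem 4 c = 0) ∧
      (∀ c, s'.mem 6 c = 0) ∧
      (∀ x, s'.mem 3 x = if x < 2 ^ k ∧ classCount k (s.mem 2) (s.mem 3) (s.mem 2 x) <
        N * N + N * N then 1 else s.mem 3 x) ∧
      ∃ d, 0 < d ∧ (∀ x < 2 ^ k, 0 < s.mem 2 x → d ≤ s.mem 2 x) ∧
        (d = N + 1 ∨ ∃ x < 2 ^ k, s.mem 2 x = d) ∧
        ((∃ r < 2 ^ k, Passes k N d (s.mem 2) (s'.mem 3) (classCount k (s.mem 2) (s.mem 3)) r) →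
          s'.reg 21 < 2 ^ k ∧
          Passes k N d (s.mem 2) (s'.mem 3) (classCount k (s.mem 2) (s.mem 3)) (s'.reg 21) ∧
          ∀ r < 2 ^ k, Passes k N d (s.mem 2) (s'.mem 3) (classCount k (s.mem 2) (s.mem 3)) r →
            s'.reg 21 ≤ r) := by
  simp only [greedyStep, Program.block, wp_seq]
  refine (wp_countUnmarked hc h4).frame.mono ?_
  rintro s₁ t₁ ⟨⟨ht₁, hcnt⟩, hf₁⟩
  have hc₁ := hc.of_frame hf₁ (by decide)
  have a2 : s₁.mem 2 = s.mem 2 := hf₁.mem 2 (by decide)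
  have a3 : s₁.mem 3 = s.mem 3 := hf₁.mem 3 (by decide)
  have a4 : s₁.mem 4 = classCount k (s.mem 2) (s.mem 3) := funext hcnt
  have a6 : s₁.mem 6 = s.mem 6 := hf₁.mem 6 (by decide)
  have a20 : s₁.reg 20 = N := (hf₁.reg 20 (by decide)).trans hN
  refine (wp_markClasses hc₁ a20 hNn).frame.mono ?_
  rintro s₂ t₂ ⟨⟨ht₂, hmk⟩, hf₂⟩
  rw [a2, a3, a4] at hmk
  have hc₂ := hc₁.of_frame hf₂ (by decide)
  have b2 : s₂.mem 2 = s.mem 2 := (hf₂.mem 2 (by decide)).trans a2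
  have b4 := (hf₂.mem 4 (by decide)).trans a4
  have b6 : s₂.mem 6 = s.mem 6 := (hf₂.mem 6 (by decide)).trans a6
  have b20 : s₂.reg 20 = N := (hf₂.reg 20 (by decide)).trans a20
  refine (wp_findMinWeight hc₂ b20 hNn).frame.mono ?_
  rintro s₃ t₃ ⟨⟨ht₃, hd0, hdle, hdex⟩, hf₃⟩
  rw [b2] at hdle hdex
  have hc₃ := hc₂.of_frame hf₃ (by decide)
  have c2 : s₃.mem 2 = s.mem 2 := (hf₃.mem 2 (by decide)).trans b2
  have c3 : s₃.mem 3 = s₂.mem 3 := hf₃.mem 3 (by decide)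
  have c4 := (hf₃.mem 4 (by decide)).trans b4
  have c6 : s₃.mem 6 = s.mem 6 := (hf₃.mem 6 (by decide)).trans b6
  have c20 : s₃.reg 20 = N := (hf₃.reg 20 (by decide)).trans b20
  refine (wp_countMinWeight hc₃).frame.mono ?_
  rintro s₄ t₄ ⟨⟨ht₄, h16⟩, hf₄⟩
  have hc₄ := hc₃.of_frame hf₄ (by decide)
  have d2 : s₄.mem 2 = s.mem 2 := (hf₄.mem 2 (by decide)).trans c2
  have d3 : s₄.mem 3 = s₂.mem 3 := (hf₄.mem 3 (by decide)).trans c3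
  have d4 := (hf₄.mem 4 (by decide)).trans c4
  have d6 : s₄.mem 6 = s.mem 6 := (hf₄.mem 6 (by decide)).trans c6
  have d15 : s₄.reg 15 = s₃.reg 15 := hf₄.reg 15 (by decide)
  have d20 : s₄.reg 20 = N := (hf₄.reg 20 (by decide)).trans c20
  refine (wp_search hc₄ d20 hNn (by rw [d4]; exact classCount_le _ _ _) (by rw [d6]; exact h6)
    (by rw [h16, d15, d2, c2])).frame.mono ?_
  rintro s₅ t₅ ⟨⟨ht₅, h6', hsearch⟩, hf₅⟩
  rw [d2, d3, d4, d15] at hsearch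
  have hc₅ := hc₄.of_frame hf₅ (by decide)
  have e2 : s₅.mem 2 = s.mem 2 := (hf₅.mem 2 (by decide)).trans d2
  have e3 : s₅.mem 3 = s₂.mem 3 := (hf₅.mem 3 (by decide)).trans d3
  have e4 := (hf₅.mem 4 (by decide)).trans d4
  refine (wp_clear (A := 4) hc₅ (by norm_num) fun c => ?_).frame.mono ?_
  · rw [e4, e2]
    by_contra hno
    push Not at hno
    exact hno.1 (classCount_eq_zero hno.2)
  rintro s₆ t₆ ⟨⟨ht₆, h4'⟩, hf₆⟩
  have f3 : s₆.mem 3 = s₂.mem 3 := (hf₆.mem 3 (by decide)).trans e3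
  have f6 : s₆.mem 6 = s₅.mem 6 := hf₆.mem 6 (by decide)
  have f21 : s₆.reg 21 = s₅.reg 21 := hf₆.reg 21 (by decide)
  refine ⟨?_, h4', by rw [f6]; exact h6', by rw [f3]; exact hmk, s₃.reg 15, hd0, hdle, hdex, ?_⟩
  · have h1 : 1 ≤ 2 ^ k := Nat.one_le_two_pow
    generalize 2 ^ k = K at *
    have h2 : K * 1 ≤ K * K := Nat.mul_le_mul_left K h1
    have h3 : K * (K * 96 + 32) = K * K * 96 + K * 32 := by ring
    omega
  · rw [f3, f21]
    exact hsearch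

/-! ### The tables of the program represent the state of the greedy algorithm -/

/-- The tables `wt` and `mk` contain the weights and marks of all words when `N` rows are present. -/
structure Represents (k : ℕ) (R : ℕ → Word k) (N : ℕ) (wt mk : ℕ → ℕ) : Prop where
  weight : ∀ x < 2 ^ k, wt x = hammingNorm (fun j : Fin N => R j ⬝ᵥ toWord k x)
  mark : ∀ x < 2 ^ k, mk x = 0 ↔ x ≠ 0 ∧ toWord k x ∉ marked R (N - k)

section Represents

variable {k t : ℕ} {R : ℕ → Word k} {wt mk : ℕ → ℕ}

theorem Represents.mem_weightClass (h : Represents k R (k + t) wt mk) {x i : ℕ} (hx : x < 2 ^ k) :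
    toWord k x ∈ weightClass R (k + t) i ↔ wt x = i := by
  rw [Rateless.mem_weightClass, h.weight x hx]

theorem Represents.weight_eq_zero (h : Represents k R (k + t) wt mk) (hR : IsGreedyMatrix R)
    {x : ℕ} (hx : x < 2 ^ k) : wt x = 0 ↔ x = 0 := by
  rw [h.weight x hx, ← toWord_eq_zero_iff hx]
  constructor
  · intro h0
    by_contra hne
    have := hammingNorm_prefix_pos hR hne (show k ≤ k + t by omega)
    omega
  · intro h0
    simp [h0, hammingNorm]

theorem Represents.weight_le (h : Represents k R (k + t) wt mk) {x : ℕ} (hx : x < 2 ^ k) :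
    wt x ≤ k + t := by
  rw [h.weight x hx]
  exact hammingNorm_le_card_fintype.trans (by simp)

theorem card_eq_sum_toWord (S : Finset (Word k)) :
    S.card = ∑ x ∈ Finset.range (2 ^ k), if toWord k x ∈ S then 1 else 0 := by
  rw [← card_filter_word fun x => x ∈ S]
  simp

theorem Represents.card_unmarked (h : Represents k R (k + t) wt mk) (hR : IsGreedyMatrix R) {c : ℕ}
    (hc : 0 < c) : (weightClass R (k + t) c \ marked R t).card = classCount k wt mk c := by
  rw [card_eq_sum_toWord, classCount]
  refine Finset.sum_congr rfl fun x hx => if_congr ?_ rfl rfl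
  have hx := Finset.mem_range.mp hx
  rw [Finset.mem_sdiff, h.mem_weightClass hx, h.mark x hx, Nat.add_sub_cancel_left]
  refine and_congr_right fun hw => ?_
  have : x ≠ 0 := fun h0 => by
    have := (h.weight_eq_zero hR hx).mpr h0
    omega
  tauto

theorem Represents.card_elevated (h : Represents k R (k + t) wt mk) (hR : IsGreedyMatrix R) {c : ℕ}
    (hc : 0 < c) {mk' : ℕ → ℕ}
    (hmk' : ∀ x < 2 ^ k, mk' x = 0 ↔ x ≠ 0 ∧ toWord k x ∉ marked R (t + 1)) (r : ℕ) :
    (elevated (toWord k r) (weightClass R (k + t) c \ marked R (t + 1))).card =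
      classElevated k wt mk' r c := by
  rw [card_eq_sum_toWord, classElevated]
  refine Finset.sum_congr rfl fun x hx => ?_
  have hx := Finset.mem_range.mp hx
  have hiff : toWord k x ∈ elevated (toWord k r) (weightClass R (k + t) c \ marked R (t + 1)) ↔
      (wt x = c ∧ mk' x = 0) ∧ bitDot k r x % 2 = 1 := by
    rw [mem_elevated, Finset.mem_sdiff, h.mem_weightClass hx, hmk' x hx, toWord_dotProduct_eq_one]
    refine and_congr_left fun _ => and_congr_right fun hw => ?_
    have : x ≠ 0 := fun h0 => by
      have := (h.weight_eq_zero hR hx).mpr h0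
      omega
    tauto
  by_cases h1 : wt x = c ∧ mk' x = 0
  · rw [if_pos h1]
    by_cases h2 : bitDot k r x % 2 = 1
    · rw [if_pos (hiff.mpr ⟨h1, h2⟩), h2]
    · rw [if_neg fun hh => h2 (hiff.mp hh).2]
      omega
  · rw [if_neg h1, if_neg fun hh => h1 (hiff.mp hh).1]

theorem Represents.card_weightClass (h : Represents k R (k + t) wt mk) (d : ℕ) :
    (weightClass R (k + t) d).card = weightCount k wt d := by
  rw [card_eq_sum_toWord, weightCount]
  refine Finset.sum_congr rfl fun x hx => if_congr ?_ rfl rfl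
  exact h.mem_weightClass (Finset.mem_range.mp hx)

theorem Represents.card_elevated_weightClass (h : Represents k R (k + t) wt mk) (r d : ℕ) :
    (elevated (toWord k r) (weightClass R (k + t) d)).card = weightElevated k wt r d := by
  rw [card_eq_sum_toWord, weightElevated]
  refine Finset.sum_congr rfl fun x hx => ?_
  have hx := Finset.mem_range.mp hx
  have hiff : toWord k x ∈ elevated (toWord k r) (weightClass R (k + t) d) ↔
      wt x = d ∧ bitDot k r x % 2 = 1 := by
    rw [mem_elevated, h.mem_weightClass hx, toWord_dotProduct_eq_one]
  by_cases h1 : wt x = d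
  · rw [if_pos h1]
    by_cases h2 : bitDot k r x % 2 = 1
    · rw [if_pos (hiff.mpr ⟨h1, h2⟩), h2]
    · rw [if_neg fun hh => h2 (hiff.mp hh).2]
      omega
  · rw [if_neg h1, if_neg fun hh => h1 (hiff.mp hh).1]

/-- The table treats the zero word as marked although `marked` never contains it. So the words with
mark `0` are exactly the unmarked ones of positive weight, the range over which the algorithm
quantifies. -/
theorem Represents.mark_succ (h : Represents k R (k + t) wt mk) (hR : IsGreedyMatrix R)
    {mk' : ℕ → ℕ} (hmk' : ∀ x, mk' x = if x < 2 ^ k ∧ classCount k wt mk (wt x) <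
      (k + t) * (k + t) + (k + t) * (k + t) then 1 else mk x) :
    ∀ x < 2 ^ k, mk' x = 0 ↔ x ≠ 0 ∧ toWord k x ∉ marked R (t + 1) := by
  intro x hx
  have hmark := h.mark x hx
  rw [Nat.add_sub_cancel_left] at hmark
  have hsq : 2 * (k + t) ^ 2 = (k + t) * (k + t) + (k + t) * (k + t) := by ring
  rw [hmk', mem_marked_succ ((h.mem_weightClass hx).mpr rfl), hsq, Finset.mem_Icc]
  by_cases h0 : x = 0
  · have : mk x ≠ 0 := fun hh => (hmark.mp hh).1 h0
    split_ifs <;> tauto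
  · have hpos : 0 < wt x := Nat.pos_of_ne_zero fun hh => h0 ((h.weight_eq_zero hR hx).mp hh)
    rw [h.card_unmarked hR hpos]
    have := h.weight_le hx
    split_ifs with hlt
    · have := hlt.2
      tauto
    · have : ¬ classCount k wt mk (wt x) < (k + t) * (k + t) + (k + t) * (k + t) :=
        fun hh => hlt ⟨hx, hh⟩
      tauto

/-- The program counts before it marks. A class that still has unmarked words after marking has lost
none, so the counts remain valid for the splitting test. -/
theorem unmarked_succ_eq (R : ℕ → Word k) (t i : ℕ) :
    weightClass R (k + t) i ⊆ marked R (t + 1) ∨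
      weightClass R (k + t) i \ marked R (t + 1) = weightClass R (k + t) i \ marked R t := by
  by_cases h : i ∈ Finset.Icc 1 (k + t) ∧
      (weightClass R (k + t) i \ marked R t).card < 2 * (k + t) ^ 2
  · exact Or.inl fun x hx => (mem_marked_succ hx).mpr (Or.inr h)
  · refine Or.inr (Finset.ext fun x => ?_)
    rw [Finset.mem_sdiff, Finset.mem_sdiff]
    refine and_congr_right fun hx => ?_
    rw [mem_marked_succ hx]
    tauto

theorem balanced_iff_splits {N : ℕ} (hN : 0 < N) {r : Word k} {S : Finset (Word k)} :
    Balanced N S.card (elevated r S).card ↔ Splits (1 / (2 * √(N : ℝ))) r S := by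
  rw [splits_iff_sq_le hN, Balanced]
  generalize S.card = c
  generalize (elevated r S).card = e
  have hz : ((c - (e + e) + (e + e - c) : ℕ) : ℝ) ^ 2 = ((c : ℝ) - 2 * e) ^ 2 := by
    rcases le_total (e + e) c with hle | hle
    · rw [Nat.sub_eq_zero_of_le hle, add_zero, Nat.cast_sub hle]
      push_cast; ring
    · rw [Nat.sub_eq_zero_of_le hle, zero_add, Nat.cast_sub hle]
      push_cast; ring
  rw [← hz, ← @Nat.cast_le ℝ]
  generalize c - (e + e) + (e + e - c) = d
  push_cast
  rw [sq, sq, mul_comm (N : ℝ)]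

/-- Quantifying over unmarked words instead of weights omits only classes without unmarked words,
and the empty set is split by every vector. -/
theorem Represents.passes_iff (h : Represents k R (k + t) wt mk) (hR : IsGreedyMatrix R)
    (hk : 0 < k) {mk' : ℕ → ℕ} {d r : ℕ}
    (hmk' : ∀ x, mk' x = if x < 2 ^ k ∧ classCount k wt mk (wt x) <
      (k + t) * (k + t) + (k + t) * (k + t) then 1 else mk x)
    (hd0 : 0 < d) (hdle : ∀ x < 2 ^ k, 0 < wt x → d ≤ wt x)
    (hdex : d = k + t + 1 ∨ ∃ x < 2 ^ k, wt x = d) :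
    Passes k (k + t) d wt mk' (classCount k wt mk) r ↔ Suitable R t (toWord k r) := by
  have hmark := h.mark_succ hR hmk'
  -- The sentinel `k + t + 1` cannot occur: as `k > 0`, word number `1` is nonzero, and its weight
  -- is between `1` and `k + t`.
  have hex : ∃ x < 2 ^ k, wt x = d := by
    rcases hdex with hd | hd
    · have h1 : 1 < 2 ^ k := Nat.one_lt_two_pow (by omega)
      have h2 : wt 1 ≠ 0 := fun hh => by
        have := (h.weight_eq_zero hR h1).mp hh
        omega
      have h3 := hdle 1 h1 (Nat.pos_of_ne_zero h2)
      have h4 := h.weight_le h1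
      omega
    · exact hd
  have hleast : IsLeast {d : ℕ | 0 < d ∧ (weightClass R (k + t) d).Nonempty} d := by
    constructor
    · obtain ⟨x, hx, hxd⟩ := hex
      exact ⟨hd0, _, (h.mem_weightClass hx).mpr hxd⟩
    · rintro d' ⟨hd', y, hy⟩
      obtain ⟨x, hx, rfl⟩ := exists_toWord y
      rw [h.mem_weightClass hx] at hy
      rw [← hy] at hd' ⊢
      exact hdle x hx hd'
  refine and_congr ?_ ?_
  · constructor
    · intro hp i hi
      have hi0 : 0 < i := (Finset.mem_Icc.mp hi).1
      rcases (weightClass R (k + t) i \ marked R (t + 1)).eq_empty_or_nonempty with he | ⟨y, hy⟩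
      · rw [he]; exact splits_empty _ _
      · obtain ⟨x, hx, rfl⟩ := exists_toWord y
        rw [Finset.mem_sdiff] at hy
        have hw := (h.mem_weightClass hx).mp hy.1
        have hx0 : x ≠ 0 := fun h0 => by
          have := (h.weight_eq_zero hR hx).mpr h0
          omega
        have := hp x hx ((hmark x hx).mpr ⟨hx0, hy.2⟩)
        rw [hw, ← h.card_elevated hR hi0 hmark, ← h.card_unmarked hR hi0] at this
        rw [← balanced_iff_splits (by omega)]
        have hsame : weightClass R (k + t) i \ marked R (t + 1) =
            weightClass R (k + t) i \ marked R t := by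
          rcases unmarked_succ_eq R t i with he | he
          · exact absurd hy.2 (not_not.mpr (he hy.1))
          · exact he
        rwa [← hsame] at this
    · intro hs x hx hmx
      obtain ⟨hx0, hxm⟩ := (hmark x hx).mp hmx
      have hpos : 0 < wt x := Nat.pos_of_ne_zero fun hh => hx0 ((h.weight_eq_zero hR hx).mp hh)
      have := hs (wt x) (Finset.mem_Icc.mpr ⟨hpos, h.weight_le hx⟩)
      rw [← balanced_iff_splits (by omega)] at this
      rw [← h.card_elevated hR hpos hmark, ← h.card_unmarked hR hpos]
      rcases unmarked_succ_eq R t (wt x) with he | he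
      · exact absurd (he ((h.mem_weightClass hx).mpr rfl)) hxm
      · rwa [← he]
  · rw [← h.card_weightClass, ← h.card_elevated_weightClass]
    have : Elevates (1 / 8) (toWord k r) (weightClass R (k + t) d) ↔
        (weightClass R (k + t) d).card ≤
          (elevated (toWord k r) (weightClass R (k + t) d)).card * 8 := by
      rw [Elevates, ← @Nat.cast_le ℝ]
      push_cast
      constructor <;> intro <;> linarith
    rw [← this]
    exact ⟨fun he d' hd' => by rw [hd'.unique hleast]; exact he, fun he => he d hleast⟩

end Represents

/-! ### The table of inner products -/

theorem bitDot_succ (m a b : ℕ) :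
    bitDot (m + 1) a b = bitDot m a b + (a / 2 ^ m % 2) * (b / 2 ^ m % 2) := by
  rw [bitDot, Finset.sum_range_succ, ← bitDot]

theorem bitDot_le (m a b : ℕ) : bitDot m a b ≤ m := by
  induction m with
  | zero => simp [bitDot]
  | succ m ih =>
    rw [bitDot_succ]
    have : (a / 2 ^ m % 2) * (b / 2 ^ m % 2) ≤ 1 * 1 :=
      Nat.mul_le_mul (by omega) (by omega)
    omega

/-- Compute the inner product of the words with numbers in registers `12` and `13`. -/
def dotProgram : Program :=
  .block [.const 15 0, .forLoop 14 0 <| .block [.arith .div 16 12 4, .arith .add 17 16 16,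
    .arith .sub 17 12 17, .arith .div 18 13 4, .arith .add 19 18 18, .arith .sub 19 13 19,
    .arith .mul 17 17 19, .arith .add 15 15 17, .arith .add 12 16 6, .arith .add 13 18 6]]

theorem wp_dotProgram {k w a b : ℕ} {s : MachineState} (h0 : s.reg 0 = k) (h2 : s.reg 2 = 1)
    (h4 : s.reg 4 = 2) (h6 : s.reg 6 = 0) (hw : 64 * 2 ^ k ≤ 2 ^ w) (ha : s.reg 12 = a)
    (hb : s.reg 13 = b) (hak : a < 2 ^ k) (hbk : b < 2 ^ k) :
    WP w dotProgram s fun s' t => t ≤ k * 32 + 4 ∧ s'.reg 15 = bitDot k a b := by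
  have hk : k < 2 ^ k := Nat.lt_two_pow_self
  simp only [dotProgram, Program.block, wp_seq, wp_const]
  refine ⟨by omega, ?_⟩
  refine (wp_for (N := k) (T := 30) (fun m s' => s'.reg 12 = a / 2 ^ m ∧ s'.reg 13 = b / 2 ^ m ∧
    s'.reg 15 = bitDot m a b)
    (by decide) (by simpa using h2) (by simpa using h0) (by omega)
    (fun m s v h => by simpa using h) (by simp [ha, hb, bitDot]) ?_).mono
    fun s' t h => ⟨by omega, h.2.1.2.2⟩
  intro m hm s₁ hf him ⟨i12, i13, i15⟩
  have e4 := hf.reg 4 (by decide)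
  have e6 := hf.reg 6 (by decide)
  simp [h4, h6] at e4 e6
  have hle := bitDot_le m a b
  have ha' : a / 2 ^ m ≤ a := Nat.div_le_self _ _
  have hb' : b / 2 ^ m ≤ b := Nat.div_le_self _ _
  simp [i12, i13, i15, e4, e6, bitDot_succ, pow_succ, ← Nat.div_div_eq_div_mul]
  generalize a / 2 ^ m = a' at *
  generalize b / 2 ^ m = b' at *
  -- The machine has no remainder operation; the lowest bit is obtained by subtracting twice the
  -- half.
  have h1 : a' - (a' / 2 + a' / 2) = a' % 2 := by omega
  have h2 : b' - (b' / 2 + b' / 2) = b' % 2 := by omega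
  rw [h1, h2]
  have : (a' % 2) * (b' % 2) ≤ 1 * 1 := Nat.mul_le_mul (by omega) (by omega)
  omega

/-- Fill the table of inner products. -/
def dotTable : Program :=
  .forLoop 10 9 <| .block [.arith .div 12 10 3, .arith .mul 13 12 3, .arith .sub 13 10 13,
    dotProgram, .arith .div 16 15 4, .arith .add 16 16 16, .arith .sub 15 15 16, .store 7 10 15]

theorem wp_dotTable {k w : ℕ} {s : MachineState} (h0 : s.reg 0 = k) (h2 : s.reg 2 = 1)
    (h3 : s.reg 3 = 2 ^ k) (h4 : s.reg 4 = 2) (h6 : s.reg 6 = 0) (h9 : s.reg 9 = 2 ^ k * 2 ^ k)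
    (hw : 64 * (2 ^ k * 2 ^ k) ≤ 2 ^ w) :
    WP w dotTable s fun s' t => t ≤ 2 ^ k * 2 ^ k * (k * 32 + 32) + 2 ∧
      ∀ a < 2 ^ k, ∀ b < 2 ^ k, s'.mem 7 (a * 2 ^ k + b) = bitDot k a b % 2 := by
  have hK : 1 ≤ 2 ^ k := Nat.one_le_two_pow
  have hKK : 2 ^ k * 1 ≤ 2 ^ k * 2 ^ k := Nat.mul_le_mul_left _ hK
  have hk : k < 2 ^ k := Nat.lt_two_pow_self
  refine (wp_for (N := 2 ^ k * 2 ^ k) (T := k * 32 + 30)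
    (fun m s' => ∀ z < m, s'.mem 7 z = bitDot k (z / 2 ^ k) (z % 2 ^ k) % 2)
    (by decide) h2 h9 (by omega) (fun m s v h => h) (by simp) ?_).mono
    fun s' t h => ⟨h.1, ?_⟩
  · intro m hm s₁ hf him hI
    have e0 := (hf.reg 0 (by decide)).trans h0
    have e2 := (hf.reg 2 (by decide)).trans h2
    have e3 := (hf.reg 3 (by decide)).trans h3
    have e4 := (hf.reg 4 (by decide)).trans h4
    have e6 := (hf.reg 6 (by decide)).trans h6
    simp only [Program.block, wp_seq, wp_arith, ArithOp.eval]
    simp [him, e3]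
    have hdm := Nat.div_add_mod m (2 ^ k)
    have hdiv : m / 2 ^ k ≤ m := Nat.div_le_self _ _
    have hmul : m / 2 ^ k * 2 ^ k ≤ m := Nat.div_mul_le_self _ _
    have hmod : m - m / 2 ^ k * 2 ^ k = m % 2 ^ k := by
      rw [mul_comm] at hdm; omega
    refine ⟨by omega, by omega, by omega, ?_⟩
    refine (wp_dotProgram (k := k) (a := m / 2 ^ k) (b := m % 2 ^ k) (by simpa using e0)
      (by simpa using e2) (by simpa using e4) (by simpa using e6) (by omega) (by simp)
      (by simpa using hmod) (Nat.div_lt_of_lt_mul hm) (Nat.mod_lt _ hK)).frame.mono ?_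
    rintro s₂ t ⟨⟨ht, h15⟩, hf₂⟩
    have f4 := hf₂.reg 4 (by decide)
    have f10 := hf₂.reg 10 (by decide)
    have f7 := hf₂.mem 7 (by decide)
    simp [e4, him] at f4 f10 f7
    have hle := bitDot_le k (m / 2 ^ k) (m % 2 ^ k)
    simp [h15, f4, f10, f7, -Order.lt_add_one_iff]
    generalize hv : bitDot k (m / 2 ^ k) (m % 2 ^ k) = v at *
    refine ⟨by omega, by omega, by omega, by omega, fun z hz => ?_⟩
    rw [Function.update_apply]
    split_ifs with hzm
    · rw [hzm, hv]; omega
    · exact hI z (by omega)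
  · intro a ha b hb
    have hlt : a * 2 ^ k + b < 2 ^ k * 2 ^ k := by
      have : (a + 1) * 2 ^ k ≤ 2 ^ k * 2 ^ k := Nat.mul_le_mul_right _ ha
      rw [add_mul] at this
      omega
    rw [h.2.1 _ hlt, add_comm, Nat.add_mul_div_right _ _ hK, Nat.div_eq_of_lt hb, zero_add,
      Nat.add_mul_mod_self_right, Nat.mod_eq_of_lt hb]

/-- Compute the constants and the table of inner products. -/
def setup : Program :=
  .block [.const 2 1, .const 4 2, .const 5 8, .const 6 0, .const 3 1,
    .forLoop 10 0 (.arith .add 3 3 3), .arith .mul 9 3 3, dotTable]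

theorem wp_setup {k n w : ℕ} {s : MachineState} (h0 : s.reg 0 = k) (h1 : s.reg 1 = n)
    (hw : 64 * ((2 ^ k * 2 ^ k) * ((n + 1) * (n + 1))) ≤ 2 ^ w) :
    WP w setup s fun s' t => t ≤ 2 ^ k * 2 ^ k * (k * 32 + 32) + k * 32 + 16 ∧
      Context k n w s' := by
  have hK : 1 ≤ 2 ^ k := Nat.one_le_two_pow
  have hKK : 2 ^ k * 1 ≤ 2 ^ k * 2 ^ k := Nat.mul_le_mul_left _ hK
  have hKn : (2 ^ k * 2 ^ k) * 1 ≤ (2 ^ k * 2 ^ k) * ((n + 1) * (n + 1)) :=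
    Nat.mul_le_mul_left _ (Nat.mul_pos (by omega) (by omega))
  have hk : k < 2 ^ k := Nat.lt_two_pow_self
  simp only [setup, Program.block, wp_seq, wp_const]
  refine ⟨by omega, by omega, by omega, by omega, by omega, ?_⟩
  refine (wp_for (N := k) (T := 1) (fun m s' => s'.reg 3 = 2 ^ m)
    (by decide) (by simp) (by simpa using h0) (by omega) (fun m s v h => by simpa using h)
    (by simp) ?_).mono ?_
  · intro m hm s₁ hf him hI
    have : 2 ^ m < 2 ^ k := Nat.pow_lt_pow_right (by norm_num) hm
    simp [hI, pow_succ]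
    omega
  rintro s₁ t₁ ⟨ht₁, h3, hf⟩
  have e0 := hf.reg 0 (by decide)
  have e1 := hf.reg 1 (by decide)
  have e2 := hf.reg 2 (by decide)
  have e4 := hf.reg 4 (by decide)
  have e5 := hf.reg 5 (by decide)
  have e6 := hf.reg 6 (by decide)
  simp [h0, h1] at e0 e1 e2 e4 e5 e6
  simp only [wp_arith, ArithOp.eval]
  simp [h3]
  refine ⟨by omega, ?_⟩
  refine (wp_dotTable (k := k) (by simpa using e0) (by simpa using e2) (by simpa using h3)
    (by simpa using e4) (by simpa using e6) (by simp) (by omega)).frame.mono ?_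
  rintro s₂ t₂ ⟨⟨ht₂, htab⟩, hf₂⟩
  refine ⟨by omega, ?_, ?_, ?_, ?_, ?_, ?_, ?_, htab, hw⟩
  · rw [hf₂.reg 0 (by decide)]; simpa using e0
  · rw [hf₂.reg 1 (by decide)]; simpa using e1
  · rw [hf₂.reg 2 (by decide)]; simpa using e2
  · rw [hf₂.reg 3 (by decide)]; simpa using h3
  · rw [hf₂.reg 4 (by decide)]; simpa using e4
  · rw [hf₂.reg 5 (by decide)]; simpa using e5
  · rw [hf₂.reg 6 (by decide)]; simpa using e6

/-! ### The greedy matrix as a program -/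

/-- Append the row in register `21` and update the weights. -/
def addRow : Program :=
  .block [.store 5 20 21, .arith .mul 30 21 3, .forLoop 10 3 <| .block [.arith .add 13 30 10,
    .load 13 7 13, .load 11 2 10, .arith .add 11 11 13, .store 2 10 11]]

theorem wp_addRow {k n w j r : ℕ} {s : MachineState} (hc : Context k n w s) (hj : s.reg 20 = j)
    (hr : s.reg 21 = r) (hrk : r < 2 ^ k) (hwt : ∀ x < 2 ^ k, s.mem 2 x ≤ n) :
    WP w addRow s fun s' t => t ≤ 2 ^ k * 32 + 4 ∧ s'.mem 5 = Function.update (s.mem 5) j r ∧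
      ∀ x < 2 ^ k, s'.mem 2 x = s.mem 2 x + bitDot k r x % 2 := by
  have hb := hc.bounds
  have hw1 := Nat.one_le_two_pow (n := w)
  have hrK : r * 2 ^ k ≤ 2 ^ k * 2 ^ k := Nat.mul_le_mul_right _ hrk.le
  simp only [addRow, Program.block, wp_seq, wp_store, wp_arith, ArithOp.eval]
  simp [hj, hr, hc.reg3]
  refine ⟨by omega, ?_⟩
  have hc' : Context k n w ((s.setMem 5 j r).setReg 30 (r * 2 ^ k)) := by
    refine Context.setReg ?_ (by norm_num) _
    exact ⟨hc.reg0, hc.reg1, hc.reg2, hc.reg3, hc.reg4, hc.reg5, hc.reg6, by simpa using hc.table,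
      hc.fits⟩
  refine (wp_for (T := 30) (fun m s' => ∀ x, s'.mem 2 x =
      if x < m then s.mem 2 x + bitDot k r x % 2 else s.mem 2 x)
    (by decide) hc'.reg2 hc'.reg3 (by have := Nat.one_le_two_pow (n := k); omega)
    (fun m s v h => h) (by simp) ?_).mono
    fun s' t h => ⟨by omega, ?_, fun x hx => by rw [h.2.1, if_pos hx]⟩
  · intro m hm s₁ hf him hI
    have hc₁ := hc'.of_frame hf (by decide)
    have e30 := hf.reg 30 (by decide)
    simp at e30
    have hdot := hc₁.table r hrk m hm
    have h2m : s₁.mem 2 m = s.mem 2 m := by rw [hI, if_neg (lt_irrefl _)]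
    have := hwt m hm
    simp [him, e30, hdot, h2m, -Order.lt_add_one_iff]
    refine ⟨by omega, by omega, fun x => ?_⟩
    rw [Function.update_apply]
    split_ifs with h1 h2 h2
    · rw [h1]
    · omega
    · rw [hI, if_pos (by omega)]
    · rw [hI, if_neg (by omega)]
  · rw [h.2.2.mem 5 (by decide)]
    simp

/-- Compute the first `n` rows of the greedy matrix. -/
def greedyProgram : Program :=
  .block [.arith .add 26 3 6, .store 3 6 2, .forLoop 20 1 <| .block [
    .branch 20 0 (.block [.arith .div 26 26 4, .arith .add 21 26 6]) greedyStep, addRow]]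

theorem Represents.succ {k N r : ℕ} {R : ℕ → Word k} {wt mk wt' mk' : ℕ → ℕ}
    (h : Represents k R N wt mk) (hr : toWord k r = R N)
    (hwt : ∀ x < 2 ^ k, wt' x = wt x + bitDot k r x % 2)
    (hmk : ∀ x < 2 ^ k, mk' x = 0 ↔ x ≠ 0 ∧ toWord k x ∉ marked R (N + 1 - k)) :
    Represents k R (N + 1) wt' mk' := by
  refine ⟨fun x hx => ?_, hmk⟩
  rw [hammingNorm_prefix_succ fun j => R j ⬝ᵥ toWord k x, hwt x hx, h.weight x hx, ← hr]
  congr 1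
  by_cases h1 : bitDot k r x % 2 = 1
  · rw [if_pos (toWord_dotProduct_eq_one.mpr h1), h1]
  · rw [if_neg fun hh => h1 (toWord_dotProduct_eq_one.mp hh)]
    omega

theorem wp_greedyProgram {k n w : ℕ} (hk : 0 < k) {s : MachineState} (hc : Context k n w s)
    (h2 : ∀ c, s.mem 2 c = 0) (h3 : ∀ c, s.mem 3 c = 0) (h4 : ∀ c, s.mem 4 c = 0)
    (h6 : ∀ c, s.mem 6 c = 0) :
    WP w greedyProgram s fun s' t => t ≤ n * (2 ^ k * 2 ^ k * 400 + 2 ^ k * 32 + 32) + 8 ∧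
      ∀ i < n, s'.mem 5 i < 2 ^ k ∧ toWord k (s'.mem 5 i) = greedyMatrix k i := by
  have hb := hc.bounds
  have hw1 := Nat.one_le_two_pow (n := w)
  have hR := isGreedyMatrix_greedyMatrix k
  simp only [greedyProgram, Program.block, wp_seq, wp_store, wp_arith, ArithOp.eval]
  simp [hc.reg3, hc.reg6, hc.reg2]
  refine ⟨by omega, ?_⟩
  -- Cell `0` of array `3` has just been set to `1`: the zero word is excluded from all unmarked
  -- counts from the start.
  have hc' : Context k n w ((s.setReg 26 (2 ^ k)).setMem 3 0 1) := by
    have hc0 := hc.setReg (show 7 ≤ 26 by norm_num) (2 ^ k)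
    exact ⟨hc0.reg0, hc0.reg1, hc0.reg2, hc0.reg3, hc0.reg4, hc0.reg5, hc0.reg6,
      by simpa using hc.table, hc.fits⟩
  refine (wp_for (N := n) (T := 2 ^ k * 2 ^ k * 400 + 2 ^ k * 32 + 30)
    (fun j s' => (∀ c, s'.mem 4 c = 0) ∧ (∀ c, s'.mem 6 c = 0) ∧
      Represents k (greedyMatrix k) j (s'.mem 2) (s'.mem 3) ∧
      (∀ i < j, s'.mem 5 i < 2 ^ k ∧ toWord k (s'.mem 5 i) = greedyMatrix k i) ∧
      (j ≤ k → s'.reg 26 = 2 ^ (k - j)))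
    (by decide) hc'.reg2 hc'.reg1 (by omega)
    (fun m s v h => by simpa using h) ?_ ?_).mono
    fun s' t h => ⟨by
      have h1 : t ≤ n * (2 ^ k * 2 ^ k * 400 + 2 ^ k * 32 + 32) + 2 := h.1
      omega, h.2.1.2.2.2.1⟩
  · simp only [MachineState.setMem_mem, MachineState.setReg_mem]
    simp [h4, h6]
    refine ⟨fun x hx => ?_, fun x hx => ?_⟩
    · simp [h2, hammingNorm]
    · simp [Function.update_apply, h3, marked]
  · intro j hj s₁ hf hij ⟨i4, i6, hrep, hrows, h26⟩
    have hc₁ := hc'.of_frame hf (by decide)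
    have hstep : WP w (.branch 20 0 (.block [.arith .div 26 26 4, .arith .add 21 26 6]) greedyStep)
        s₁ fun s₂ t => t ≤ 2 ^ k * 2 ^ k * 400 + 4 ∧ (∀ c, s₂.mem 4 c = 0) ∧
          (∀ c, s₂.mem 6 c = 0) ∧ s₂.reg 21 < 2 ^ k ∧ toWord k (s₂.reg 21) = greedyMatrix k j ∧
          (∀ x < 2 ^ k, s₂.mem 3 x = 0 ↔
            x ≠ 0 ∧ toWord k x ∉ marked (greedyMatrix k) (j + 1 - k)) ∧
          (j + 1 ≤ k → s₂.reg 26 = 2 ^ (k - (j + 1))) := by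
      rw [wp_branch, hij, hc₁.reg0]
      split_ifs with hjk
      -- Row `j < k` is the unit vector with number `2 ^ (k - 1 - j)`, obtained by halving register
      -- `26`, which starts at `2 ^ k`.
      · have e26 := h26 hjk.le
        have hpow : 2 ^ (k - j) / 2 = 2 ^ (k - 1 - j) := by
          rw [show k - j = (k - 1 - j) + 1 by omega, pow_succ]
          simp
        have hlt : 2 ^ (k - 1 - j) < 2 ^ k := Nat.pow_lt_pow_right (by norm_num) (by omega)
        have hm := hrep.mark
        rw [show j - k = j + 1 - k by omega] at hm
        simp [e26, hc₁.reg4, hc₁.reg6, hpow]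
        refine ⟨by omega, i4, i6, hlt, ?_, hm, fun _ => by omega⟩
        rw [toWord_two_pow hjk, greedyMatrix_lt hjk]
      · obtain ⟨t, rfl⟩ : ∃ t, j = k + t := ⟨j - k, by omega⟩
        refine (wp_greedyStep hc₁ hij hj.le i4 i6).frame.mono ?_
        rintro s₂ t₂ ⟨⟨ht, g4, g6, gmk, d, hd0, hdle, hdex, hfind⟩, hf₂⟩
        have hpass : ∀ r, Passes k (k + t) d (s₁.mem 2) (s₂.mem 3)
            (classCount k (s₁.mem 2) (s₁.mem 3)) r ↔ Suitable (greedyMatrix k) t (toWord k r) :=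
          fun r => hrep.passes_iff hR hk gmk hd0 hdle hdex
        simp only [hpass] at hfind
        -- The specification of the search is conditional on a passing candidate; `exists_suitable`,
        -- through `nextIndex`, provides one.
        have hspec := nextIndex_spec (greedyMatrix k) t
        obtain ⟨j1, j2, j3⟩ := hfind ⟨_, hspec⟩
        have heq : s₂.reg 21 = nextIndex (greedyMatrix k) t :=
          le_antisymm (j3 _ hspec.1 hspec.2) (nextIndex_le j1 j2)
        refine ⟨by omega, g4, g6, j1, by rw [heq, greedyMatrix_add], ?_, fun hh => by omega⟩
        rw [show k + t + 1 - k = t + 1 by omega]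
        exact hrep.mark_succ hR gmk
    simp only [Program.block] at hstep ⊢
    refine wp_seq.mpr (hstep.frame.mono ?_)
    rintro s₂ t₂ ⟨⟨ht₂, g4, g6, g21, hrow, gmk, g26⟩, hf₂⟩
    have hc₂ := hc₁.of_frame hf₂ (by decide)
    have e2 : s₂.mem 2 = s₁.mem 2 := hf₂.mem 2 (by decide)
    have e5 : s₂.mem 5 = s₁.mem 5 := hf₂.mem 5 (by decide)
    have e20 : s₂.reg 20 = j := (hf₂.reg 20 (by decide)).trans hij
    refine (wp_addRow hc₂ e20 rfl g21 fun x hx => ?_).frame.mono ?_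
    · rw [e2, hrep.weight x hx]
      exact hammingNorm_le_card_fintype.trans (by simpa using hj.le)
    rintro s₃ t₃ ⟨⟨ht₃, k5, k2⟩, hf₃⟩
    have f3 : s₃.mem 3 = s₂.mem 3 := hf₃.mem 3 (by decide)
    have f4 : s₃.mem 4 = s₂.mem 4 := hf₃.mem 4 (by decide)
    have f6 : s₃.mem 6 = s₂.mem 6 := hf₃.mem 6 (by decide)
    have f26 : s₃.reg 26 = s₂.reg 26 := hf₃.reg 26 (by decide)
    refine ⟨by omega, by rw [f4]; exact g4, by rw [f6]; exact g6, ?_, fun i hi => ?_,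
      by rw [f26]; exact g26⟩
    · rw [e2] at k2
      exact hrep.succ hrow k2 (by rw [f3]; exact gmk)
    · rw [k5, Function.update_apply]
      split_ifs with hij'
      · rw [hij']; exact ⟨g21, hrow⟩
      · rw [e5]; exact hrows i (by omega)

/-! ### The code -/

/-- The distance of `y` from the codeword of the information word with number `x`. -/
def codewordDist {n k : ℕ} (y : Word n) (x : ℕ) : ℕ :=
  hammingDist y fun i : Fin n => greedyMatrix k i ⬝ᵥ toWord k x

theorem exists_closest {n : ℕ} (k : ℕ) (y : Word n) :
    ∃ x, x < 2 ^ k ∧ ∀ z < 2 ^ k, codewordDist (k := k) y x ≤ codewordDist (k := k) y z := by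
  obtain ⟨x, hx, hmin⟩ := Finset.exists_min_image (Finset.range (2 ^ k))
    (codewordDist (k := k) y) ⟨0, by simp⟩
  exact ⟨x, Finset.mem_range.mp hx, fun z hz => hmin z (Finset.mem_range.mpr hz)⟩

open Classical in
/-- The number of the first information word whose codeword is closest to `y`. -/
def closest {n : ℕ} (k : ℕ) (y : Word n) : ℕ := Nat.find (exists_closest k y)

open Classical in
theorem closest_spec {n : ℕ} (k : ℕ) (y : Word n) : closest k y < 2 ^ k ∧
    ∀ z < 2 ^ k, codewordDist (k := k) y (closest k y) ≤ codewordDist (k := k) y z :=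
  Nat.find_spec (exists_closest k y)

open Classical in
theorem closest_le {n k x : ℕ} {y : Word n} (hx : x < 2 ^ k)
    (h : ∀ z < 2 ^ k, codewordDist (k := k) y x ≤ codewordDist (k := k) y z) : closest k y ≤ x :=
  Nat.find_min' (exists_closest k y) ⟨hx, h⟩

/-- The code generated by the greedy matrix, with maximum-likelihood decoding. -/
def greedyCode : RatelessCode where
  enc k m i := greedyMatrix k i ⬝ᵥ m
  dec _ k y := toWord k (closest k y)

theorem greedyCode_isGeneratedBy : greedyCode.IsGeneratedBy greedyMatrix := fun _ _ _ => rfl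

theorem greedyCode_isSystematic : greedyCode.IsSystematic := fun k m =>
  prefix_eq (isGreedyMatrix_greedyMatrix k) m

theorem greedyCode_isMaximumLikelihood : greedyCode.IsMaximumLikelihood := by
  intro n k y m
  obtain ⟨x, hx, rfl⟩ := exists_toWord m
  exact (closest_spec k y).2 x hx

/-! ### The encoder and the decoder as programs -/

theorem initialState_mem_zero (k n : ℕ) {l : ℕ} (x : Word l) (i : Fin l) :
    (initialState k n x).mem 0 i = (x i).val := by
  simp [initialState]

theorem initialState_mem (k n : ℕ) {l : ℕ} (x : Word l) {A : ℕ} (hA : A ≠ 0) (c : ℕ) :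
    (initialState k n x).mem A c = 0 := by
  simp [initialState, hA]

/-- As `n + 1 ≤ 2 ^ (log n + 1)`, the left side has at most `6 + 2 k + 2 (log n + 1)` bits. -/
theorem fits_of_word_size {c k n : ℕ} (hc : 10 ≤ c) :
    64 * ((2 ^ k * 2 ^ k) * ((n + 1) * (n + 1))) ≤ 2 ^ (c * (k + Nat.log 2 n + 1)) := by
  have h1 : n + 1 ≤ 2 ^ (Nat.log 2 n + 1) := Nat.lt_pow_succ_log_self (by norm_num) n
  calc 64 * ((2 ^ k * 2 ^ k) * ((n + 1) * (n + 1)))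
      ≤ 2 ^ 6 * ((2 ^ k * 2 ^ k) * (2 ^ (Nat.log 2 n + 1) * 2 ^ (Nat.log 2 n + 1))) :=
        Nat.mul_le_mul (by norm_num) (Nat.mul_le_mul_left _ (Nat.mul_le_mul h1 h1))
    _ = 2 ^ (6 + (k + k + (Nat.log 2 n + 1 + (Nat.log 2 n + 1)))) := by
        simp only [pow_add]
    _ ≤ 2 ^ (10 * (k + Nat.log 2 n + 1)) := Nat.pow_le_pow_right (by norm_num) (by omega)
    _ ≤ 2 ^ (c * (k + Nat.log 2 n + 1)) :=
        Nat.pow_le_pow_right (by norm_num) (Nat.mul_le_mul_right _ hc)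

theorem toWord_apply_val (k x : ℕ) (i : Fin k) :
    (toWord k x i).val = x / 2 ^ (k - 1 - (i : ℕ)) % 2 := by
  rw [toWord, ZMod.val_natCast]

theorem dotProduct_toWord_val (k a b : ℕ) :
    (toWord k a ⬝ᵥ toWord k b).val = bitDot k a b % 2 := by
  rw [toWord_dotProduct, ZMod.val_natCast]

/-- Set up the tables and compute the first `n` rows of the greedy matrix. -/
def prepare : Program := .seq setup greedyProgram

theorem wp_prepare {k n l c : ℕ} (hk : 0 < k) (hc : 10 ≤ c) (x : Word l) :
    WP (c * (k + Nat.log 2 n + 1)) prepare (initialState k n x) fun s t =>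
      t ≤ 2 ^ k * 2 ^ k * (k * 32 + 32) + k * 32 + 16 +
        (n * (2 ^ k * 2 ^ k * 400 + 2 ^ k * 32 + 32) + 8) ∧
      Context k n (c * (k + Nat.log 2 n + 1)) s ∧
      (∀ i : Fin l, s.mem 0 i = (x i).val) ∧
      ∀ i < n, s.mem 5 i < 2 ^ k ∧ toWord k (s.mem 5 i) = greedyMatrix k i := by
  refine wp_seq.mpr ((wp_setup (k := k) (n := n) (by simp [initialState]) (by simp [initialState])
    (fits_of_word_size hc)).frame.mono ?_)
  rintro s₁ t₁ ⟨⟨ht₁, hc₁⟩, hf₁⟩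
  have hz : ∀ A, A ∉ setup.arrays → A ≠ 0 → ∀ c, s₁.mem A c = 0 := fun A hA hA0 c => by
    rw [hf₁.mem A hA]
    exact initialState_mem k n x hA0 c
  refine (wp_greedyProgram hk hc₁ (hz 2 (by decide) (by norm_num)) (hz 3 (by decide) (by norm_num))
    (hz 4 (by decide) (by norm_num)) (hz 6 (by decide) (by norm_num))).frame.mono ?_
  rintro s₂ t₂ ⟨⟨ht₂, hrows⟩, hf₂⟩
  refine ⟨by omega, hc₁.of_frame hf₂ (by decide), fun i => ?_, hrows⟩
  rw [hf₂.mem 0 (by decide), hf₁.mem 0 (by decide)]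
  exact initialState_mem_zero k n x i

/-- Read the information word. -/
def readWord : Program :=
  .block [.const 27 0, .forLoop 10 0 <| .block [.load 11 0 10, .arith .add 27 27 27,
    .arith .add 27 27 11]]

/-- Horner's scheme from the most significant bit: after `m` bits the register holds `x / 2 ^ (k -
m)`. -/
theorem wp_readWord {k n w x : ℕ} {s : MachineState} (hc : Context k n w s) (hx : x < 2 ^ k)
    (h0 : ∀ i : Fin k, s.mem 0 i = (toWord k x i).val) :
    WP w readWord s fun s' t => t ≤ k * 32 + 4 ∧ s'.reg 27 = x := by
  have hb := hc.bounds
  have hk : k < 2 ^ k := Nat.lt_two_pow_self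
  have hw1 := Nat.one_le_two_pow (n := w)
  simp only [readWord, Program.block, wp_seq, wp_const]
  refine ⟨by omega, ?_⟩
  have hc' := hc.setReg (show 7 ≤ 27 by norm_num) 0
  refine (wp_for (N := k) (T := 30) (fun m s' => s'.reg 27 = x / 2 ^ (k - m))
    (by decide) hc'.reg2 hc'.reg0 (by omega) (fun m s v h => by simpa using h)
    (by simp [Nat.div_eq_of_lt hx]) ?_).mono
    fun s' t h => ⟨by omega, by simpa using h.2.1⟩
  intro m hm s₁ hf him hI
  have e0 := hf.mem 0 (by decide)
  simp at e0
  have hbit : s.mem 0 m = x / 2 ^ (k - 1 - m) % 2 := by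
    have := h0 ⟨m, hm⟩
    rwa [toWord_apply_val] at this
  have hpow : x / 2 ^ (k - m) = x / 2 ^ (k - 1 - m) / 2 := by
    rw [show k - m = (k - 1 - m) + 1 by omega, pow_succ, Nat.div_div_eq_div_mul]
  have hle : x / 2 ^ (k - 1 - m) ≤ x := Nat.div_le_self _ _
  have hsub : k - (m + 1) = k - 1 - m := by omega
  simp [him, hI, e0, hbit, hpow, hsub]
  omega

/-- Write the encoding. -/
def writeCodeword : Program :=
  .forLoop 10 1 <| .block [.load 11 5 10, .arith .mul 11 11 3, .arith .add 11 11 27,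
    .load 11 7 11, .store 1 10 11]

theorem wp_writeCodeword {k n w x : ℕ} {s : MachineState} (hc : Context k n w s) (hx : x < 2 ^ k)
    (h27 : s.reg 27 = x) (h5 : ∀ i < n, s.mem 5 i < 2 ^ k) :
    WP w writeCodeword s fun s' t => t ≤ n * 32 + 2 ∧
      ∀ i < n, s'.mem 1 i = bitDot k (s.mem 5 i) x % 2 := by
  have hb := hc.bounds
  refine (wp_for (N := n) (T := 30) (fun m s' => ∀ i < m, s'.mem 1 i = bitDot k (s.mem 5 i) x % 2)
    (by decide) hc.reg2 hc.reg1 (by omega) (fun m s v h => h) (by simp) ?_).mono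
    fun s' t h => ⟨h.1, h.2.1⟩
  intro m hm s₁ hf him hI
  have hc₁ := hc.of_frame hf (by decide)
  have e5 := hf.mem 5 (by decide)
  have e27 := (hf.reg 27 (by decide)).trans h27
  have h5m := h5 m hm
  have hdot := hc₁.table _ h5m x hx
  have hlt : s.mem 5 m * 2 ^ k ≤ 2 ^ k * 2 ^ k := Nat.mul_le_mul_right _ h5m.le
  simp [him, e5, e27, hc₁.reg3, hdot, -Order.lt_add_one_iff]
  refine ⟨by omega, by omega, fun i hi => ?_⟩
  rw [Function.update_apply]
  split_ifs with h
  · rw [h]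
  · exact hI i (by omega)

/-- The encoder. -/
def encoder : Program := .block [prepare, readWord, writeCodeword]

/-- Each monomial in the running times divides into `n k K ^ 2` with a cofactor of at least one;
here `K = 2 ^ k`. With these bounds the final estimates are linear. -/
theorem total_time_le {n k K : ℕ} (hn : 1 ≤ n) (hk : 1 ≤ k) (hK : 1 ≤ K) :
    k * (K * K) ≤ n * k * (K * K) ∧ n * (K * K) ≤ n * k * (K * K) ∧ K * K ≤ n * k * (K * K) ∧
      n * K ≤ n * k * (K * K) ∧ n ≤ n * k * (K * K) ∧ k ≤ n * k * (K * K) ∧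
      K ≤ n * k * (K * K) ∧ 1 ≤ n * k * (K * K) := by
  have hKK : 1 ≤ K * K := Nat.mul_pos hK hK
  have h1 : K ≤ K * K := Nat.le_mul_of_pos_left K hK
  have hnk : n ≤ n * k := Nat.le_mul_of_pos_right n hk
  have hkn : k ≤ n * k := Nat.le_mul_of_pos_left k hn
  have hp : 1 ≤ n * k := Nat.mul_pos hn hk
  have h2 := Nat.mul_le_mul_right (K * K) hnk
  have h3 := Nat.mul_le_mul_right (K * K) hkn
  have h4 := Nat.mul_le_mul_right (K * K) hp
  have h5 := Nat.mul_le_mul_left n h1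
  have h6 := Nat.mul_le_mul_left n hKK
  have h7 := Nat.mul_le_mul_left k hKK
  omega

theorem greedyCode_encodesInTime :
    greedyCode.EncodesInTime fun k n => n * k * 2 ^ (2 * k) := by
  refine ⟨encoder, 5000, fun k n hk hn m => ?_⟩
  obtain ⟨x, hx, rfl⟩ := exists_toWord m
  have h : WP (5000 * (k + Nat.log 2 n + 1)) encoder (initialState k n (toWord k x)) fun s t =>
      t ≤ 5000 * (n * k * 2 ^ (2 * k)) ∧
        ∀ i : Fin n, s.mem 1 i = (greedyCode.encPrefix n (toWord k x) i).val := by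
    simp only [encoder, Program.block, wp_seq]
    refine (wp_prepare hk (by norm_num) _).frame.mono ?_
    rintro s₁ t₁ ⟨⟨ht₁, hc₁, hin, hrows⟩, hf₁⟩
    refine (wp_readWord hc₁ hx hin).frame.mono ?_
    rintro s₂ t₂ ⟨⟨ht₂, h27⟩, hf₂⟩
    have hc₂ := hc₁.of_frame hf₂ (by decide)
    have e5 := hf₂.mem 5 (by decide)
    refine (wp_writeCodeword hc₂ hx h27 (by rw [e5]; exact fun i hi => (hrows i hi).1)).mono ?_
    rintro s₃ t₃ ⟨ht₃, hout⟩
    refine ⟨?_, fun i => ?_⟩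
    · obtain ⟨a1, a2, a3, a4, a5, a6, a7, a8⟩ := total_time_le hn hk (Nat.one_le_two_pow (n := k))
      rw [show 2 ^ (2 * k) = 2 ^ k * 2 ^ k by rw [two_mul, pow_add]]
      generalize 2 ^ k = K at *
      have b1 : K * K * (k * 32 + 32) = 32 * (k * (K * K)) + 32 * (K * K) := by ring
      have b2 : n * (K * K * 400 + K * 32 + 32) = 400 * (n * (K * K)) + 32 * (n * K) + 32 * n := by
        ring
      omega
    · rw [hout i i.2, e5, ← dotProduct_toWord_val, (hrows i i.2).2]
      rfl
  obtain ⟨s, t, hr, ht, hout⟩ := h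
  exact ⟨s, t, hr, ht, hout⟩

/-- Compute in register `24` the distance of the input from the codeword of the information word
with number in register `22`. -/
def distProgram : Program :=
  .block [.const 24 0, .forLoop 10 1 <| .block [.load 11 5 10, .arith .mul 11 11 3,
    .arith .add 11 11 22, .load 11 7 11, .load 12 0 10,
    .branch 11 12 (.arith .add 24 24 2) (.branch 12 11 (.arith .add 24 24 2) .skip)]]

theorem wp_distProgram {k n w x : ℕ} {y : Word n} {s : MachineState} (hc : Context k n w s)
    (hx : x < 2 ^ k) (h22 : s.reg 22 = x) (hin : ∀ i : Fin n, s.mem 0 i = (y i).val)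
    (hrows : ∀ i < n, s.mem 5 i < 2 ^ k ∧ toWord k (s.mem 5 i) = greedyMatrix k i) :
    WP w distProgram s fun s' t => t ≤ n * 32 + 4 ∧ s'.reg 24 = codewordDist (k := k) y x := by
  have hb := hc.bounds
  have hw1 := Nat.one_le_two_pow (n := w)
  simp only [distProgram, Program.block, wp_seq, wp_const]
  refine ⟨by omega, ?_⟩
  have hc' := hc.setReg (show 7 ≤ 24 by norm_num) 0
  refine (wp_for (N := n) (T := 30) (fun m s' => s'.reg 24 =
    ∑ i ∈ Finset.range m, if s.mem 0 i ≠ bitDot k (s.mem 5 i) x % 2 then 1 else 0)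
    (by decide) hc'.reg2 hc'.reg1 (by omega) (fun m s v h => by simpa using h) (by simp) ?_).mono
    fun s' t h => ⟨by omega, ?_⟩
  · intro m hm s₁ hf him hI
    have hc₁ := hc'.of_frame hf (by decide)
    have e0 := hf.mem 0 (by decide)
    have e5 := hf.mem 5 (by decide)
    have e22 := hf.reg 22 (by decide)
    simp [h22] at e0 e5 e22
    have h5m := (hrows m hm).1
    have hdot := hc₁.table _ h5m x hx
    have hlt : s.mem 5 m * 2 ^ k ≤ 2 ^ k * 2 ^ k := Nat.mul_le_mul_right _ h5m.le
    have hle : s₁.reg 24 ≤ m := by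
      rw [hI]
      exact sum_ite_le m _ (fun _ => 1) fun _ => le_rfl
    rw [Finset.sum_range_succ, ← hI]
    simp [him, e0, e5, e22, hc₁.reg3, hc₁.reg2, hdot]
    refine ⟨by omega, by omega, ?_⟩
    generalize bitDot k (s.mem 5 m) x % 2 = u
    generalize s.mem 0 m = v
    split_ifs <;> omega
  · rw [h.2.1, codewordDist, hammingDist, Finset.card_filter, Finset.sum_range]
    refine Finset.sum_congr rfl fun i _ => if_congr ?_ rfl rfl
    rw [hin i, ← dotProduct_toWord_val, (hrows i i.2).2]
    exact (ZMod.val_injective 2).ne_iff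

/-- Find the first information word whose codeword is closest to the input. -/
def findClosest : Program :=
  .block [.arith .add 28 1 2, .forLoop 22 3 <| .block [distProgram,
    .branch 24 28 (.block [.arith .add 28 24 6, .arith .add 29 22 6]) .skip]]

theorem wp_findClosest {k n w : ℕ} {y : Word n} {s : MachineState} (hc : Context k n w s)
    (hin : ∀ i : Fin n, s.mem 0 i = (y i).val)
    (hrows : ∀ i < n, s.mem 5 i < 2 ^ k ∧ toWord k (s.mem 5 i) = greedyMatrix k i) :
    WP w findClosest s fun s' t => t ≤ 2 ^ k * (n * 32 + 32) + 4 ∧ s'.reg 29 = closest k y := by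
  have hb := hc.bounds
  have hw1 := Nat.one_le_two_pow (n := w)
  have hK : 0 < 2 ^ k := Nat.two_pow_pos k
  simp only [findClosest, Program.block, wp_seq, wp_arith, ArithOp.eval]
  simp [hc.reg1, hc.reg2]
  refine ⟨by omega, ?_⟩
  have hc' := hc.setReg (show 7 ≤ 28 by norm_num) (n + 1)
  have hdist : ∀ x, codewordDist (k := k) y x ≤ n := fun x =>
    hammingDist_le_card_fintype.trans (by simp)
  -- Before the first round register `28` holds `n + 1`, larger than any distance, so word `0` is
  -- always accepted. Later a strict improvement is required, so the first of several closest words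
  -- is kept, as in `closest`.
  refine (wp_for (T := n * 32 + 30) (fun m s' => (m = 0 ∧ s'.reg 28 = n + 1) ∨
      (s'.reg 29 < m ∧ s'.reg 28 = codewordDist (k := k) y (s'.reg 29) ∧
        ∀ z < m, codewordDist (k := k) y (s'.reg 29) ≤ codewordDist (k := k) y z ∧
          (codewordDist (k := k) y z = codewordDist (k := k) y (s'.reg 29) → s'.reg 29 ≤ z)))
    (by decide) hc'.reg2 hc'.reg3 (by omega) (fun m s v h => by simpa using h) (by simp) ?_).mono
    fun s' t h => ⟨?_, ?_⟩
  · intro m hm s₁ hf him hI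
    have hc₁ := hc'.of_frame hf (by decide)
    have e0 := hf.mem 0 (by decide)
    have e5 := hf.mem 5 (by decide)
    simp at e0 e5
    simp only [wp_seq]
    refine (wp_distProgram (y := y) hc₁ hm him (by rw [e0]; exact hin)
      (by rw [e5]; exact hrows)).frame.mono ?_
    rintro s₂ t₂ ⟨⟨ht₂, h24⟩, hf₂⟩
    have f28 := hf₂.reg 28 (by decide)
    have f29 := hf₂.reg 29 (by decide)
    have f22 := (hf₂.reg 22 (by decide)).trans him
    have f6 := (hf₂.reg 6 (by decide)).trans hc₁.reg6
    have hdm := hdist m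
    simp [f28, f29, f22, f6, h24, -Order.lt_add_one_iff]
    rw [← f29, ← f28] at hI
    rw [← f28]
    have hsucc : ∀ (p : ℕ → Prop), (∀ z < m, p z) → p m → ∀ z < m + 1, p z := by
      intro p h1 h2 z hz
      rcases Nat.lt_succ_iff_lt_or_eq.mp hz with hz | rfl
      · exact h1 z hz
      · exact h2
    split_ifs with hlt
    · refine ⟨by omega, by omega, by omega, hsucc _ (fun z hz => ?_) ⟨le_rfl, fun _ => le_rfl⟩⟩
      rcases hI with ⟨rfl, _⟩ | ⟨_, h28, hmin⟩
      · omega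
      · have := (hmin z hz).1
        exact ⟨by omega, fun _ => by omega⟩
    · rcases hI with ⟨_, h28⟩ | ⟨hlt', h28, hmin⟩
      · omega
      · rw [← f29]
        refine ⟨by omega, by omega, h28, hsucc _ hmin ⟨by omega, fun _ => by omega⟩⟩
  · have h1 : t ≤ 2 ^ k * (n * 32 + 32) + 2 := h.1
    omega
  · rcases h.2.1 with ⟨h0, _⟩ | ⟨hlt, _, hmin⟩
    · omega
    · have hspec := closest_spec k y
      apply le_antisymm
      · exact (hmin _ hspec.1).2 (le_antisymm (hspec.2 _ hlt) (hmin _ hspec.1).1)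
      · exact closest_le hlt fun z hz => (hmin z hz).1

/-- Write the information word with number in register `29`. -/
def writeWord : Program :=
  .forLoop 10 0 <| .block [.arith .sub 11 0 2, .arith .sub 11 11 10, .arith .div 12 29 4,
    .arith .add 13 12 12, .arith .sub 13 29 13, .store 1 11 13, .arith .add 29 12 6]

theorem wp_writeWord {k n w x : ℕ} {s : MachineState} (hc : Context k n w s) (hx : x < 2 ^ k)
    (h29 : s.reg 29 = x) :
    WP w writeWord s fun s' t => t ≤ k * 32 + 2 ∧
      ∀ i : Fin k, s'.mem 1 i = (toWord k x i).val := by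
  have hb := hc.bounds
  have hk : k < 2 ^ k := Nat.lt_two_pow_self
  refine (wp_for (N := k) (T := 30) (fun m s' => s'.reg 29 = x / 2 ^ m ∧
      ∀ i < m, s'.mem 1 (k - 1 - i) = x / 2 ^ i % 2)
    (by decide) hc.reg2 hc.reg0 (by omega) (fun m s v h => by simpa using h) (by simp [h29]) ?_).mono
    fun s' t h => ⟨h.1, fun i => ?_⟩
  · intro m hm s₁ hf him ⟨i29, hI⟩
    have hc₁ := hc.of_frame hf (by decide)
    have hle : x / 2 ^ m ≤ x := Nat.div_le_self _ _
    simp [him, i29, hc₁.reg0, hc₁.reg2, hc₁.reg4, hc₁.reg6, pow_succ, ← Nat.div_div_eq_div_mul,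
      -Order.lt_add_one_iff]
    refine ⟨by omega, by omega, by omega, by omega, by omega, by omega, fun i hi => ?_⟩
    rw [Function.update_apply]
    split_ifs with h
    · obtain rfl : i = m := by omega
      omega
    · refine hI i ?_
      by_contra hlt
      obtain rfl : i = m := by omega
      exact h rfl
  · rw [toWord_apply_val, ← h.2.1.2 (k - 1 - i) (by omega)]
    congr 1
    omega

/-- The decoder. -/
def decoder : Program := .block [prepare, findClosest, writeWord]

theorem greedyCode_decodesInTime :
    greedyCode.DecodesInTime fun k n => n * k * 2 ^ (2 * k) := by
  refine ⟨decoder, 5000, fun k n hk hn y => ?_⟩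
  have h : WP (5000 * (k + Nat.log 2 n + 1)) decoder (initialState k n y) fun s t =>
      t ≤ 5000 * (n * k * 2 ^ (2 * k)) ∧
        ∀ i : Fin k, s.mem 1 i = (greedyCode.dec n k y i).val := by
    simp only [decoder, Program.block, wp_seq]
    refine (wp_prepare hk (by norm_num) _).frame.mono ?_
    rintro s₁ t₁ ⟨⟨ht₁, hc₁, hin, hrows⟩, hf₁⟩
    refine (wp_findClosest hc₁ hin hrows).frame.mono ?_
    rintro s₂ t₂ ⟨⟨ht₂, h29⟩, hf₂⟩
    have hc₂ := hc₁.of_frame hf₂ (by decide)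
    refine (wp_writeWord hc₂ (closest_spec k y).1 h29).mono ?_
    rintro s₃ t₃ ⟨ht₃, hout⟩
    refine ⟨?_, hout⟩
    obtain ⟨a1, a2, a3, a4, a5, a6, a7, a8⟩ := total_time_le hn hk (Nat.one_le_two_pow (n := k))
    rw [show 2 ^ (2 * k) = 2 ^ k * 2 ^ k by rw [two_mul, pow_add]]
    generalize 2 ^ k = K at *
    have b1 : K * K * (k * 32 + 32) = 32 * (k * (K * K)) + 32 * (K * K) := by ring
    have b2 : n * (K * K * 400 + K * 32 + 32) = 400 * (n * (K * K)) + 32 * (n * K) + 32 * n := by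
      ring
    have b3 : K * (n * 32 + 32) = 32 * (n * K) + 32 * K := by ring
    omega
  obtain ⟨s, t, hr, ht, hout⟩ := h
  exact ⟨s, t, hr, ht, hout⟩

end Rateless

end

theorem theorem3 :
    ∃ (C : Rateless.RatelessCode) (G : (k : ℕ) → ℕ → Rateless.Word k),
      -- the code is linear, with a generator matrix built by the greedy algorithm, systematic,
      -- and decoded by maximum likelihood
      C.IsGeneratedBy G ∧ (∀ k, Rateless.IsGreedyMatrix (G k)) ∧
      C.IsSystematic ∧ C.IsMaximumLikelihood ∧
      -- error probability
      (∀ p : ℝ, 0 < p → p < 1 / 2 → ∀ δ : ℝ, 0 < δ → δ < 1 - Rateless.entropy p →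
        ∃ c : ℝ, 0 < c ∧ ∀ k n : ℕ, 2 ≤ n →
          (k : ℝ) / (1 - Rateless.entropy p - δ) ≤ (n : ℝ) →
          C.errorProb p k n ≤ Real.exp (-(c * ((n : ℝ) / Real.log n)))) ∧
      -- complexity
      C.EncodesInTime (fun k n => n * k * 2 ^ (2 * k)) ∧
      C.DecodesInTime (fun k n => n * k * 2 ^ (2 * k)) :=
  ⟨Rateless.greedyCode, Rateless.greedyMatrix, Rateless.greedyCode_isGeneratedBy,
    Rateless.isGreedyMatrix_greedyMatrix, Rateless.greedyCode_isSystematic,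
    Rateless.greedyCode_isMaximumLikelihood,
    fun _ h0 h1 _ hδ hδ1 => Rateless.errorProb_exponent Rateless.greedyCode_isGeneratedBy
      Rateless.isGreedyMatrix_greedyMatrix Rateless.greedyCode_isMaximumLikelihood h0 h1 hδ hδ1,
    Rateless.greedyCode_encodesInTime, Rateless.greedyCode_decodesInTime⟩
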